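/- Let $M$ be a smooth surface (Hausdorff, second countable). All connections below are smooth. \textbf{AH structures.} A Riemannian signature AH structure $([\nabla],[h])$ on $M$ is a pair consisting of a projective equivalence class $[\nabla]$ of torsion-free affine connections (two being equivalent if their difference tensor is $\gamma_i\delta_j{}^k+\gamma_j\delta_i{}^k$ for a one-form $\gamma$, i.e. if they have the same unparameterized geodesics) and a conformal class $[h]$ of Riemannian metrics. Its aligned representative is the unique torsion-free $\nabla\in[\nabla]$ such that, for $h\in[h]$, $\nabla_{[i}h_{j]k}=2\gamma_{[i}h_{j]k}$ with $4\gamma_i=h^{pq}\nabla_ih_{pq}$. Let $R_{ij}$ be the Ricci tensor of the aligned representative, $F_{ij}=-R_{[ij]}$, $H_{ij}=|\det h|^{-1/2}h_{ij}$, and let the weighted scalar curvature be the density $R=H^{ij}R_{ij}=h^{ij}R_{ij}\,|\det h|^{1/2}$. The AH structure is exact if $\nabla_i\det h=0$ for some $h\in[h]$; it is Einstein if $R_{(ij)}=\tfrac12RH_{ij}$ and $\nabla_iR+2H^{pq}\nabla_qF_{ip}=0$. \textbf{The bundle and the Thomas connection.} Let $\rho:\hat M\to M$ be the principal $\mathbb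 R^\times$-bundle whose third power is the bundle of nonzero two-forms on $M$; write $\theta^3$ for the two-form given by $\theta\in\hat M$, $R_r$ for the action of $r\in\mathbb R^\times$, $\mathbb X$ for the vector field generating $R_{e^t}$, $\mu_\theta(X,Y)=\theta^3(T\rho X,T\rho Y)$ for the tautological two-form, and $\Psi=d\mu$. The Thomas connection $\hat\nabla$ of $[\nabla]$ is the unique torsion-free affine connection on $\hat M$ such that: (1) $\hat\nabla_I\mathbb X^J=\delta_I{}^J$; (2) $\hat\nabla\Psi=0$; (3) $\hat\nabla$ is Ricci flat; (4) $R_r^*\hat\nabla=\hat\nabla$ for all $r\in\mathbb R^\times$; (5) the inverse image in $\hat M$ of a projective geodesic of $M$ is a totally geodesic surface tangent to $\mathbb X$; (6) $\hat\nabla_Q\hat R_{IJK}{}^Q=0$. \textbf{Hessian metrics.} A flat (torsion-free) affine connection $\hat\nabla$ and a pseudo-Riemannian metric $g$ form a Hessian metric if $g=\hat\nabla d\phi$ for a globally defined smooth function $\phi$. The Kähler affine Ricci tensor of $(\hat\nabla,g)$ is $-\hat\nabla_I\big(d\log|\det g/\nu^2|\big)_J$, where $\nu$ is any local $\hat\nabla$-parallel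 volume form. The metric is Monge–Ampère if this tensor vanishes, and Einstein (Kähler affine) if it is a constant multiple of $g$. \textbf{Theorem.} Let $([\nabla],[h])$ be an exact Riemannian signature Einstein AH structure on $M$ whose weighted scalar curvature $R$ is negative. Let $\tilde R$ be the function on $\hat M$ with $\tilde R(\theta)=R/|\theta^3|$, and let $\tilde v=(\tilde R^2/4)^{-1/3}$ and $F=-\tfrac32\log\tilde v$. Then the Thomas connection $\hat\nabla$ on $\hat M$ exists, the level sets of $\tilde R$ are smooth surfaces ($\tilde R$ is smooth and $d\tilde R$ vanishes nowhere), and: \begin{enumerate} \item $g=\tfrac12\hat\nabla d\tilde v$ forms with $\hat\nabla$ a Monge–Ampère Hessian metric of Lorentzian signature $(+,-,-)$. With respect to $g$ the level surfaces of $\tilde R$ are spacelike ($g$ is negative definite on their tangent spaces), totally umbilic, and each has constant mean curvature. \item $f=\hat\nabla dF$ forms with $\hat\nabla$ a Hessian metric which is Riemannian (positive definite) and Einstein Kähler affine. With respect to $f$ the level surfaces of $\tilde R$ are totally geodesic. \end{enumerate} -/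

import Mathlib

open Bundle Set
open scoped Manifold ContDiff Topology

/-! ### Affine connections and covariant tensors on a manifold -/

namespace Affine

noncomputable section

variable {E : Type*} [NormedAddCommGroup E] [NormedSpace ℝ E] [FiniteDimensional ℝ E]
  [CompleteSpace E] {H : Type*} [TopologicalSpace H] {I : ModelWithCorners ℝ E H}
  {N : Type*} [TopologicalSpace N] [ChartedSpace H N] [IsManifold I ∞ N]

variable (I N) in
/-- Affine connections, i.e. covariant derivatives on the tangent bundle; `D Y x (X x)` is
the value of `∇_X Y` at `x`. -/
abbrev Connection := CovariantDerivative I E (TangentSpace I : N → Type _)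

/-- A smooth vector field. -/
def IsSmoothField (X : Π x : N, TangentSpace I x) : Prop :=
  ContMDiff I I.tangent ∞ (fun x => (⟨x, X x⟩ : TangentBundle I N))

/-- The vector field extending a tangent vector `v` at `x` which has constant components in the
preferred chart at `x`. All the tensors below are computed at `x` with these extensions. -/
abbrev ext {x : N} (v : TangentSpace I x) : Π y : N, TangentSpace I y :=
  FiberBundle.extend E v

/-- A field of functions of `k` tangent vectors; the covariant `k`-tensor fields are those which
are multilinear at every point. -/
abbrev CoTensor (I : ModelWithCorners ℝ E H) (N : Type*) [TopologicalSpace N]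
    [ChartedSpace H N] (k : ℕ) := Π x : N, (Fin k → TangentSpace I x) → ℝ

/-- The covariant derivative `(∇_u t)(v₀, …, v_{k-1})` of a covariant `k`-tensor field. -/
def covTensor (D : Connection I N) {k : ℕ} (t : CoTensor I N k) (x : N)
    (u : TangentSpace I x) (v : Fin k → TangentSpace I x) : ℝ :=
  mvfderiv I (fun y => t y (fun i => ext (v i) y)) x u
    - ∑ i, t x (Function.update v i (D (ext (v i)) x u))

/-- The differential of a function, as a `1`-tensor. -/
def dOne (F : N → ℝ) : CoTensor I N 1 := fun x v => mvfderiv I F x (v 0)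

/-- The Hessian `∇dF` of a function with respect to a connection. -/
def hess (D : Connection I N) (F : N → ℝ) (x : N) (v w : TangentSpace I x) : ℝ :=
  covTensor D (dOne F) x v ![w]

/-- The exterior derivative of a two-form. -/
def dTwo (om : CoTensor I N 2) : CoTensor I N 3 := fun x v =>
  mvfderiv I (fun y => om y ![ext (v 1) y, ext (v 2) y]) x (v 0)
    - mvfderiv I (fun y => om y ![ext (v 0) y, ext (v 2) y]) x (v 1)
    + mvfderiv I (fun y => om y ![ext (v 0) y, ext (v 1) y]) x (v 2)
    - om x ![VectorField.mlieBracket I (ext (v 0)) (ext (v 1)) x, v 2]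
    + om x ![VectorField.mlieBracket I (ext (v 0)) (ext (v 2)) x, v 1]
    - om x ![VectorField.mlieBracket I (ext (v 1)) (ext (v 2)) x, v 0]

/-- `∇_X Y` as a vector field. -/
def along (D : Connection I N) (X Y : Π x : N, TangentSpace I x) :
    Π x : N, TangentSpace I x := fun x => D Y x (X x)

/-- The curvature `R(u,v)w = ∇_u∇_v w - ∇_v∇_u w - ∇_[u,v] w`. -/
def riemann (D : Connection I N) (x : N) (u v w : TangentSpace I x) : TangentSpace I x :=
  D (along D (ext v) (ext w)) x u - D (along D (ext u) (ext w)) x v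
    - D (ext w) x (VectorField.mlieBracket I (ext u) (ext v) x)

/-- The trace of a linear endomorphism of a tangent space. -/
def trace {x : N} (A : TangentSpace I x → TangentSpace I x) : ℝ :=
  ∑ i, (Module.finBasis ℝ E).coord i (A (Module.finBasis ℝ E i : E))

/-- The Ricci tensor `Ric(v,w) = tr (u ↦ R(u,v)w)`. -/
def ric (D : Connection I N) (x : N) (v w : TangentSpace I x) : ℝ :=
  trace (fun u => riemann D x u v w)

/-- The covariant derivative `(∇_q R)(a,b)c` of the curvature. -/
def covRiemann (D : Connection I N) (x : N) (q a b c : TangentSpace I x) : TangentSpace I x :=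
  D (fun y => riemann D y (ext a y) (ext b y) (ext c y)) x q
    - riemann D x (D (ext a) x q) b c - riemann D x a (D (ext b) x q) c
    - riemann D x a b (D (ext c) x q)

/-- A torsion-free connection with vanishing curvature. -/
def IsFlat (D : Connection I N) : Prop :=
  D.torsion = 0 ∧ ∀ (x : N) (u v w : TangentSpace I x), riemann D x u v w = 0

/-! ### Pseudo-Riemannian metrics -/

variable (I N) in
/-- A smooth pseudo-Riemannian metric. -/
structure PseudoMetric where
  form : Π x : N, LinearMap.BilinForm ℝ (TangentSpace I x)
  symm : ∀ x v w, form x v w = form x w v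
  nondegenerate : ∀ x v, (∀ w, form x v w = 0) → v = 0
  smooth : ∀ X Y : Π x : N, TangentSpace I x, IsSmoothField X → IsSmoothField Y →
    ContMDiff I 𝓘(ℝ, ℝ) ∞ (fun x => form x (X x) (Y x))

/-- Positive definite. -/
def PseudoMetric.IsRiemannian (g : PseudoMetric I N) : Prop :=
  ∀ x v, v ≠ 0 → 0 < g.form x v v

/-- Lorentzian, with signs `(+,-,…,-)`: one positive direction, and negative definite on its
orthogonal complement. -/
def PseudoMetric.IsLorentzian (g : PseudoMetric I N) : Prop :=
  ∀ x, ∃ e, 0 < g.form x e e ∧ ∀ v, g.form x e v = 0 → v ≠ 0 → g.form x v v < 0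

/-- The metric as a `2`-tensor. -/
def PseudoMetric.tensor (g : PseudoMetric I N) : CoTensor I N 2 :=
  fun x v => g.form x (v 0) (v 1)

/-- `L` is the Levi-Civita connection of `g`. -/
def IsLeviCivita (g : PseudoMetric I N) (L : Connection I N) : Prop :=
  CovariantDerivative.ContMDiffCovariantDerivative L ∞ ∧ L.torsion = 0 ∧
    ∀ (x : N) (u : TangentSpace I x) (v : Fin 2 → TangentSpace I x),
      covTensor L g.tensor x u v = 0

/-! ### Hessian metrics and their Kähler affine Ricci tensor -/

/-- A flat affine connection `D` and a metric `g` form a Hessian metric with the globally defined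
potential `F`: `g = ∇dF`. -/
structure IsHessianMetric (D : Connection I N) (g : PseudoMetric I N) (F : N → ℝ) : Prop where
  smooth_connection : CovariantDerivative.ContMDiffCovariantDerivative D ∞
  flat : IsFlat D
  smooth_potential : ContMDiff I 𝓘(ℝ, ℝ) ∞ F
  hessian : ∀ (x : N) (v w : TangentSpace I x), g.form x v w = hess D F x v w

variable (I N) in
/-- A field of top-degree alternating forms. -/
abbrev TopForm := Π x : N, (TangentSpace I x) [⋀^Fin (Module.finrank ℝ E)]→ₗ[ℝ] ℝ

/-- `vol` is a smooth nowhere vanishing `D`-parallel volume form on `U`. For a flat affine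
connection these are, locally, the constant multiples of `dx¹ ∧ ⋯ ∧ dxⁿ`, in affine coordinates. -/
structure IsParallelVolume (D : Connection I N) (vol : TopForm I N) (U : Set N) : Prop where
  smooth : ∀ X : Fin (Module.finrank ℝ E) → Π x : N, TangentSpace I x,
    (∀ i, IsSmoothField (X i)) → ContMDiffOn I 𝓘(ℝ, ℝ) ∞ (fun x => vol x (fun i => X i x)) U
  ne_zero : ∀ x ∈ U, vol x ≠ 0
  parallel : ∀ x ∈ U, ∀ u v, covTensor D (fun y => vol y) x u v = 0

/-- The function `det_vol g = (det g) / vol²`. -/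
def detRatio (g : PseudoMetric I N) (vol : TopForm I N) (x : N) : ℝ :=
  (Matrix.of fun i j => g.form x (Module.finBasis ℝ E i : E) (Module.finBasis ℝ E j : E)).det
    / (vol x (fun i => (Module.finBasis ℝ E i : E))) ^ 2

/-- `r` is the Ricci tensor of the Kähler affine metric `(D, g)`: around each point there is a
parallel volume form `vol` with `r = -∇ d log |det_vol g|`. The right-hand side does not
depend on the choice of `vol`. -/
def HasKahlerAffineRicci (D : Connection I N) (g : PseudoMetric I N)
    (r : Π x : N, TangentSpace I x → TangentSpace I x → ℝ) : Prop :=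
  ∀ p : N, ∃ (U : Set N) (vol : TopForm I N), IsOpen U ∧ p ∈ U ∧ IsParallelVolume D vol U ∧
    ∀ x ∈ U, ∀ v w, r x v w = - hess D (fun y => Real.log |detRatio g vol y|) x v w

/-- Kähler affine Einstein: the Kähler affine Ricci tensor is a constant multiple of `g`. -/
def IsKahlerAffineEinstein (D : Connection I N) (g : PseudoMetric I N) : Prop :=
  ∃ c : ℝ, HasKahlerAffineRicci D g (fun x v w => c * g.form x v w)

/-- Monge-Ampère: Kähler affine Ricci flat. -/
def IsMongeAmpere (D : Connection I N) (g : PseudoMetric I N) : Prop :=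
  HasKahlerAffineRicci D g (fun _ _ _ => 0)

/-! ### Level sets -/

/-- `φ` is smooth and its differential vanishes nowhere, so that its level sets are smoothly
embedded hypersurfaces, with tangent space `ker dφ`. -/
def HasSmoothLevelSets (I : ModelWithCorners ℝ E H) (φ : N → ℝ) : Prop :=
  ContMDiff I 𝓘(ℝ, ℝ) ∞ φ ∧ ∀ x, mvfderiv I φ x ≠ 0

/-- The tangent space at `x` of the level set of `φ` through `x`. -/
def levelTangent (I : ModelWithCorners ℝ E H) (φ : N → ℝ) (x : N) :
    Submodule ℝ (TangentSpace I x) := LinearMap.ker (mvfderiv I φ x).toLinearMap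

/-- A smooth field `ν` of unit normals to the level sets of `φ`. -/
def IsUnitNormal (g : PseudoMetric I N) (φ : N → ℝ) (ν : Π x : N, TangentSpace I x) : Prop :=
  IsSmoothField ν ∧ ∀ x, |g.form x (ν x) (ν x)| = 1 ∧
    ∀ v ∈ levelTangent I φ x, g.form x (ν x) v = 0

/-- The second fundamental form `II(v,w) = g(∇_v W, ν) = -g(∇_v ν, w)` of the level set
through `x` (for tangent vectors `v`, `w` of the level set), `L` being the Levi-Civita
connection and `ν` the unit normal. -/
def secondForm (g : PseudoMetric I N) (L : Connection I N) (ν : Π x : N, TangentSpace I x)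
    (x : N) (v w : TangentSpace I x) : ℝ := - g.form x (L ν x v) w

/-- At `x` the second fundamental form is a multiple of the induced metric. -/
def IsUmbilicAt (g : PseudoMetric I N) (L : Connection I N) (φ : N → ℝ)
    (ν : Π x : N, TangentSpace I x) (x : N) : Prop :=
  ∃ l : ℝ, ∀ v ∈ levelTangent I φ x, ∀ w ∈ levelTangent I φ x,
    secondForm g L ν x v w = l * g.form x v w

/-- For level surfaces of a function on a three-manifold: the mean curvature at `x`, half the
trace of the second fundamental form with respect to the induced metric, is `m`. -/
def HasMeanCurvatureAt (g : PseudoMetric I N) (L : Connection I N) (φ : N → ℝ)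
    (ν : Π x : N, TangentSpace I x) (x : N) (m : ℝ) : Prop :=
  ∀ e : Fin 2 → TangentSpace I x, LinearIndependent ℝ e → (∀ i, e i ∈ levelTangent I φ x) →
    2 * m = ∑ i, ∑ j, (Matrix.of fun a b => g.form x (e a) (e b))⁻¹ i j
      * secondForm g L ν x (e i) (e j)

/-- The level set `φ = c` is totally geodesic: `∇_X Y` is tangent to it for all vector fields `X`,
`Y` that are tangent to it along it. -/
def IsTotallyGeodesicLevel (L : Connection I N) (φ : N → ℝ) (c : ℝ) : Prop :=
  ∀ X Y : Π x : N, TangentSpace I x, IsSmoothField X → IsSmoothField Y →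
    (∀ x, φ x = c → X x ∈ levelTangent I φ x) → (∀ x, φ x = c → Y x ∈ levelTangent I φ x) →
    ∀ x, φ x = c → L Y x (X x) ∈ levelTangent I φ x

end

end Affine

/-! ### AH structures on surfaces -/

namespace AH

open Affine

noncomputable section

/-- The model plane. -/
abbrev Plane := EuclideanSpace ℝ (Fin 2)

variable (M : Type*) [TopologicalSpace M] [ChartedSpace Plane M] [IsManifold (𝓡 2) ∞ M]

/-- A smooth torsion-free affine connection. -/
structure TorsionFree where
  conn : Connection (𝓡 2) M
  smooth : CovariantDerivative.ContMDiffCovariantDerivative conn ∞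
  torsion_eq : conn.torsion = 0

/-- A smooth Riemannian metric. -/
abbrev Metric := ContMDiffRiemannianMetric (𝓡 2) ∞ Plane (TangentSpace (𝓡 2) : M → Type _)

variable {M}

/-- Projective equivalence of torsion-free connections: the difference tensor is
`γ_i δ_j^k + γ_j δ_i^k` for a one-form `γ` (equivalently, they have the same unparameterized
geodesics). -/
def ProjEquiv (D D' : TorsionFree M) : Prop :=
  ∃ γ : Π x : M, TangentSpace (𝓡 2) x →ₗ[ℝ] ℝ,
    ∀ (Y : Π x : M, TangentSpace (𝓡 2) x) (x : M),
      MDifferentiableAt (𝓡 2) (𝓡 2).tangent (fun y => (⟨y, Y y⟩ : TangentBundle (𝓡 2) M)) x →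
      ∀ u : TangentSpace (𝓡 2) x,
        D'.conn Y x u = D.conn Y x u + (γ x u) • Y x + (γ x (Y x)) • u

/-- Conformal equivalence of metrics. -/
def ConfEquiv (h h' : Metric M) : Prop :=
  ∃ φ : M → ℝ, (∀ x, 0 < φ x) ∧ ∀ x v w, h'.inner x v w = φ x * h.inner x v w

variable (M)

instance projSetoid : Setoid (TorsionFree M) where
  r := ProjEquiv
  iseqv := by
    refine ⟨fun D => ⟨fun _ => 0, by simp⟩, ?_, ?_⟩
    · rintro D D' ⟨γ, h⟩
      refine ⟨fun x => - γ x, fun Y x hY u => ?_⟩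
      rw [h Y x hY u]
      simp only [LinearMap.neg_apply, neg_smul]
      abel
    · rintro D D' D'' ⟨γ, h⟩ ⟨γ', h'⟩
      refine ⟨fun x => γ x + γ' x, fun Y x hY u => ?_⟩
      rw [h' Y x hY u, h Y x hY u]
      simp only [LinearMap.add_apply, add_smul]
      abel

instance confSetoid : Setoid (Metric M) where
  r := ConfEquiv
  iseqv := by
    refine ⟨fun h => ⟨fun _ => 1, by simp⟩, ?_, ?_⟩
    · rintro h h' ⟨φ, hp, he⟩
      refine ⟨fun x => (φ x)⁻¹, fun x => inv_pos.2 (hp x), fun x v w => ?_⟩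
      rw [he x v w, ← mul_assoc, inv_mul_cancel₀ (hp x).ne', one_mul]
    · rintro h h' h'' ⟨φ, hp, he⟩ ⟨ψ, hq, hf⟩
      refine ⟨fun x => ψ x * φ x, fun x => mul_pos (hq x) (hp x), fun x v w => ?_⟩
      rw [hf x v w, he x v w, mul_assoc]

/-- A projective structure: a projective equivalence class of torsion-free connections. -/
abbrev ProjectiveStructure := Quotient (projSetoid M)

/-- A Riemannian signature conformal structure. -/
abbrev ConformalStructure := Quotient (confSetoid M)

/-- A Riemannian signature AH structure on a surface: a projective structure and a conformal
structure (in dimension two the compatibility of the two is automatic). -/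
structure Structure where
  proj : ProjectiveStructure M
  conf : ConformalStructure M

variable {M}

/-- The standard basis of the tangent space, in the preferred chart. -/
def e (x : M) (i : Fin 2) : TangentSpace (𝓡 2) x := (EuclideanSpace.single i (1 : ℝ) : Plane)

/-- The matrix `h_ij`. -/
def gram (h : Metric M) (x : M) : Matrix (Fin 2) (Fin 2) ℝ :=
  Matrix.of fun i j => h.inner x (e x i) (e x j)

/-- The metric trace `h^{ij} B_ij`. -/
def trH (h : Metric M) (x : M)
    (B : TangentSpace (𝓡 2) x → TangentSpace (𝓡 2) x → ℝ) : ℝ :=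
  ∑ i, ∑ j, (gram h x)⁻¹ i j * B (e x i) (e x j)

/-- The metric as a `2`-tensor. -/
def metricTensor (h : Metric M) : CoTensor (𝓡 2) M 2 := fun x v => h.inner x (v 0) (v 1)

/-- The section `det h` of the square of the bundle of two-forms, as a `4`-tensor:
its value on `(v₀, v₁; v₂, v₃)` is `det (h(v_i, v_{2+j}))`. -/
def detTensor (h : Metric M) : CoTensor (𝓡 2) M 4 := fun x v =>
  h.inner x (v 0) (v 2) * h.inner x (v 1) (v 3) - h.inner x (v 0) (v 3) * h.inner x (v 1) (v 2)

/-- `∇_i h_jk`. -/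
def nablaMetric (D : TorsionFree M) (h : Metric M) (x : M) (u v w : TangentSpace (𝓡 2) x) : ℝ :=
  covTensor D.conn (metricTensor h) x u ![v, w]

/-- The Faraday primitive `γ_i = (1/4) h^{pq} ∇_i h_pq`. -/
def faradayPrimitive (D : TorsionFree M) (h : Metric M) (x : M)
    (u : TangentSpace (𝓡 2) x) : ℝ :=
  (1 / 4) * trH h x (fun v w => nablaMetric D h x u v w)

/-- `∇_[i h_j]k = 2 γ_[i h_j]k`, where `4 γ_i = h^{pq} ∇_i h_pq`. -/
def AlignedWith (D : TorsionFree M) (h : Metric M) : Prop :=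
  ∀ (x : M) (u v w : TangentSpace (𝓡 2) x),
    nablaMetric D h x u v w - nablaMetric D h x v u w =
      2 * (faradayPrimitive D h x u * h.inner x v w - faradayPrimitive D h x v * h.inner x u w)

/-- The trace `h^{ij} R_ij` of the Ricci tensor. -/
def scal (D : TorsionFree M) (h : Metric M) (x : M) : ℝ := trH h x (ric D.conn x)

/-- The Faraday form `F_ij = -R_[ij]`. -/
def faraday (D : TorsionFree M) : CoTensor (𝓡 2) M 2 := fun x v =>
  - (ric D.conn x (v 0) (v 1) - ric D.conn x (v 1) (v 0)) / 2

namespace Structure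

variable (A : Structure M)

/-- `D` is the aligned representative of the projective structure. -/
def IsAligned (D : TorsionFree M) : Prop :=
  (Quotient.mk _ D : ProjectiveStructure M) = A.proj ∧
    ∀ h : Metric M, (Quotient.mk _ h : ConformalStructure M) = A.conf → AlignedWith D h

/-- Exact: `∇ det h = 0` for the aligned representative `∇` and some metric `h` of the
conformal structure. -/
def IsExact : Prop :=
  ∃ (D : TorsionFree M) (h : Metric M), A.IsAligned D ∧
    (Quotient.mk _ h : ConformalStructure M) = A.conf ∧
    ∀ x u v, covTensor D.conn (detTensor h) x u v = 0

/-- Einstein: the trace-free symmetric part of the Ricci tensor of the aligned representative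
vanishes, i.e. `R_(ij) = (1/2) (h^{pq}R_pq) h_ij`, and the weighted scalar curvature
`R = h^{ij}R_ij |det h|^{1/2}` satisfies `∇_i R + 2 ∇^p F_ip = 0`. The second
equation is written after division by `|det h|^{1/2}`, using
`∇_i |det h|^{1/2} = 2 γ_i |det h|^{1/2}`. -/
def IsEinstein : Prop :=
  ∀ (D : TorsionFree M) (h : Metric M), A.IsAligned D →
    (Quotient.mk _ h : ConformalStructure M) = A.conf →
    (∀ x v w, (ric D.conn x v w + ric D.conn x w v) / 2 = scal D h x / 2 * h.inner x v w) ∧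
    (∀ x u, mvfderiv (𝓡 2) (scal D h) x u + 2 * faradayPrimitive D h x u * scal D h x
      + 2 * trH h x (fun p q => covTensor D.conn (faraday D) x p ![u, q]) = 0)

/-- The weighted scalar curvature is negative. -/
def HasNegativeScalar : Prop :=
  ∀ (D : TorsionFree M) (h : Metric M), A.IsAligned D →
    (Quotient.mk _ h : ConformalStructure M) = A.conf → ∀ x, scal D h x < 0

end Structure

/-! ### The bundle of nonzero area elements -/

variable (M)

/-- The line bundle of two-forms on `M`: the component with respect to `dx¹ ∧ dx²`
changes by the Jacobian determinant. -/
def detCotangent : VectorBundleCore ℝ M ℝ (atlas Plane M) where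
  baseSet i := i.1.source
  isOpen_baseSet i := i.1.open_source
  indexAt := achart Plane
  mem_baseSet_at := mem_chart_source Plane
  coordChange i j x :=
    ((tangentBundleCore (𝓡 2) M).coordChange j i x).det • ContinuousLinearMap.id ℝ ℝ
  coordChange_self i x hx v := by
    have : (tangentBundleCore (𝓡 2) M).coordChange i i x = ContinuousLinearMap.id ℝ Plane :=
      ContinuousLinearMap.ext fun w => (tangentBundleCore (𝓡 2) M).coordChange_self i x hx w
    rw [this]
    simp [ContinuousLinearMap.det]
  continuousOn_coordChange i j := by
    have := (tangentBundleCore (𝓡 2) M).continuousOn_coordChange j i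
    rw [inter_comm] at this
    exact (ContinuousLinearMap.continuous_det.comp_continuousOn this).smul continuousOn_const
  coordChange_comp i j k x hx v := by
    have : (tangentBundleCore (𝓡 2) M).coordChange k i x =
        ((tangentBundleCore (𝓡 2) M).coordChange j i x).comp
          ((tangentBundleCore (𝓡 2) M).coordChange k j x) :=
      ContinuousLinearMap.ext fun w =>
        ((tangentBundleCore (𝓡 2) M).coordChange_comp k j i x ⟨⟨hx.2, hx.1.2⟩, hx.1.1⟩ w).symm
    rw [this]
    simp [ContinuousLinearMap.det]
    ring

theorem detCotangent_isContMDiff : (detCotangent M).IsContMDiff (𝓡 2) ∞ := by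
  have hM : IsManifold (𝓡 2) (∞ + 1) M := ‹IsManifold (𝓡 2) ∞ M›
  have : (tangentBundleCore (𝓡 2) M).IsContMDiff (𝓡 2) ∞ := tangentBundleCore.isContMDiff
  refine ⟨fun i j => ?_⟩
  have h := (tangentBundleCore (𝓡 2) M).contMDiffOn_coordChange (𝓡 2) (n := ∞) j i
  rw [inter_comm] at h
  have hd : ContDiff ℝ ∞ (fun L : Plane →L[ℝ] Plane => L.det) := by
    have hdet : (fun L : Plane →L[ℝ] Plane => L.det) = fun L =>
        (Matrix.of fun i j : Fin 2 => L (EuclideanSpace.single j (1 : ℝ)) i).det := by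
      ext L
      rw [ContinuousLinearMap.det,
        ← LinearMap.det_toMatrix (EuclideanSpace.basisFun (Fin 2) ℝ).toBasis]
      congr 1
    have hc : ∀ i j : Fin 2,
        ContDiff ℝ ∞ (fun L : Plane →L[ℝ] Plane => L (EuclideanSpace.single j (1 : ℝ)) i) :=
      fun i j => ((EuclideanSpace.proj (𝕜 := ℝ) i).comp
        (ContinuousLinearMap.apply ℝ Plane (EuclideanSpace.single j (1 : ℝ)))).contDiff
    rw [hdet]
    simp only [Matrix.det_fin_two, Matrix.of_apply]
    exact ((hc 0 0).mul (hc 1 1)).sub ((hc 0 1).mul (hc 1 0))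
  have := (hd.contMDiff.comp_contMDiffOn h)
  exact this.smul contMDiffOn_const

instance detCotangent_contMDiffVectorBundle :
    ContMDiffVectorBundle ∞ ℝ (detCotangent M).Fiber (𝓡 2) :=
  haveI := detCotangent_isContMDiff M
  VectorBundleCore.instContMDiffVectorBundle _

/-- The total space of the line bundle of two-forms on `M`. -/
abbrev DetTotal := TotalSpace ℝ (detCotangent M).Fiber

/-- The complement of the zero section. -/
def coneOpens : TopologicalSpace.Opens (DetTotal M) where
  carrier := {θ | (show ℝ from θ.2) ≠ 0}
  is_open' := by
    rw [isOpen_iff_mem_nhds]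
    intro θ hθ
    let t := trivializationAt ℝ (detCotangent M).Fiber θ.proj
    have hmem : θ.proj ∈ t.baseSet := FiberBundle.mem_baseSet_trivializationAt' θ.proj
    have hs : θ ∈ t.source := by rw [t.mem_source]; exact hmem
    have hcont : ContinuousAt (fun η => (t η).2) θ :=
      continuousAt_snd.comp (t.continuousAt hs)
    have hinj : ∀ η ∈ t.source, (t η).2 ≠ 0 ↔ η.2 ≠ 0 := by
      intro η hη
      have hb : η.proj ∈ t.baseSet := by rwa [t.mem_source] at hη
      have := (t.continuousLinearEquivAt ℝ η.proj hb).map_eq_zero_iff (x := η.2)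
      exact not_congr this
    have hne : (t θ).2 ≠ 0 := (hinj θ hs).2 hθ
    filter_upwards [hcont.eventually_ne hne, t.open_source.mem_nhds hs] with η h1 h2
    exact (hinj η h2).1 h1

/-- The total space of the principal `ℝ^×`-bundle over `M` whose third power is the bundle of
nonzero two-forms. Since `r ↦ r³` is an automorphism of `ℝ^×`, its underlying manifold is that of
the nonzero two-forms, with `r ∈ ℝ^×` acting as multiplication by `r³`. -/
abbrev Cone := ↥(coneOpens M)

/-- The model with corners of the three-manifold `Cone M`. -/
abbrev coneModel : ModelWithCorners ℝ (Plane × ℝ) (ModelProd Plane ℝ) := (𝓡 2).prod 𝓘(ℝ, ℝ)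

variable {M}

/-- The projection to `M`. -/
def proj (p : Cone M) : M := p.1.proj

/-- The differential of the projection. -/
def dproj (p : Cone M) : TangentSpace coneModel p →L[ℝ] TangentSpace (𝓡 2) (proj p) :=
  mfderiv coneModel (𝓡 2) proj p

/-- The component of a point of `Cone M` with respect to `dx¹ ∧ dx²`, in the preferred
chart at the base point. -/
def component (p : Cone M) : ℝ := p.1.2

/-- The two-form on the tangent space of the base which a point of `Cone M` is. -/
def twoForm (p : Cone M) (v w : TangentSpace (𝓡 2) (proj p)) : ℝ :=
  let a : Plane := v
  let b : Plane := w
  component p * (a 0 * b 1 - a 1 * b 0)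

/-- The principal action `R_r` of `r ∈ ℝ^×`. -/
def scale (r : ℝˣ) (p : Cone M) : Cone M :=
  ⟨⟨proj p, ((r : ℝ) ^ 3 * component p : ℝ)⟩,
    mul_ne_zero (pow_ne_zero 3 r.ne_zero) p.2⟩

/-- The vector field generating the flow `t ↦ R_{e^t}`. -/
def radial (p : Cone M) : TangentSpace coneModel p :=
  (mfderiv 𝓘(ℝ, ℝ) coneModel
    (fun t : ℝ => scale (Units.mk0 (Real.exp t) (Real.exp_ne_zero t)) p) 0 (1 : ℝ) : Plane × ℝ)

variable (M) in
/-- The tautological two-form `μ`. -/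
def tautological : CoTensor coneModel (Cone M) 2 := fun p v =>
  twoForm p (dproj p (v 0)) (dproj p (v 1))

variable (M) in
/-- The volume form `dμ`. -/
def coneVolume : CoTensor coneModel (Cone M) 3 := dTwo (tautological M)

/-- `D` is the Thomas connection of the projective structure `P`. It is characterized by being
torsion-free together with the six listed properties.

`geodesic` says that the inverse image of a projective geodesic of `M` is a totally geodesic
surface: if the integral curve of `X` through `x` satisfies at `x` the equation of unparameterized
geodesics of `P`, i.e. `∇_X X ∈ ℝ X` at `x`, then the covariant derivatives at points `p` over `x`
of vector fields tangent to the inverse images of the integral curves of `X` are tangent to the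
inverse image through `p`. -/
structure IsThomas (P : ProjectiveStructure M) (D : Connection coneModel (Cone M)) : Prop where
  smooth : CovariantDerivative.ContMDiffCovariantDerivative D ∞
  torsion_eq : D.torsion = 0
  radial_eq : ∀ (p : Cone M) (v : TangentSpace coneModel p), D radial p v = v
  volume_parallel : ∀ (p : Cone M) (u : TangentSpace coneModel p)
    (v : Fin 3 → TangentSpace coneModel p), covTensor D (coneVolume M) p u v = 0
  ricci_flat : ∀ (p : Cone M) (v w : TangentSpace coneModel p), ric D p v w = 0
  invariant : ∀ (r : ℝˣ) (Y : Π p : Cone M, TangentSpace coneModel p), IsSmoothField Y →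
    ∀ (p : Cone M) (v : TangentSpace coneModel p),
      mfderiv coneModel coneModel (scale r) p
          (D (VectorField.mpullback coneModel coneModel (scale r) Y) p v) =
        D Y (scale r p) (mfderiv coneModel coneModel (scale r) p v)
  geodesic : ∀ (B : TorsionFree M), (Quotient.mk _ B : ProjectiveStructure M) = P →
    ∀ (X : Π x : M, TangentSpace (𝓡 2) x), IsSmoothField X →
    ∀ x : M, X x ≠ 0 → (∃ c : ℝ, B.conn X x (X x) = c • X x) →
    ∀ Y Z : Π p : Cone M, TangentSpace coneModel p, IsSmoothField Y → IsSmoothField Z →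
    (∀ q, dproj q (Y q) ∈ Submodule.span ℝ {X (proj q)}) →
    (∀ q, dproj q (Z q) ∈ Submodule.span ℝ {X (proj q)}) →
    ∀ p, proj p = x → dproj p (D Z p (Y p)) ∈ Submodule.span ℝ {X (proj p)}
  divergence_curvature : ∀ (p : Cone M) (a b c : TangentSpace coneModel p),
    trace (fun q => covRiemann D p q a b c) = 0

/-- The function of homogeneity `-3` on `Cone M` which corresponds to the weighted scalar
curvature `R = h^{ij}R_ij |det h|^{1/2}`: its value at `θ` is the quotient of the densities
`R` and `|θ|` (with `θ` viewed as a two-form). -/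
def scalarLift (D : TorsionFree M) (h : Metric M) (p : Cone M) : ℝ :=
  scal D h (proj p) * Real.sqrt (gram h (proj p)).det
    / |twoForm p (e (proj p) 0) (e (proj p) 1)|

/-- The function `u² = (R/2)^{-2/3}` of homogeneity `2` on `Cone M`. -/
def vLift (D : TorsionFree M) (h : Metric M) (p : Cone M) : ℝ :=
  ((scalarLift D h p / 2) ^ 2) ^ (-(1 / 3) : ℝ)

/-- The potential of the Lorentzian metric `g = (1/2) ∇ d(u²)`. -/
def potentialG (D : TorsionFree M) (h : Metric M) (p : Cone M) : ℝ := (1 / 2) * vLift D h p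

/-- The potential `F = -(3/2) log u²` of the Riemannian metric `f = ∇ dF`. -/
def potentialF (D : TorsionFree M) (h : Metric M) (p : Cone M) : ℝ :=
  -(3 / 2) * Real.log (vLift D h p)

end

end AH

set_option linter.unusedSectionVars false
set_option linter.unusedVariables false

/-! Exactness provides a metric h in the conformal class whose area form is parallel for the aligned
representative ∇. Then the Faraday primitive of h vanishes, so alignment says that ∇h is totally
symmetric. The curvature is trace-free, so the Ricci tensor is symmetric and the Faraday form is
zero. The Einstein equations become Ric = κh with κ = scal/2 negative and dκ = 0. The curvature of a
connection on a surface is determined by its Ricci tensor, hence R(u,v)w = κ(h(v,w)u − h(u,w)v), and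
κh is a Codazzi tensor (`AH.isSpecial_of_isEinstein`).

On the cone, the ratio of a two-form to the area form of h gives a function ρ (`AH.logRadius`) with
ρ(R_{e^t} p) = ρ(p) + t. Its differential η is a closed principal connection form: η(𝕏) = 1, every
vector is the sum of a multiple of 𝕏 and a horizontal lift, and brackets of lifts are lifts of
brackets. Everything takes place in this splitting. The connection `AH.coneConn` with a = 1 and
symmetric form P satisfies ∇̂𝕏 = id and ∇̂_v X̂ = (∇_v X)^ + η(v)X̂ − P(X,v)𝕏. It is torsion-free,
scale invariant, preserves dμ = 3η ∧ μ and respects geodesics. Its curvature on horizontal lifts is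
the Weyl-type tensor of (∇, P), with the skew part of ∇P as radial component. With P = κh both
vanish, so the connection is flat, and it is a Thomas connection (`AH.isThomas_coneConn`).

It is the only one (`AH.IsThomas.agree`). The difference of two candidates kills 𝕏. Its horizontal
part is symmetric, trace-free because the volume is preserved, and proportional to w on (w, w)
because geodesics are respected, so it vanishes. What remains is a change of P, which scale
invariance makes constant along the fibres and which Ricci flatness makes zero. Connections are
compared by `Affine.Agree`, since the axioms of a covariant derivative say nothing about
non-differentiable sections.

The metrics are now explicit. One has ∇̂η = P − η ⊗ η, and R̃ = scal · e^{−3ρ} with scal locally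
constant, so dṽ = 2ṽη and dF = −3η. Therefore g = ṽ(η ⊗ η + κh) and f = 3(η ⊗ η − κh), and the
signatures follow from κ < 0. Relative to the parallel volume 3η ∧ μ the determinants are 1/9 for g
and 3ṽ^{−3} for f. The logarithm of the latter is log 3 + 2F, so the Kähler affine Ricci tensors are
0 and −2f.

The level surfaces of R̃ have tangent space ker η. The Levi-Civita connections of g and f come from
the same cone construction, with the Levi-Civita connection of h in place of ∇ and with a = 1 and a
= 0 respectively. For g, the identity ∇𝕏 = id makes the level surfaces umbilic, with mean curvature
−ṽ^{−1/2}, a function of R̃. The metric f is locally a product of a line with −3κh, whose slices are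
totally geodesic. -/

namespace Affine

noncomputable section

variable {E : Type*} [NormedAddCommGroup E] [NormedSpace ℝ E] [FiniteDimensional ℝ E]
  [CompleteSpace E] {H : Type*} [TopologicalSpace H] {I : ModelWithCorners ℝ E H}
  {N : Type*} [TopologicalSpace N] [ChartedSpace H N] [IsManifold I ∞ N]

/-! ### Fields and functions -/

theorem mdiffAt_ext {x : N} (v : TangentSpace I x) : MDiffAt (T% (ext v)) x :=
  FiberBundle.mdifferentiableAt_extend I E v

theorem ext_self {x : N} (v : TangentSpace I x) : ext v x = v :=
  FiberBundle.extend_apply_self E v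

theorem IsSmoothField.mdiffAt {X : Π x : N, TangentSpace I x} (hX : IsSmoothField X) (x : N) :
    MDiffAt (T% X) x :=
  (hX x).mdifferentiableAt (by simp)

theorem IsSmoothField.add {X Y : Π x : N, TangentSpace I x} (hX : IsSmoothField X)
    (hY : IsSmoothField Y) : IsSmoothField (X + Y) :=
  ContMDiff.add_section hX hY

theorem IsSmoothField.sub {X Y : Π x : N, TangentSpace I x} (hX : IsSmoothField X)
    (hY : IsSmoothField Y) : IsSmoothField (X - Y) :=
  ContMDiff.sub_section hX hY

theorem IsSmoothField.smul {X : Π x : N, TangentSpace I x} (hX : IsSmoothField X) {f : N → ℝ}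
    (hf : ContMDiff I 𝓘(ℝ, ℝ) ∞ f) : IsSmoothField (f • X) :=
  ContMDiff.smul_section hf hX

theorem smoothAt_mdiffAt {f : N → ℝ} {x : N} (hf : ContMDiffAt I 𝓘(ℝ, ℝ) ∞ f x) : MDiffAt f x :=
  hf.mdifferentiableAt (by simp)

theorem smooth_mdiffAt {f : N → ℝ} (hf : ContMDiff I 𝓘(ℝ, ℝ) ∞ f) (x : N) : MDiffAt f x :=
  smoothAt_mdiffAt (hf x)

theorem mvfderiv_congr {f g : N → ℝ} {x : N} (h : f =ᶠ[𝓝 x] g) :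
    mvfderiv I f x = mvfderiv I g x := by
  have := h.mfderiv_eq (I := I) (I' := 𝓘(ℝ, ℝ))
  ext v
  exact congrArg (fun L : TangentSpace I x →L[ℝ] ℝ => L v) this

theorem mdiffAt_congr_field {X Y : Π x : N, TangentSpace I x} {x : N} (hX : MDiffAt (T% X) x)
    (h : ∀ᶠ y in 𝓝 x, X y = Y y) : MDiffAt (T% Y) x :=
  hX.congr_of_eventuallyEq (h.mono fun y hy => by simp [hy])

theorem smoothAt_congr_field {X Y : Π x : N, TangentSpace I x} {x : N}
    (hX : ContMDiffAt I I.tangent ∞ (T% X) x)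
    (h : ∀ᶠ y in 𝓝 x, X y = Y y) : ContMDiffAt I I.tangent ∞ (T% Y) x :=
  hX.congr_of_eventuallyEq (h.mono fun y hy => by simp [hy])

/-- The derivative of a smooth function along a field which is smooth at a point. -/
theorem smoothAt_mvfderiv_apply {f : N → ℝ} {X : Π x : N, TangentSpace I x}
    (hf : ContMDiff I 𝓘(ℝ, ℝ) ∞ f) {x : N} (hX : ContMDiffAt I I.tangent ∞ (T% X) x) :
    ContMDiffAt I 𝓘(ℝ, ℝ) ∞ (fun y => mvfderiv I f y (X y)) x := by
  have h : ContMDiff I.tangent (𝓘(ℝ, ℝ)).tangent ∞ (tangentMap I 𝓘(ℝ, ℝ) f) :=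
    hf.contMDiff_tangentMap (by simp)
  have h2 := h.contMDiffAt.comp x hX
  exact (contMDiff_snd_tangentBundle_modelSpace ℝ 𝓘(ℝ, ℝ)).contMDiffAt.comp x h2

theorem smooth_mvfderiv_apply {f : N → ℝ} {X : Π x : N, TangentSpace I x}
    (hf : ContMDiff I 𝓘(ℝ, ℝ) ∞ f) (hX : IsSmoothField X) :
    ContMDiff I 𝓘(ℝ, ℝ) ∞ (fun y => mvfderiv I f y (X y)) :=
  fun x => smoothAt_mvfderiv_apply hf (hX x)

theorem mdiffAt_mvfderiv_apply {f : N → ℝ} {X : Π x : N, TangentSpace I x}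
    (hf : ContMDiff I 𝓘(ℝ, ℝ) ∞ f) {x : N} (hX : MDiffAt (T% X) x) :
    MDiffAt (fun y => mvfderiv I f y (X y)) x := by
  have h : ContMDiff I.tangent (𝓘(ℝ, ℝ)).tangent ∞ (tangentMap I 𝓘(ℝ, ℝ) f) :=
    hf.contMDiff_tangentMap (by simp)
  have h2 := (h.mdifferentiable (by simp) _).comp x hX
  exact ((contMDiff_snd_tangentBundle_modelSpace ℝ 𝓘(ℝ, ℝ)).mdifferentiable
    (n := ∞) (by simp) _).comp x h2

section Cutoff

variable [T2Space N]

theorem exists_smooth_cutoff {x : N} {U : Set N} (hU : IsOpen U) (hx : x ∈ U) :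
    ∃ ψ : N → ℝ, ContMDiff I 𝓘(ℝ, ℝ) ∞ ψ ∧ (∀ᶠ y in 𝓝 x, ψ y = 1) ∧ tsupport ψ ⊆ U := by
  obtain ⟨ψ, hψ, -⟩ := (SmoothBumpFunction.nhds_basis_support (I := I) (hU.mem_nhds hx)).mem_iff.1
    (hU.mem_nhds hx)
  exact ⟨ψ, ψ.contMDiff, ψ.eventuallyEq_one, hψ⟩

/-- Multiplication by a cutoff function keeps the germ at the point and makes the field global.
Statements about `IsSmoothField` thereby apply to local constructions. -/
theorem exists_smoothField_of_contMDiffOn {X : Π x : N, TangentSpace I x} {U : Set N}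
    (hU : IsOpen U) (hX : ContMDiffOn I I.tangent ∞ (T% X) U) {x : N} (hx : x ∈ U) :
    ∃ Y : Π x : N, TangentSpace I x, IsSmoothField Y ∧ ∀ᶠ y in 𝓝 x, Y y = X y := by
  obtain ⟨ψ, hψ, h1, hs⟩ := exists_smooth_cutoff (I := I) hU hx
  exact ⟨ψ • X, hψ.contMDiffOn.smul_section_of_tsupport hU hs hX,
    h1.mono fun y hy => by simp [hy]⟩

theorem exists_smooth_of_contMDiffOn {f : N → ℝ} {U : Set N}
    (hU : IsOpen U) (hf : ContMDiffOn I 𝓘(ℝ, ℝ) ∞ f U) {x : N} (hx : x ∈ U) :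
    ∃ g : N → ℝ, ContMDiff I 𝓘(ℝ, ℝ) ∞ g ∧ ∀ᶠ y in 𝓝 x, g y = f y := by
  obtain ⟨ψ, hψ, h1, hs⟩ := exists_smooth_cutoff (I := I) hU hx
  refine ⟨fun y => ψ y * f y, fun y => ?_, h1.mono fun y hy => by simp [hy]⟩
  by_cases hy : y ∈ tsupport ψ
  · exact (hψ y).mul ((hf y (hs hy)).contMDiffAt (hU.mem_nhds (hs hy)))
  · have : (fun z => ψ z * f z) =ᶠ[𝓝 y] fun _ => (0 : ℝ) := by
      filter_upwards [(isClosed_tsupport ψ).isOpen_compl.mem_nhds hy] with z hz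
      rw [image_eq_zero_of_notMem_tsupport hz, zero_mul]
    exact contMDiffAt_const.congr_of_eventuallyEq this

-- The fields are a local frame of the tangent bundle, cut off so as to be globally smooth. The
-- coefficient forms are not cut off; only their values on smooth fields receive smooth
-- representatives near the point.
variable (I N) in
theorem exists_smooth_frame (x : N) : ∃ (Z : Fin (Module.finrank ℝ E) → Π y : N, TangentSpace I y)
    (c : Fin (Module.finrank ℝ E) → Π y : N, TangentSpace I y →ₗ[ℝ] ℝ),
    (∀ i, IsSmoothField (Z i)) ∧
    (∀ i (Y : Π y : N, TangentSpace I y), IsSmoothField Y →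
      ∃ f : N → ℝ, ContMDiff I 𝓘(ℝ, ℝ) ∞ f ∧ ∀ᶠ y in 𝓝 x, f y = c i y (Y y)) ∧
    (∀ i (Y : Π y : N, TangentSpace I y), MDiffAt (T% Y) x → MDiffAt (fun y => c i y (Y y)) x) ∧
    ∀ᶠ y in 𝓝 x, ∀ v : TangentSpace I y, v = ∑ i, c i y v • Z i y := by
  let e := trivializationAt E (TangentSpace I) x
  let b := Module.finBasis ℝ E
  have hx : x ∈ e.baseSet := FiberBundle.mem_baseSet_trivializationAt' x
  have hon : ∀ i, ContMDiffOn I I.tangent ∞ (T% (e.localFrame b i)) e.baseSet := fun i =>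
    e.contMDiffOn_localFrame_baseSet ∞ b i
  choose Z hZ hZe using fun i => exists_smoothField_of_contMDiffOn e.open_baseSet (hon i) hx
  refine ⟨Z, fun i => e.localFrameCoeff I b i, hZ, fun i Y hY => ?_, fun i Y hY => ?_, ?_⟩
  · exact exists_smooth_of_contMDiffOn e.open_baseSet
      (contMDiffOn_baseSet_localFrameCoeff b hY.contMDiffOn i) hx
  · exact mdifferentiableAt_localFrameCoeff b hx hY i
  · filter_upwards [Filter.eventually_all.2 hZe, e.open_baseSet.mem_nhds hx] with y hy hye v
    have := e.eq_sum_localFrameCoeff_smul (I := I) (b := b) (s := ext v) hye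
    rw [ext_self] at this
    rw [Finset.sum_congr rfl fun i _ => congrArg _ (hy i)]
    exact this

/-- A tangent vector extends to a smooth field which is locally `ext`. -/
theorem exists_smoothField_eq_ext {x : N} (v : TangentSpace I x) :
    ∃ V : Π x : N, TangentSpace I x, IsSmoothField V ∧ ∀ᶠ y in 𝓝 x, V y = ext v y := by
  let e := trivializationAt E (TangentSpace I) x
  have hx : x ∈ e.baseSet := FiberBundle.mem_baseSet_trivializationAt' x
  refine exists_smoothField_of_contMDiffOn e.open_baseSet ?_ hx
  rw [e.contMDiffOn_section_baseSet_iff]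
  exact (contMDiffOn_const (c := (e ⟨x, v⟩).2)).congr fun y hy => by
    change (e ⟨y, e.symm y (e ⟨x, v⟩).2⟩).2 = _
    rw [e.apply_mk_symm hy]

theorem exists_smoothField_apply {x : N} (v : TangentSpace I x) :
    ∃ V : Π x : N, TangentSpace I x, IsSmoothField V ∧ V x = v := by
  obtain ⟨V, hV, h⟩ := exists_smoothField_eq_ext v
  exact ⟨V, hV, by rw [h.self_of_nhds, ext_self]⟩

end Cutoff

/-! ### Connections -/

variable (D : Connection I N) {x : N}

theorem conn_congr {Y Y' : Π x : N, TangentSpace I x} (hY : MDiffAt (T% Y) x)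
    (h : ∀ᶠ y in 𝓝 x, Y y = Y' y) : D Y x = D Y' x :=
  D.isCovariantDerivativeOnUniv.congr_of_eventuallyEq hY (mdiffAt_congr_field hY h)
    Filter.univ_mem h

theorem conn_add {Y Y' : Π x : N, TangentSpace I x} (hY : MDiffAt (T% Y) x)
    (hY' : MDiffAt (T% Y') x) : D (Y + Y') x = D Y x + D Y' x :=
  D.isCovariantDerivativeOnUniv.add hY hY'

theorem conn_smul {f : N → ℝ} {Y : Π x : N, TangentSpace I x} (hf : MDiffAt f x)
    (hY : MDiffAt (T% Y) x) (u : TangentSpace I x) :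
    D (f • Y) x u = f x • D Y x u + mvfderiv I f x u • Y x := by
  rw [D.isCovariantDerivativeOnUniv.leibniz hY hf]
  rfl

theorem conn_const_smul {Y : Π x : N, TangentSpace I x} (a : ℝ)
    (hY : MDiffAt (T% Y) x) : D (a • Y) x = a • D Y x :=
  D.isCovariantDerivativeOnUniv.smul_const a hY

theorem conn_sub {Y Y' : Π x : N, TangentSpace I x} (hY : MDiffAt (T% Y) x)
    (hY' : MDiffAt (T% Y') x) : D (Y - Y') x = D Y x - D Y' x := by
  have h : Y - Y' = Y + (-1 : ℝ) • Y' := by ext; simp [sub_eq_add_neg]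
  have h2 : MDiffAt (T% ((-1 : ℝ) • Y')) x := mdifferentiableAt_const.smul_section hY'
  rw [h, conn_add D hY h2, conn_const_smul D _ hY']
  ext; simp [sub_eq_add_neg]

theorem conn_sum {ι : Type*} {s : Finset ι} (Y : ι → Π x : N, TangentSpace I x)
    (hY : ∀ i ∈ s, MDiffAt (T% (Y i)) x) :
    D (fun y => ∑ i ∈ s, Y i y) x = ∑ i ∈ s, D (Y i) x := by
  classical
  induction s using Finset.induction_on with
  | empty => exact D.isCovariantDerivativeOnUniv.zero (x := x)
  | insert a s ha ih =>
    simp only [Finset.mem_insert, forall_eq_or_imp] at hY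
    simp only [Finset.sum_insert ha, ← ih hY.2]
    exact conn_add D hY.1 (.sum_section hY.2)

theorem along_apply (X Y : Π x : N, TangentSpace I x) (y : N) : along D X Y y = D Y y (X y) := rfl

theorem along_smoothAt {D : Connection I N}
    (hD : CovariantDerivative.ContMDiffCovariantDerivative D ∞)
    {X Y : Π x : N, TangentSpace I x} (hX : ContMDiffAt I I.tangent ∞ (T% X) x)
    (hY : IsSmoothField Y) : ContMDiffAt I I.tangent ∞ (T% (along D X Y)) x := by
  have h := (hD.contMDiff.contMDiff (σ := Y) (by simpa using hY.contMDiffOn)).contMDiffAt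
    (x := x) Filter.univ_mem
  exact ContMDiffAt.clm_bundle_apply h hX

theorem along_smooth {D : Connection I N}
    (hD : CovariantDerivative.ContMDiffCovariantDerivative D ∞)
    {X Y : Π x : N, TangentSpace I x} (hX : IsSmoothField X)
    (hY : IsSmoothField Y) : IsSmoothField (along D X Y) :=
  fun x => along_smoothAt hD (hX x) hY

theorem along_mdiffAt {D : Connection I N}
    (hD : CovariantDerivative.ContMDiffCovariantDerivative D ∞)
    {X Y : Π x : N, TangentSpace I x} (hX : MDiffAt (T% X) x)
    (hY : IsSmoothField Y) : MDiffAt (T% (along D X Y)) x := by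
  have h := (hD.contMDiff.contMDiff (σ := Y) (by simpa using hY.contMDiffOn)).contMDiffAt
    (x := x) Filter.univ_mem
  exact MDifferentiableAt.clm_bundle_apply (h.mdifferentiableAt (by simp)) hX

/-! ### Brackets -/

theorem torsionFree_bracket {D : Connection I N} (h : D.torsion = 0)
    {X Y : Π x : N, TangentSpace I x} (hX : MDiffAt (T% X) x) (hY : MDiffAt (T% Y) x) :
    VectorField.mlieBracket I X Y x = D Y x (X x) - D X x (Y x) :=
  ((D.torsion_eq_zero_iff.1 h) hX hY).symm

theorem minSmoothness_le_infty (n : ℕ) : minSmoothness ℝ n ≤ ∞ := by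
  rw [minSmoothness_of_isRCLikeNormedField]
  exact_mod_cast le_top

theorem isManifold_minSmoothness (n : ℕ) : IsManifold I (minSmoothness ℝ n) N :=
  IsManifold.of_le (n := ∞) (minSmoothness_le_infty n)

theorem bracket_smooth {X Y : Π x : N, TangentSpace I x} (hX : IsSmoothField X)
    (hY : IsSmoothField Y) : IsSmoothField (VectorField.mlieBracket I X Y) := fun x =>
  have : IsManifold I (minSmoothness ℝ 2) N := isManifold_minSmoothness 2
  have : IsManifold I (((⊤ : ℕ∞) : ℕ∞ω) + 1) N := ‹IsManifold I ∞ N›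
  ContMDiffAt.mlieBracket_vectorField (m := ⊤) (n := ⊤) (hX x) (hY x) (by simp)

/-- The commutator of two fields acts on functions as their Lie bracket. -/
theorem mvfderiv_bracket {X Y : Π x : N, TangentSpace I x} (hX : IsSmoothField X)
    (hY : IsSmoothField Y) {f : N → ℝ} (hf : ContMDiff I 𝓘(ℝ, ℝ) ∞ f) [T2Space N] (x : N) :
    mvfderiv I f x (VectorField.mlieBracket I X Y x) =
      mvfderiv I (fun y => mvfderiv I f y (Y y)) x (X x)
        - mvfderiv I (fun y => mvfderiv I f y (X y)) x (Y x) := by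
  have : IsManifold I (minSmoothness ℝ 3) N := isManifold_minSmoothness 3
  -- The argument reads off a coefficient of a nonzero vector; if the tangent space is trivial both
  -- sides vanish.
  by_cases hw : ∃ w : TangentSpace I x, w ≠ 0
  · obtain ⟨w, hw⟩ := hw
    obtain ⟨W, hW, rfl⟩ := exists_smoothField_apply w
    have br : ∀ {f : N → ℝ} {U V : Π x : N, TangentSpace I x}, ContMDiff I 𝓘(ℝ, ℝ) ∞ f →
        IsSmoothField V → VectorField.mlieBracket I U (f • V) =
          (fun y => mvfderiv I f y (U y)) • V + f • VectorField.mlieBracket I U V := by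
      intro f U V hf hV
      ext y
      exact VectorField.mlieBracket_smul_right (smooth_mdiffAt hf y) (hV.mdiffAt y)
    have add : ∀ {U V V' : Π x : N, TangentSpace I x}, IsSmoothField V → IsSmoothField V' →
        VectorField.mlieBracket I U (V + V') x =
          VectorField.mlieBracket I U V x + VectorField.mlieBracket I U V' x :=
      fun hV hV' => VectorField.mlieBracket_add_right (hV.mdiffAt x) (hV'.mdiffAt x)
    have le2 : minSmoothness ℝ 2 ≤ ∞ := minSmoothness_le_infty 2
    -- The Jacobi identity for X, Y, fW is expanded by the Leibniz rule. After the identity for X,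
    -- Y, W is used, all terms cancel except a multiple of W x, and its coefficient is the
    -- difference of the two sides of the claim.
    have jac := VectorField.leibniz_identity_mlieBracket_apply (I := I) ((hX x).of_le le2)
      ((hY x).of_le le2) (((hW.smul hf) x).of_le le2)
    have jac' := VectorField.leibniz_identity_mlieBracket_apply (I := I) ((hX x).of_le le2)
      ((hY x).of_le le2) ((hW x).of_le le2)
    have hYf := smooth_mvfderiv_apply hf hY
    have hXf := smooth_mvfderiv_apply hf hX
    rw [br hf hW, br hf hW, br hf hW, add (hW.smul hYf) ((bracket_smooth hY hW).smul hf),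
      add (hW.smul hXf) ((bracket_smooth hX hW).smul hf), br hYf hW, br hXf hW,
      br hf (bracket_smooth hY hW), br hf (bracket_smooth hX hW)] at jac
    simp only [Pi.add_apply, Pi.smul_apply', jac', smul_add] at jac
    rw [← sub_eq_zero] at jac
    have h0 : (mvfderiv I f x (VectorField.mlieBracket I X Y x) -
      (mvfderiv I (fun y => mvfderiv I f y (Y y)) x (X x)
        - mvfderiv I (fun y => mvfderiv I f y (X y)) x (Y x))) • W x = 0 := by
      rw [← neg_eq_zero, ← jac]
      module
    exact sub_eq_zero.1 ((smul_eq_zero.1 h0).resolve_right hw)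
  · push Not at hw
    rw [hw (X x), hw (Y x), hw (VectorField.mlieBracket I X Y x)]
    simp

end

end Affine

namespace Affine

noncomputable section

variable {E : Type*} [NormedAddCommGroup E] [NormedSpace ℝ E] [FiniteDimensional ℝ E]
  [CompleteSpace E] {H : Type*} [TopologicalSpace H] {I : ModelWithCorners ℝ E H}
  {N : Type*} [TopologicalSpace N] [ChartedSpace H N] [IsManifold I ∞ N]

/-! ### Covariant derivatives of tensors -/

/-- A field of multilinear maps which is differentiable at `x`. -/
structure IsTensorAt {k : ℕ} (t : CoTensor I N k) (x : N) : Prop where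
  multilinear : ∀ y, ∃ m : MultilinearMap ℝ (fun _ : Fin k => TangentSpace I y) ℝ,
    ∀ v, t y v = m v
  mdiff : ∀ V : Fin k → Π y : N, TangentSpace I y, (∀ i, MDiffAt (T% (V i)) x) →
    MDiffAt (fun y => t y (fun i => V i y)) x

section Tensor

variable (D : Connection I N) {k : ℕ} {t : CoTensor I N k} {x : N}

/-- The expression for the covariant derivative of a tensor evaluated on fields. -/
def covFields (t : CoTensor I N k) (x : N) (u : TangentSpace I x)
    (V : Fin k → Π y : N, TangentSpace I y) : ℝ :=
  mvfderiv I (fun y => t y (fun i => V i y)) x u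
    - ∑ i, t x (Function.update (fun j => V j x) i (D (V i) x u))

theorem IsTensorAt.update_add (ht : IsTensorAt t x) (y : N) (v : Fin k → TangentSpace I y)
    (i : Fin k) (a b : TangentSpace I y) :
    t y (Function.update v i (a + b)) =
      t y (Function.update v i a) + t y (Function.update v i b) := by
  obtain ⟨m, hm⟩ := ht.multilinear y
  simp only [hm, m.map_update_add]

theorem IsTensorAt.update_smul (ht : IsTensorAt t x) (y : N) (v : Fin k → TangentSpace I y)
    (i : Fin k) (c : ℝ) (a : TangentSpace I y) :
    t y (Function.update v i (c • a)) = c * t y (Function.update v i a) := by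
  obtain ⟨m, hm⟩ := ht.multilinear y
  simp only [hm, m.map_update_smul, smul_eq_mul]

theorem update_field_apply (V : Fin k → Π y : N, TangentSpace I y) (i : Fin k)
    (σ : Π y : N, TangentSpace I y) (y : N) :
    (fun j => Function.update V i σ j y) = Function.update (fun j => V j y) i (σ y) := by
  ext j
  by_cases h : j = i
  · subst h; simp
  · simp [h]

/-- For fσ in slot i, the derivative of f coming from the value of t cancels the one coming from
D(fσ), and the other slots are plainly linear in f. -/
theorem IsTensorAt.tensorialAt (ht : IsTensorAt t x) (u : TangentSpace I x)
    {V : Fin k → Π y : N, TangentSpace I y} (hV : ∀ i, MDiffAt (T% (V i)) x) (i : Fin k) :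
    TensorialAt I E (fun σ => covFields D t x u (Function.update V i σ)) x := by
  have hup : ∀ σ : Π y : N, TangentSpace I y, MDiffAt (T% σ) x →
      ∀ j, MDiffAt (T% (Function.update V i σ j)) x := by
    intro σ hσ j
    by_cases h : j = i
    · subst h; simpa using hσ
    · simpa [h] using hV j
  have key : ∀ σ : Π y : N, TangentSpace I y,
      covFields D t x u (Function.update V i σ) =
        mvfderiv I (fun y => t y (Function.update (fun j => V j y) i (σ y))) x u
        - (t x (Function.update (fun j => V j x) i (D σ x u)) + ∑ j ∈ Finset.univ.erase i,
          t x (Function.update (Function.update (fun j => V j x) j (D (V j) x u)) i (σ x))) := by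
    intro σ
    rw [covFields, ← Finset.add_sum_erase _ _ (Finset.mem_univ i)]
    simp only [update_field_apply, Function.update_idem, Function.update_self]
    congr 2
    refine Finset.sum_congr rfl fun j hj => ?_
    have hji : j ≠ i := Finset.ne_of_mem_erase hj
    rw [Function.update_of_ne hji, Function.update_comm hji]
  have hd : ∀ σ : Π y : N, TangentSpace I y, MDiffAt (T% σ) x →
      MDiffAt (fun y => t y (Function.update (fun j => V j y) i (σ y))) x := by
    intro σ hσ
    have := ht.mdiff _ (hup σ hσ)
    simpa only [update_field_apply] using this
  refine ⟨fun {f σ} hf hσ => ?_, fun {σ σ'} hσ hσ' => ?_⟩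
  · rw [key, key, conn_smul D hf hσ]
    simp only [Pi.smul_apply', ht.update_smul, ht.update_add, ← Finset.mul_sum]
    rw [mvfderiv_fun_mul hf (hd σ hσ)]
    simp only [add_apply, smul_apply, smul_eq_mul]
    ring
  · rw [key, key, key, conn_add D hσ hσ']
    simp only [Pi.add_apply, add_apply, ht.update_add,
      Finset.sum_add_distrib]
    rw [mvfderiv_fun_add (hd σ hσ) (hd σ' hσ')]
    simp only [add_apply]
    ring

/-- The covariant derivative of a tensor can be computed with arbitrary extensions. -/
theorem covTensor_apply (ht : IsTensorAt t x) (u : TangentSpace I x)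
    {V : Fin k → Π y : N, TangentSpace I y} (hV : ∀ i, MDiffAt (T% (V i)) x) :
    covTensor D t x u (fun i => V i x) = covFields D t x u V := by
  classical
  let V' : Fin k → Π y : N, TangentSpace I y := fun i => ext (V i x)
  have hV' : ∀ i, MDiffAt (T% (V' i)) x := fun i => mdiffAt_ext _
  have hx : ∀ i, V' i x = V i x := fun i => ext_self _
  -- The given fields are exchanged for the extensions `ext` one slot at a time; each exchange is
  -- tensoriality in that slot.
  have hstep : ∀ s : Finset (Fin k), covFields D t x u (s.piecewise V' V) =
      covFields D t x u V := by
    intro s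
    induction s using Finset.induction_on with
    | empty => simp
    | insert i s hi ih =>
      have hs : ∀ j, MDiffAt (T% (s.piecewise V' V j)) x := by
        intro j
        by_cases h : j ∈ s
        · simpa [h] using hV' j
        · simpa [h] using hV j
      rw [Finset.piecewise_insert, ← ih]
      refine ((ht.tensorialAt D u hs i).pointwise (hV' i) (hV i) (hx i)).trans ?_
      congr 1
      exact Function.update_eq_self_iff.2 (by simp [hi])
  have := hstep Finset.univ
  rw [Finset.piecewise_univ] at this
  rw [← this]
  simp only [covTensor, covFields, V', ext_self]

end Tensor

theorem isTensorAt_dOne {F : N → ℝ} (hF : ContMDiff I 𝓘(ℝ, ℝ) ∞ F) (x : N) :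
    IsTensorAt (dOne (I := I) F) x where
  multilinear y := ⟨LinearMap.compMultilinearMap (mvfderiv I F y).toLinearMap
    (MultilinearMap.ofSubsingleton ℝ (TangentSpace I y) (TangentSpace I y) (0 : Fin 1)
      LinearMap.id), fun v => by simp [dOne]⟩
  mdiff V hV := mdiffAt_mvfderiv_apply hF (hV 0)

/-- Independence of the extension frees the Hessian from `ext`, so that it can be evaluated on
whichever field is convenient. -/
theorem hess_apply (D : Connection I N) {F : N → ℝ} (hF : ContMDiff I 𝓘(ℝ, ℝ) ∞ F) {x : N}
    (v : TangentSpace I x) {W : Π y : N, TangentSpace I y} (hW : MDiffAt (T% W) x) :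
    hess D F x v (W x) =
      mvfderiv I (fun y => mvfderiv I F y (W y)) x v - mvfderiv I F x (D W x v) := by
  have := covTensor_apply D (isTensorAt_dOne hF x) v (V := fun _ => W) fun _ => hW
  have h2 : (![W x] : Fin 1 → TangentSpace I x) = fun _ => W x := by ext i; fin_cases i; rfl
  rw [hess, h2, this]
  simp [covFields, dOne]

/-! ### Curvature -/

/-- `R(U,V)W` on vector fields. -/
def curv (D : Connection I N) (U V W : Π y : N, TangentSpace I y) (x : N) : TangentSpace I x :=
  D (along D V W) x (U x) - D (along D U W) x (V x) - D W x (VectorField.mlieBracket I U V x)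

section Curvature

variable {D : Connection I N} (hD : CovariantDerivative.ContMDiffCovariantDerivative D ∞)
  {U V W : Π y : N, TangentSpace I y} {x : N}

theorem curv_swap : curv D U V W x = - curv D V U W x := by
  rw [curv, curv, VectorField.mlieBracket_swap_apply, map_neg]
  abel

include hD

/-- One derivative falls on U, and the term with df from the covariant derivative cancels the one
from the bracket. The second slot follows by antisymmetry. -/
theorem curv_tensorial (hV : IsSmoothField V) (hW : IsSmoothField W) :
    TensorialAt I E (fun U => curv D U V W x) x where
  smul {f U} hf hU := by
    have h : along D (f • U) W = f • along D U W := by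
      ext y; simp [along]
    rw [curv, h, conn_smul D hf (along_mdiffAt hD hU hW),
      VectorField.mlieBracket_smul_left hf hU, curv]
    simp only [Pi.smul_apply', map_add, map_smul, along_apply]
    module
  add {U U'} hU hU' := by
    have h : along D (U + U') W = along D U W + along D U' W := by
      ext y; simp [along]
    simp only [curv]
    rw [h, conn_add D (along_mdiffAt hD hU hW) (along_mdiffAt hD hU' hW),
      VectorField.mlieBracket_add_left hU hU']
    simp only [Pi.add_apply, map_add, add_apply]
    module

theorem curv_congr_left {U' : Π y : N, TangentSpace I y} (hU : IsSmoothField U)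
    (hU' : IsSmoothField U') (hV : IsSmoothField V) (hW : IsSmoothField W) (h : U x = U' x) :
    curv D U V W x = curv D U' V W x :=
  (curv_tensorial hD hV hW).pointwise (hU.mdiffAt x) (hU'.mdiffAt x) h

theorem curv_congr_mid {V' : Π y : N, TangentSpace I y} (hU : IsSmoothField U)
    (hV : IsSmoothField V) (hV' : IsSmoothField V') (hW : IsSmoothField W) (h : V x = V' x) :
    curv D U V W x = curv D U V' W x := by
  rw [curv_swap, curv_congr_left hD hV hV' hU hW h, ← curv_swap]

theorem curv_add_right {W' : Π y : N, TangentSpace I y} (hU : IsSmoothField U)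
    (hV : IsSmoothField V) (hW : IsSmoothField W) (hW' : IsSmoothField W') :
    curv D U V (W + W') x = curv D U V W x + curv D U V W' x := by
  have h : ∀ {Z : Π y : N, TangentSpace I y},
      along D Z (W + W') = along D Z W + along D Z W' := by
    intro Z; ext y; simp [along, conn_add D (hW.mdiffAt y) (hW'.mdiffAt y)]
  simp only [curv, h, conn_add D (hW.mdiffAt x) (hW'.mdiffAt x)]
  rw [conn_add D ((along_smooth hD hV hW).mdiffAt x) ((along_smooth hD hV hW').mdiffAt x),
    conn_add D ((along_smooth hD hU hW).mdiffAt x) ((along_smooth hD hU hW').mdiffAt x)]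
  simp only [add_apply]
  module

variable [T2Space N]

/-- The first derivatives of f cancel in pairs, and the second derivatives cancel against the
derivative of f along [U, V] by `mvfderiv_bracket`. -/
theorem curv_smul_right (hU : IsSmoothField U) (hV : IsSmoothField V) (hW : IsSmoothField W)
    {f : N → ℝ} (hf : ContMDiff I 𝓘(ℝ, ℝ) ∞ f) :
    curv D U V (f • W) x = f x • curv D U V W x := by
  have h : ∀ {Z : Π y : N, TangentSpace I y},
      along D Z (f • W) = f • along D Z W + (fun y => mvfderiv I f y (Z y)) • W := by
    intro Z; ext y; simp [along, conn_smul D (smooth_mdiffAt hf y) (hW.mdiffAt y)]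
  simp only [curv, h, conn_smul D (smooth_mdiffAt hf x) (hW.mdiffAt x)]
  have hs : ∀ {Z : Π y : N, TangentSpace I y}, IsSmoothField Z →
      D (f • along D Z W + (fun y => mvfderiv I f y (Z y)) • W) x =
      D (f • along D Z W) x + D ((fun y => mvfderiv I f y (Z y)) • W) x := fun hZ =>
    conn_add D (((along_smooth hD hZ hW).smul hf).mdiffAt x)
      ((hW.smul (smooth_mvfderiv_apply hf hZ)).mdiffAt x)
  rw [hs hV, hs hU]
  simp only [add_apply]
  rw [conn_smul D (smooth_mdiffAt hf x) ((along_smooth hD hV hW).mdiffAt x),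
    conn_smul D (smooth_mdiffAt hf x) ((along_smooth hD hU hW).mdiffAt x),
    conn_smul D (smooth_mdiffAt (smooth_mvfderiv_apply hf hV) x) (hW.mdiffAt x),
    conn_smul D (smooth_mdiffAt (smooth_mvfderiv_apply hf hU) x) (hW.mdiffAt x),
    mvfderiv_bracket hU hV hf]
  simp only [along_apply]
  module

omit [T2Space N] in
theorem curv_congr_right_of_eventuallyEq (hV : ContMDiffAt I I.tangent ∞ (T% V) x)
    (hU : ContMDiffAt I I.tangent ∞ (T% U) x) {W' : Π y : N, TangentSpace I y}
    (hW : IsSmoothField W) (h : ∀ᶠ y in 𝓝 x, W y = W' y) :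
    curv D U V W x = curv D U V W' x := by
  have hl : ∀ {Z : Π y : N, TangentSpace I y}, ∀ᶠ y in 𝓝 x, along D Z W y = along D Z W' y := by
    intro Z
    filter_upwards [h.eventually_nhds] with y hy
    rw [along, along, conn_congr D (hW.mdiffAt y) hy]
  rw [curv, curv, conn_congr D (hW.mdiffAt x) h,
    conn_congr D ((along_smoothAt hD hV hW).mdifferentiableAt (by simp)) hl,
    conn_congr D ((along_smoothAt hD hU hW).mdifferentiableAt (by simp)) hl]

/-- The curvature takes two derivatives of W, so differentiability at the point is not enough for
the usual tensoriality criterion. Instead W is expanded in a smooth frame near x and linearity over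
smooth functions is used. -/
theorem curv_congr_right {W' : Π y : N, TangentSpace I y} (hU : IsSmoothField U)
    (hV : IsSmoothField V) (hW : IsSmoothField W) (hW' : IsSmoothField W') (h : W x = W' x) :
    curv D U V W x = curv D U V W' x := by
  classical
  obtain ⟨Z, c, hZ, hc, -, hsum⟩ := exists_smooth_frame I N x
  have zero : curv D U V 0 x = 0 := by
    have := curv_smul_right hD (x := x) hU hV hW (f := fun _ => 0) contMDiff_const
    simpa [show ((fun _ => 0 : N → ℝ) • W) = 0 by ext; simp] using this
  have key : ∀ {W : Π y : N, TangentSpace I y}, IsSmoothField W →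
      curv D U V W x = ∑ i, c i x (W x) • curv D U V (Z i) x := by
    intro W hW
    choose f hf hfe using fun i => hc i W hW
    have hsm : ∀ s : Finset (Fin (Module.finrank ℝ E)), IsSmoothField (∑ i ∈ s, f i • Z i) ∧
        curv D U V (∑ i ∈ s, f i • Z i) x = ∑ i ∈ s, f i x • curv D U V (Z i) x := by
      intro s
      induction s using Finset.induction_on with
      | empty =>
        refine ⟨?_, by simpa using zero⟩
        simpa [show ((fun _ => 0 : N → ℝ) • W) = 0 by ext; simp] using
          hW.smul (f := fun _ => (0 : ℝ)) contMDiff_const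
      | insert a s ha ih =>
        rw [Finset.sum_insert ha, Finset.sum_insert ha]
        refine ⟨((hZ a).smul (hf a)).add ih.1, ?_⟩
        rw [curv_add_right hD hU hV ((hZ a).smul (hf a)) ih.1, ih.2,
          curv_smul_right hD hU hV (hZ a) (hf a)]
    have he : ∀ᶠ y in 𝓝 x, W y = (∑ i, f i • Z i) y := by
      filter_upwards [hsum, Filter.eventually_all.2 hfe] with y hy hfy
      rw [hy (W y)]
      simp [hfy]
    rw [curv_congr_right_of_eventuallyEq hD (hV x) (hU x) hW he, (hsm Finset.univ).2]
    exact Finset.sum_congr rfl fun i _ => by rw [(hfe i).self_of_nhds]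
  rw [key hW, key hW', h]

/-- The curvature can be computed with arbitrary smooth extensions. -/
theorem riemann_apply (hU : IsSmoothField U) (hV : IsSmoothField V) (hW : IsSmoothField W) :
    riemann D x (U x) (V x) (W x) = curv D U V W x := by
  obtain ⟨U', hU', hUe⟩ := exists_smoothField_eq_ext (U x)
  obtain ⟨V', hV', hVe⟩ := exists_smoothField_eq_ext (V x)
  obtain ⟨W', hW', hWe⟩ := exists_smoothField_eq_ext (W x)
  have hx : ∀ {Z Z' : Π y : N, TangentSpace I y}, (∀ᶠ y in 𝓝 x, Z' y = ext (Z x) y) →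
      Z x = Z' x := fun h => by rw [h.self_of_nhds, ext_self]
  rw [curv_congr_left hD hU hU' hV hW (hx hUe), curv_congr_mid hD hU' hV hV' hW (hx hVe),
    curv_congr_right hD hU' hV' hW hW' (hx hWe),
    curv_congr_right_of_eventuallyEq hD (hV' x) (hU' x) hW' hWe]
  have hext : ∀ᶠ y in 𝓝 x, MDiffAt (T% (ext (W x))) y := by
    filter_upwards [hWe.eventually_nhds] with y hy
    exact mdiffAt_congr_field (hW'.mdiffAt y) hy
  have hl : ∀ {Z Z' : Π y : N, TangentSpace I y}, (∀ᶠ y in 𝓝 x, Z y = Z' y) →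
      ∀ᶠ y in 𝓝 x, along D Z (ext (W x)) y = along D Z' (ext (W x)) y :=
    fun h => h.mono fun y hy => by rw [along, along, hy]
  have hm : ∀ {Z : Π y : N, TangentSpace I y}, IsSmoothField Z →
      MDiffAt (T% (along D Z (ext (W x)))) x := by
    intro Z hZ
    refine mdiffAt_congr_field ((along_smooth hD hZ hW').mdiffAt x) ?_
    filter_upwards [hWe.eventually_nhds] with y hy
    rw [along, along, conn_congr D (hW'.mdiffAt y) hy]
  rw [riemann, curv, conn_congr D (hm hV') (hl hVe), conn_congr D (hm hU') (hl hUe),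
    hUe.self_of_nhds, hVe.self_of_nhds, ext_self, ext_self,
    Filter.EventuallyEq.mlieBracket_vectorField_eq hUe hVe]

variable (x) in
theorem riemann_swap (u v w : TangentSpace I x) : riemann D x u v w = - riemann D x v u w := by
  obtain ⟨U, hU, rfl⟩ := exists_smoothField_apply u
  obtain ⟨V, hV, rfl⟩ := exists_smoothField_apply v
  obtain ⟨W, hW, rfl⟩ := exists_smoothField_apply w
  rw [riemann_apply hD hU hV hW, riemann_apply hD hV hU hW, curv_swap]

theorem riemann_add_left (u u' v w : TangentSpace I x) :
    riemann D x (u + u') v w = riemann D x u v w + riemann D x u' v w := by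
  obtain ⟨U, hU, rfl⟩ := exists_smoothField_apply u
  obtain ⟨U', hU', rfl⟩ := exists_smoothField_apply u'
  obtain ⟨V, hV, rfl⟩ := exists_smoothField_apply v
  obtain ⟨W, hW, rfl⟩ := exists_smoothField_apply w
  rw [riemann_apply hD hU hV hW, riemann_apply hD hU' hV hW]
  exact (riemann_apply hD (hU.add hU') hV hW).trans
    ((curv_tensorial hD hV hW).add (hU.mdiffAt x) (hU'.mdiffAt x))

theorem riemann_smul_left (a : ℝ) (u v w : TangentSpace I x) :
    riemann D x (a • u) v w = a • riemann D x u v w := by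
  obtain ⟨U, hU, rfl⟩ := exists_smoothField_apply u
  obtain ⟨V, hV, rfl⟩ := exists_smoothField_apply v
  obtain ⟨W, hW, rfl⟩ := exists_smoothField_apply w
  rw [riemann_apply hD hU hV hW]
  exact (riemann_apply hD (hU.smul (f := fun _ => a) contMDiff_const) hV hW).trans
    ((curv_tensorial hD hV hW).smul mdifferentiableAt_const (hU.mdiffAt x))

theorem riemann_add_right (u v w w' : TangentSpace I x) :
    riemann D x u v (w + w') = riemann D x u v w + riemann D x u v w' := by
  obtain ⟨U, hU, rfl⟩ := exists_smoothField_apply u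
  obtain ⟨V, hV, rfl⟩ := exists_smoothField_apply v
  obtain ⟨W, hW, rfl⟩ := exists_smoothField_apply w
  obtain ⟨W', hW', rfl⟩ := exists_smoothField_apply w'
  rw [riemann_apply hD hU hV hW, riemann_apply hD hU hV hW']
  exact (riemann_apply hD hU hV (hW.add hW')).trans (curv_add_right hD hU hV hW hW')

theorem riemann_smul_right (a : ℝ) (u v w : TangentSpace I x) :
    riemann D x u v (a • w) = a • riemann D x u v w := by
  obtain ⟨U, hU, rfl⟩ := exists_smoothField_apply u
  obtain ⟨V, hV, rfl⟩ := exists_smoothField_apply v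
  obtain ⟨W, hW, rfl⟩ := exists_smoothField_apply w
  rw [riemann_apply hD hU hV hW]
  exact (riemann_apply hD hU hV (hW.smul (f := fun _ => a) contMDiff_const)).trans
    (curv_smul_right hD hU hV hW contMDiff_const)

theorem riemann_add_mid (u v v' w : TangentSpace I x) :
    riemann D x u (v + v') w = riemann D x u v w + riemann D x u v' w := by
  rw [riemann_swap hD, riemann_add_left hD, riemann_swap hD x v, riemann_swap hD x v']
  abel

theorem riemann_smul_mid (a : ℝ) (u v w : TangentSpace I x) :
    riemann D x u (a • v) w = a • riemann D x u v w := by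
  rw [riemann_swap hD, riemann_smul_left hD, riemann_swap hD x v]
  simp

end Curvature

/-! ### A smoothness criterion -/

/-- Smoothness of v ↦ D_v σ as a section of a Hom bundle is read in a trivialization: it is the sum
over a local frame Z_i of the dual basis form times D_{Z_i} σ. This is how the connections
constructed below are shown to be smooth. -/
theorem contMDiff_of_along [T2Space N] {D : Connection I N}
    (h : ∀ V Y : Π y : N, TangentSpace I y, IsSmoothField V → IsSmoothField Y →
      IsSmoothField (along D V Y)) :
    CovariantDerivative.ContMDiffCovariantDerivative D ∞ := by
  refine ⟨⟨fun {σ} hσ => ?_⟩⟩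
  have hσ' : IsSmoothField σ := contMDiffOn_univ.1 hσ
  rw [contMDiffOn_univ]
  intro x
  rw [contMDiffAt_hom_bundle]
  refine ⟨contMDiffAt_id, ?_⟩
  let e := trivializationAt E (TangentSpace I) x
  let b := Module.finBasis ℝ E
  have hx : x ∈ e.baseSet := FiberBundle.mem_baseSet_trivializationAt' x
  choose Z hZ hZe using fun i => exists_smoothField_of_contMDiffOn e.open_baseSet
    (e.contMDiffOn_localFrame_baseSet (I := I) ∞ b i) hx
  have hs : ∀ i, ContMDiffAt I 𝓘(ℝ, E) ∞ (fun y => (e ⟨y, along D (Z i) σ y⟩).2) x := fun i =>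
    (contMDiffAt_section _).1 (h _ _ (hZ i) hσ' x)
  have hsum : ContMDiffAt I 𝓘(ℝ, E →L[ℝ] E) ∞ (fun y => ∑ i,
      ContinuousLinearMap.smulRightL ℝ E E (b.coord i).toContinuousLinearMap
        ((e ⟨y, along D (Z i) σ y⟩).2)) x := by
    refine ContMDiffAt.sum fun i _ => ?_
    exact (ContinuousLinearMap.contMDiff _).contMDiffAt.comp x (hs i)
  refine hsum.congr_of_eventuallyEq ?_
  filter_upwards [e.open_baseSet.mem_nhds hx, Filter.eventually_all.2 hZe] with y hy hZy
  refine ContinuousLinearMap.coe_injective (b.ext fun j => ?_)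
  simp only [ContinuousLinearMap.coe_coe]
  rw [sum_apply, Finset.sum_eq_single j]
  · simp only [ContinuousLinearMap.smulRightL_apply_apply, along_apply, hZy]
    have hfr : e.localFrame b j y = e.symmL ℝ y (b j) := by
      rw [e.localFrame_apply_of_mem_baseSet b hy, Trivialization.basisAt]
      simp [e.symmL_apply hy]
    rw [ContinuousLinearMap.smulRight_apply, hfr, ContinuousLinearMap.inCoordinates]
    simp only [ContinuousLinearMap.comp_apply]
    rw [Trivialization.continuousLinearMapAt_apply, e.coe_linearMapAt_of_mem hy]
    simp
    rfl
  · intro i _ hij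
    simp [hij.symm]
  · simp

end

end Affine

/-! ### Tangent vectors in the preferred charts -/

namespace Affine

noncomputable section

variable {E : Type*} [NormedAddCommGroup E] [NormedSpace ℝ E] [FiniteDimensional ℝ E]
  [CompleteSpace E] {H : Type*} [TopologicalSpace H] {I : ModelWithCorners ℝ E H}
  {N : Type*} [TopologicalSpace N] [ChartedSpace H N] [IsManifold I ∞ N]

theorem trivializationAt_self (x : N) (v : TangentSpace I x) :
    (trivializationAt E (TangentSpace I) x ⟨x, v⟩).2 = v :=
  congrArg Prod.snd ((tangentBundleCore I N).localTrivAt_apply ⟨x, v⟩)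

/-- The components of a tangent vector at `y` in the preferred chart at `x`. -/
def chartVec (x y : N) : TangentSpace I y →L[ℝ] TangentSpace I x :=
  (trivializationAt E (TangentSpace I) x).continuousLinearMapAt ℝ y

theorem ext_eq_symmL {x y : N} (hy : y ∈ (chartAt H x).source) (v : TangentSpace I x) :
    ext v y = (trivializationAt E (TangentSpace I) x).symmL ℝ y (v : E) := by
  have hb : y ∈ (trivializationAt E (TangentSpace I : N → Type _) x).baseSet := hy
  have h2 : ext v y = (trivializationAt E (TangentSpace I) x).symm y (v : E) := by
    simp only [ext, FiberBundle.extend]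
    rw [trivializationAt_self]
  exact h2.trans ((trivializationAt E (TangentSpace I) x).symmL_apply hb (v : E)).symm

theorem chartVec_ext {x y : N} (hy : y ∈ (chartAt H x).source) (v : TangentSpace I x) :
    chartVec x y (ext v y) = v := by
  have hb : y ∈ (trivializationAt E (TangentSpace I : N → Type _) x).baseSet := hy
  rw [ext_eq_symmL hy]
  exact Trivialization.continuousLinearMapAt_symmL (R := ℝ)
    (trivializationAt E (TangentSpace I : N → Type _) x) hb (v : E)

theorem ext_chartVec {x y : N} (hy : y ∈ (chartAt H x).source) (v : TangentSpace I y) :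
    ext (chartVec x y v) y = v := by
  have hb : y ∈ (trivializationAt E (TangentSpace I : N → Type _) x).baseSet := hy
  rw [ext_eq_symmL hy]
  exact Trivialization.symmL_continuousLinearMapAt (R := ℝ)
    (trivializationAt E (TangentSpace I : N → Type _) x) hb v

theorem mfderiv_extChartAt {x y : N} (hy : y ∈ (chartAt H x).source) (v : TangentSpace I y) :
    (mfderiv I 𝓘(ℝ, E) (extChartAt I x) y : TangentSpace I y →L[ℝ] E) v = chartVec x y v :=
  congrArg (fun L : TangentSpace I y →L[ℝ] E => L v)
    (TangentBundle.continuousLinearMapAt_trivializationAt hy).symm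

theorem chartVec_eq_trivialization {x y : N} (hy : y ∈ (chartAt H x).source)
    (v : TangentSpace I y) : chartVec x y v =
      (trivializationAt E (TangentSpace I) x ⟨y, v⟩).2 := by
  have hb : y ∈ (trivializationAt E (TangentSpace I : N → Type _) x).baseSet := hy
  exact Trivialization.continuousLinearMapAt_apply_of_mem (R := ℝ) _ hb v

theorem eq_of_chartVec {x y : N} (hy : y ∈ (chartAt H x).source)
    {v w : TangentSpace I y} (h : chartVec x y v = chartVec x y w) : v = w := by
  rw [← ext_chartVec hy v, h, ext_chartVec hy]

theorem smoothAt_ext {x : N} (v : TangentSpace I x) : ContMDiffAt I I.tangent ∞ (T% (ext v)) x :=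
  FiberBundle.contMDiffAt_extend I E v

end

end Affine

namespace AH

open Affine

noncomputable section

variable {M : Type*} [TopologicalSpace M] [ChartedSpace Plane M] [IsManifold (𝓡 2) ∞ M]

/-! ### The wedge product on the model plane -/

/-- The standard area form of the model plane. -/
def wedge (v w : Plane) : ℝ := v 0 * w 1 - v 1 * w 0

theorem wedge_map (A : Plane →L[ℝ] Plane) (v w : Plane) :
    wedge (A v) (A w) = A.det * wedge v w := by
  have hdec : ∀ z : Plane, z = z 0 • EuclideanSpace.single 0 (1 : ℝ) +
      z 1 • EuclideanSpace.single 1 (1 : ℝ) := by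
    intro z; ext i; fin_cases i <;> simp
  have hdet : A.det = A (EuclideanSpace.single 0 1) 0 * A (EuclideanSpace.single 1 1) 1 -
      A (EuclideanSpace.single 1 1) 0 * A (EuclideanSpace.single 0 1) 1 := by
    rw [ContinuousLinearMap.det,
      ← LinearMap.det_toMatrix (EuclideanSpace.basisFun (Fin 2) ℝ).toBasis, Matrix.det_fin_two]
    simp [LinearMap.toMatrix_apply]
  have h : ∀ z : Plane, ∀ i, A z i = z 0 * A (EuclideanSpace.single 0 1) i +
      z 1 * A (EuclideanSpace.single 1 1) i := by
    intro z i
    conv_lhs => rw [hdec z]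
    simp
  rw [wedge, wedge, hdet, h v, h w, h v, h w]
  ring

theorem twoForm_eq (q : Cone M) (v w : TangentSpace (𝓡 2) (proj q)) :
    twoForm q v w = component q * wedge v w := rfl

/-! ### Charts -/

/-- The change of coordinates of tangent vectors at `y` from the preferred chart at `x` to the
preferred chart at `y`. -/
def chartJac (x y : M) : Plane →L[ℝ] Plane :=
  (tangentBundleCore (𝓡 2) M).coordChange (achart Plane x) (achart Plane y) y

theorem ext_eq_chartJac {x y : M} (hy : y ∈ (chartAt Plane x).source)
    (w : TangentSpace (𝓡 2) x) : ext w y = chartJac x y w := by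
  have hb : y ∈ (trivializationAt Plane (TangentSpace (𝓡 2) : M → Type _) x).baseSet := hy
  have h1 : ext w y = (trivializationAt Plane (TangentSpace (𝓡 2)) x).symm y w := by
    simp only [FiberBundle.extend]
    rw [trivializationAt_self]
  rw [h1]
  exact (tangentBundleCore (𝓡 2) M).localTriv_symm_apply (achart Plane x) hb w

theorem chartJac_self (x : M) : chartJac x x = ContinuousLinearMap.id ℝ Plane := by
  ext1 w
  exact (ext_eq_chartJac (mem_chart_source Plane x) w).symm.trans
    (ext_self (I := 𝓡 2) (x := x) w)

/-- The fibre coordinate on `Cone M` given by the preferred chart at `x`. -/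
def fib (x : M) (q : Cone M) : ℝ := (trivializationAt ℝ (detCotangent M).Fiber x q.1).2

theorem fib_eq (x : M) (q : Cone M) : fib x q = (chartJac x (proj q)).det * component q := rfl

theorem fib_self (p : Cone M) : fib (proj p) p = component p := by
  rw [fib_eq, chartJac_self]
  simp [ContinuousLinearMap.det]

theorem component_ne_zero (p : Cone M) : component p ≠ 0 := p.2

theorem proj_smooth : ContMDiff coneModel (𝓡 2) ∞ (proj : Cone M → M) :=
  (contMDiff_proj (IB := 𝓡 2) (F := ℝ) (detCotangent M).Fiber).comp contMDiff_subtype_val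

theorem dproj_eq (p : Cone M) : dproj p = mfderiv coneModel (𝓡 2) proj p := rfl

theorem isOpen_proj_source (x : M) : IsOpen {q : Cone M | proj q ∈ (chartAt Plane x).source} :=
  (chartAt Plane x).open_source.preimage proj_smooth.continuous

theorem proj_source_eventually (p : Cone M) :
    ∀ᶠ q in 𝓝 p, proj q ∈ (chartAt Plane (proj p)).source :=
  (isOpen_proj_source (proj p)).mem_nhds (mem_chart_source Plane (proj p))

theorem fib_smoothOn (x : M) : ContMDiffOn coneModel 𝓘(ℝ, ℝ) ∞ (fib x)
    {q : Cone M | proj q ∈ (chartAt Plane x).source} := by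
  have h : ContMDiffOn ((𝓡 2).prod 𝓘(ℝ, ℝ)) 𝓘(ℝ, ℝ) ∞
      (fun θ : DetTotal M => (trivializationAt ℝ (detCotangent M).Fiber x θ).2)
      (trivializationAt ℝ (detCotangent M).Fiber x).source :=
    contMDiff_snd.comp_contMDiffOn (Trivialization.contMDiffOn _)
  refine h.comp (contMDiff_subtype_val (U := coneOpens M)).contMDiffOn fun q hq => ?_
  rw [mem_preimage, Trivialization.mem_source]
  exact hq

theorem fib_smoothAt {x : M} {q : Cone M} (hq : proj q ∈ (chartAt Plane x).source) :
    ContMDiffAt coneModel 𝓘(ℝ, ℝ) ∞ (fib x) q :=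
  (fib_smoothOn x).contMDiffAt ((isOpen_proj_source x).mem_nhds hq)

/-- The cone is open in the total space of a line bundle, so its preferred chart is the base chart
together with the fibre coordinate. Differentials of `proj` and `fib` are computed from this. -/
theorem extChartAt_cone (p q : Cone M) :
    extChartAt coneModel p q = (extChartAt (𝓡 2) (proj p) (proj q), fib (proj p) q) := rfl

theorem mem_chart_source_cone {p q : Cone M} :
    q ∈ (chartAt (ModelProd Plane ℝ) p).source ↔ proj q ∈ (chartAt Plane (proj p)).source := by
  rw [TopologicalSpace.Opens.chartAt_eq, OpenPartialHomeomorph.subtypeRestr_source, mem_preimage,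
    FiberBundle.chartedSpace_chartAt, OpenPartialHomeomorph.trans_source, mem_inter_iff]
  constructor
  · rintro ⟨h, -⟩
    exact (Trivialization.mem_source _).1 h
  · intro h
    refine ⟨(Trivialization.mem_source _).2 h, ?_⟩
    rw [mem_preimage, OpenPartialHomeomorph.prod_source]
    exact ⟨h, mem_univ _⟩

theorem twoForm_ext {x : M} {q : Cone M} (hq : proj q ∈ (chartAt Plane x).source)
    (v w : TangentSpace (𝓡 2) x) :
    twoForm q (ext v (proj q)) (ext w (proj q)) = fib x q * wedge v w := by
  rw [twoForm_eq, ext_eq_chartJac hq, ext_eq_chartJac hq, fib_eq]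
  have := wedge_map (chartJac x (proj q)) v w
  rw [this]
  ring

theorem fib_ne_zero {x : M} {q : Cone M} (hq : proj q ∈ (chartAt Plane x).source) :
    fib x q ≠ 0 := by
  have hq' : q.1 ∈ (trivializationAt ℝ (detCotangent M).Fiber x).source := by
    rw [Trivialization.mem_source]; exact hq
  have := ((trivializationAt ℝ (detCotangent M).Fiber x).continuousLinearEquivAt ℝ q.1.proj
    hq).map_eq_zero_iff (x := q.1.2)
  exact fun h => component_ne_zero q (this.1 h)

/-! ### The action and its generator -/

theorem proj_scale (r : ℝˣ) (p : Cone M) : proj (scale r p) = proj p := rfl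

theorem component_scale (r : ℝˣ) (p : Cone M) :
    component (scale r p) = (r : ℝ) ^ 3 * component p := rfl

theorem fib_scale (x : M) (r : ℝˣ) (p : Cone M) : fib x (scale r p) = (r : ℝ) ^ 3 * fib x p := by
  simp only [fib_eq, proj_scale, component_scale]
  ring

theorem scale_one (p : Cone M) : scale 1 p = p := by
  apply Subtype.ext
  simp only [scale, Units.val_one, one_pow, one_mul]
  rfl

/-- A map into the cone has two components, the base point and the fibre coordinate. The coordinate
is taken in the fixed chart at the image point, since `component` follows the preferred chart and
may jump. -/
theorem contMDiffAt_cone_iff {E' : Type*} [NormedAddCommGroup E'] [NormedSpace ℝ E']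
    {H' : Type*} [TopologicalSpace H'] {I' : ModelWithCorners ℝ E' H'} {N' : Type*}
    [TopologicalSpace N'] [ChartedSpace H' N'] {f : N' → Cone M} {z : N'} :
    ContMDiffAt I' coneModel ∞ f z ↔ ContMDiffAt I' (𝓡 2) ∞ (fun y => proj (f y)) z ∧
      ContMDiffAt I' 𝓘(ℝ, ℝ) ∞ (fun y => fib (proj (f z)) (f y)) z := by
  rw [← ContMDiffAt.subtypeVal_comp_iff, contMDiffAt_totalSpace]
  rfl

theorem scale_smooth (r : ℝˣ) : ContMDiff coneModel coneModel ∞ (scale r : Cone M → Cone M) := by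
  intro p
  rw [contMDiffAt_cone_iff]
  refine ⟨proj_smooth p, ?_⟩
  simp only [fib_scale, proj_scale]
  exact contMDiffAt_const.mul (fib_smoothAt (mem_chart_source Plane (proj p)))

/-- The orbit `t ↦ R_{e^t} p`. -/
def orbit (p : Cone M) (t : ℝ) : Cone M := scale (Units.mk0 (Real.exp t) (Real.exp_ne_zero t)) p

theorem orbit_zero (p : Cone M) : orbit p 0 = p := by
  rw [orbit]
  convert scale_one p
  ext; simp

theorem orbit_smooth (p : Cone M) : ContMDiff 𝓘(ℝ, ℝ) coneModel ∞ (orbit p) := by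
  intro t
  rw [contMDiffAt_cone_iff]
  refine ⟨contMDiffAt_const, ?_⟩
  simp only [orbit, fib_scale, proj_scale, Units.val_mk0]
  exact (((Real.contDiff_exp.contDiffAt.pow 3).mul contDiffAt_const)).contMDiffAt

/-- Tangent spaces at propositionally equal points are different types, so the equation is stated on
the model space. It is needed because an orbit passes through p at time 0 only up to such an
equality. -/
theorem mfderiv_point_eq {E₁ E₂ : Type*} [NormedAddCommGroup E₁] [NormedSpace ℝ E₁]
    [NormedAddCommGroup E₂] [NormedSpace ℝ E₂]
    {H₁ H₂ : Type*} [TopologicalSpace H₁] [TopologicalSpace H₂] {I₁ : ModelWithCorners ℝ E₁ H₁}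
    {I₂ : ModelWithCorners ℝ E₂ H₂} {N₁ N₂ : Type*} [TopologicalSpace N₁] [TopologicalSpace N₂]
    [ChartedSpace H₁ N₁] [ChartedSpace H₂ N₂] (g : N₁ → N₂) {x y : N₁} (h : x = y) (v : E₁) :
    (show E₂ from (mfderiv I₁ I₂ g x : E₁ →L[ℝ] E₂) v) =
      (mfderiv I₁ I₂ g y : E₁ →L[ℝ] E₂) v := by
  subst h; rfl

theorem mfderiv_radial {E₂ : Type*} [NormedAddCommGroup E₂] [NormedSpace ℝ E₂]
    {H₂ : Type*} [TopologicalSpace H₂] {I₂ : ModelWithCorners ℝ E₂ H₂} {N₂ : Type*}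
    [TopologicalSpace N₂] [ChartedSpace H₂ N₂] {g : Cone M → N₂} {p : Cone M}
    (hg : MDifferentiableAt coneModel I₂ g p) :
    (show E₂ from (mfderiv coneModel I₂ g p : Plane × ℝ →L[ℝ] E₂) (radial p)) =
      (mfderiv 𝓘(ℝ, ℝ) I₂ (g ∘ orbit p) 0 : ℝ →L[ℝ] E₂) 1 := by
  have h := mfderiv_comp_of_eq (I := 𝓘(ℝ, ℝ)) (I' := coneModel) (I'' := I₂) (g := g)
    (f := orbit p) (x := 0) hg ((orbit_smooth p).mdifferentiable (by simp) 0) (orbit_zero p)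
  have h2 := mfderiv_point_eq (I₁ := coneModel) (I₂ := I₂) g (orbit_zero p) (radial p)
  refine h2.symm.trans ?_
  exact (congrArg (fun L : ℝ →L[ℝ] E₂ => L 1) h).symm

theorem mvfderiv_radial {φ : Cone M → ℝ} {p : Cone M}
    (hφ : MDifferentiableAt coneModel 𝓘(ℝ, ℝ) φ p) :
    mvfderiv coneModel φ p (radial p) = deriv (fun t => φ (orbit p t)) 0 := by
  refine (mfderiv_radial hφ).trans ?_
  rw [mfderiv_eq_fderiv]
  rfl

theorem dproj_radial (p : Cone M) : dproj p (radial p) = 0 := by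
  refine (mfderiv_radial (proj_smooth.mdifferentiable (by simp) p)).trans ?_
  have : (proj ∘ orbit p) = fun _ => proj p := rfl
  rw [this, mfderiv_const]
  rfl

theorem deriv_exp_cube (a : ℝ) : deriv (fun t => Real.exp t ^ 3 * a) 0 = 3 * a := by
  have : HasDerivAt (fun t => Real.exp t ^ 3 * a) ((3 * Real.exp 0 ^ 2 * Real.exp 0) * a) 0 := by
    simpa using ((Real.hasDerivAt_exp 0).pow 3).mul_const a
  rw [this.deriv]
  simp

/-- The factor 3 arises because R_r multiplies the two-form by r³. -/
theorem fib_radial {x : M} {q : Cone M} (hq : proj q ∈ (chartAt Plane x).source) :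
    mvfderiv coneModel (fib x) q (radial q) = 3 * fib x q := by
  rw [mvfderiv_radial (smoothAt_mdiffAt (fib_smoothAt hq))]
  simp only [orbit, fib_scale, Units.val_mk0]
  exact deriv_exp_cube _

/-- In the preferred charts at p and at its base point, the projection is the first coordinate
projection. -/
theorem hasMFDerivAt_proj (p : Cone M) : HasMFDerivAt coneModel (𝓡 2) proj p
    (ContinuousLinearMap.fst ℝ Plane ℝ : Plane × ℝ →L[ℝ] Plane) := by
  refine ⟨proj_smooth.continuous.continuousAt, ?_⟩
  refine (ContinuousLinearMap.hasFDerivWithinAt _).congr_of_eventuallyEq ?_ ?_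
  · filter_upwards [extChartAt_target_mem_nhdsWithin (I := coneModel) p] with z hz
    have := (extChartAt coneModel p).right_inv hz
    rw [extChartAt_cone] at this
    have h2 := congrArg Prod.fst this
    exact h2
  · have := (extChartAt coneModel p).right_inv (mem_extChartAt_target p)
    rw [extChartAt_cone] at this
    have h2 := congrArg Prod.fst this
    exact h2

theorem hasMFDerivAt_fib (p : Cone M) : HasMFDerivAt coneModel 𝓘(ℝ, ℝ) (fib (proj p)) p
    (ContinuousLinearMap.snd ℝ Plane ℝ : Plane × ℝ →L[ℝ] ℝ) := by
  refine ⟨(fib_smoothAt (mem_chart_source Plane (proj p))).continuousAt, ?_⟩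
  refine (ContinuousLinearMap.hasFDerivWithinAt _).congr_of_eventuallyEq ?_ ?_
  · filter_upwards [extChartAt_target_mem_nhdsWithin (I := coneModel) p] with z hz
    have := (extChartAt coneModel p).right_inv hz
    rw [extChartAt_cone] at this
    have h2 := congrArg Prod.snd this
    exact h2
  · have := (extChartAt coneModel p).right_inv (mem_extChartAt_target p)
    rw [extChartAt_cone] at this
    have h2 := congrArg Prod.snd this
    exact h2

theorem dproj_apply (p : Cone M) (v : TangentSpace coneModel p) :
    dproj p v = (show Plane × ℝ from v).1 := by
  rw [dproj_eq, (hasMFDerivAt_proj p).mfderiv]; rfl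

theorem mvfderiv_fib (p : Cone M) (v : TangentSpace coneModel p) :
    mvfderiv coneModel (fib (proj p)) p v = (show Plane × ℝ from v).2 :=
  congrArg (fun L : Plane × ℝ →L[ℝ] ℝ => L v) (hasMFDerivAt_fib p).mfderiv

theorem radial_eq (p : Cone M) : radial p = (show TangentSpace coneModel p from
    ((0, 3 * component p) : Plane × ℝ)) := by
  have h1 := dproj_radial p
  have h2 := fib_radial (mem_chart_source Plane (proj p))
  rw [mvfderiv_fib, fib_self] at h2
  rw [dproj_apply] at h1
  exact Prod.ext h1 h2

end

end AH

namespace Affine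

noncomputable section

variable {E : Type*} [NormedAddCommGroup E] [NormedSpace ℝ E] [FiniteDimensional ℝ E]
  [CompleteSpace E] {H : Type*} [TopologicalSpace H] {I : ModelWithCorners ℝ E H}
  {N : Type*} [TopologicalSpace N] [ChartedSpace H N] [IsManifold I ∞ N]

/-- Differentiability of a vector field at a point. -/
abbrev FieldDiffAt (X : Π y : N, TangentSpace I y) (x : N) : Prop :=
  MDifferentiableAt I I.tangent (fun y => (⟨y, X y⟩ : TangentBundle I N)) x

/-- Smoothness of a vector field at a point. -/
abbrev FieldSmoothAt (X : Π y : N, TangentSpace I y) (x : N) : Prop :=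
  ContMDiffAt I I.tangent ∞ (fun y => (⟨y, X y⟩ : TangentBundle I N)) x

theorem FieldSmoothAt.diffAt {X : Π y : N, TangentSpace I y} {x : N} (h : FieldSmoothAt X x) :
    FieldDiffAt X x :=
  h.mdifferentiableAt (by simp)

/-! ### Components in charts -/

theorem chart_source_eventually (x : N) : ∀ᶠ y in 𝓝 x, y ∈ (chartAt H x).source :=
  (chartAt H x).open_source.mem_nhds (mem_chart_source H x)

theorem chartVec_self (x : N) (v : TangentSpace I x) : chartVec x x v = v := by
  rw [chartVec_eq_trivialization (mem_chart_source H x), trivializationAt_self]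

/-- The components of a vector field in the preferred chart at `x`. -/
def comps (X : Π y : N, TangentSpace I y) (x y : N) : E := chartVec x y (X y)

theorem comps_eventuallyEq (X : Π y : N, TangentSpace I y) (x : N) :
    comps X x =ᶠ[𝓝 x] fun y => (trivializationAt E (TangentSpace I) x ⟨y, X y⟩).2 :=
  (chart_source_eventually x).mono fun y hy => chartVec_eq_trivialization hy _

theorem smoothAt_iff_comps {X : Π y : N, TangentSpace I y} {x : N} :
    ContMDiffAt I I.tangent ∞ (T% X) x ↔ ContMDiffAt I 𝓘(ℝ, E) ∞ (comps X x) x := by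
  rw [contMDiffAt_section]
  exact ⟨fun h' => h'.congr_of_eventuallyEq (comps_eventuallyEq X x),
    fun h' => h'.congr_of_eventuallyEq (comps_eventuallyEq X x).symm⟩

theorem mdiffAt_iff_comps {X : Π y : N, TangentSpace I y} {x : N} :
    MDiffAt (T% X) x ↔ MDifferentiableAt I 𝓘(ℝ, E) (comps X x) x := by
  rw [mdifferentiableAt_section]
  exact ⟨fun h' => h'.congr_of_eventuallyEq (comps_eventuallyEq X x),
    fun h' => h'.congr_of_eventuallyEq (comps_eventuallyEq X x).symm⟩

/-- A function `f` with `f = ℓ ∘ extChartAt x` near `x`. -/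
theorem exists_smooth_mvfderiv_eq [T2Space N] (x : N) (l : E →L[ℝ] ℝ) :
    ∃ f : N → ℝ, ContMDiff I 𝓘(ℝ, ℝ) ∞ f ∧ ∀ v : TangentSpace I x, mvfderiv I f x v = l v := by
  have h : ContMDiffOn I 𝓘(ℝ, ℝ) ∞ (fun y => l (extChartAt I x y)) (chartAt H x).source :=
    l.contMDiff.comp_contMDiffOn (contMDiffOn_extChartAt (x := x))
  obtain ⟨f, hf, he⟩ := exists_smooth_of_contMDiffOn (chartAt H x).open_source h
    (mem_chart_source H x)
  refine ⟨f, hf, fun v => ?_⟩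
  rw [mvfderiv_congr he]
  have hc : MDifferentiableAt I 𝓘(ℝ, E) (extChartAt I x) x :=
    mdifferentiableAt_extChartAt (mem_chart_source H x)
  have h2 := mvfderiv_comp_apply (I := 𝓘(ℝ, E)) (I' := I) (g := l) x l.mdifferentiableAt hc v
  refine h2.trans ?_
  have h3 := mfderiv_extChartAt (mem_chart_source H x) v
  rw [chartVec_self] at h3
  have h4 : (mvfderiv 𝓘(ℝ, E) l (extChartAt I x x) : E →L[ℝ] ℝ) = l := by
    exact (ContinuousLinearMap.mfderiv_eq l)
  exact (congrArg (fun L : E →L[ℝ] ℝ => L _) h4).trans (congrArg l h3)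

/-- Linear coordinate functions, cut off, already separate tangent vectors. Brackets of lifted
fields are identified in this way, through their action on functions. -/
theorem eq_of_mvfderiv [T2Space N] {x : N} {v w : TangentSpace I x}
    (h : ∀ f : N → ℝ, ContMDiff I 𝓘(ℝ, ℝ) ∞ f → mvfderiv I f x v = mvfderiv I f x w) :
    v = w := by
  have : ∀ l : E →L[ℝ] ℝ, l v = l w := by
    intro l
    obtain ⟨f, hf, hl⟩ := exists_smooth_mvfderiv_eq (I := I) x l
    rw [← hl, ← hl, h f hf]
  have key : ∀ a b : E, (∀ l : E →L[ℝ] ℝ, l a = l b) → a = b := fun a b h =>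
    (SeparatingDual.eq_iff_forall_dual_eq (R := ℝ)).2 h
  exact key v w this

theorem exists_smooth_mvfderiv_eq_one [T2Space N] {x : N} {v : TangentSpace I x} (hv : v ≠ 0) :
    ∃ f : N → ℝ, ContMDiff I 𝓘(ℝ, ℝ) ∞ f ∧ f x = 0 ∧ mvfderiv I f x v = 1 := by
  have : ∃ f : N → ℝ, ContMDiff I 𝓘(ℝ, ℝ) ∞ f ∧ mvfderiv I f x v ≠ 0 := by
    by_contra! hc
    exact hv (eq_of_mvfderiv fun f hf => by rw [hc f hf, map_zero])
  obtain ⟨f, hf, h0⟩ := this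
  have hg : MDiffAt (fun y => f y - f x) x := smooth_mdiffAt (hf.sub contMDiff_const) x
  have hd : mvfderiv I (fun y => f y - f x) x = mvfderiv I f x := by
    have := mvfderiv_sub (I := I) (smooth_mdiffAt hf x)
      (mdifferentiableAt_const (c := f x) (I := I) (I' := 𝓘(ℝ, ℝ)))
    rw [mvfderiv_const, sub_zero] at this
    exact this
  refine ⟨fun y => (mvfderiv I f x v)⁻¹ * (f y - f x),
    contMDiff_const.mul (hf.sub contMDiff_const), by simp, ?_⟩
  have := mvfderiv_mul (I := I) (mdifferentiableAt_const (c := (mvfderiv I f x v)⁻¹)) hg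
  rw [show (fun y => (mvfderiv I f x v)⁻¹ * (f y - f x)) =
    (fun _ => (mvfderiv I f x v)⁻¹) * fun y => f y - f x from rfl, this, mvfderiv_const, hd]
  simp [h0]

/-! ### Connections which agree on differentiable fields -/

/-- Two connections agree on all differentiable fields. -/
def Agree (D D' : Connection I N) : Prop :=
  ∀ (Y : Π x : N, TangentSpace I x) (x : N), MDiffAt (T% Y) x → D Y x = D' Y x

section Agree

variable {D D' : Connection I N}

theorem Agree.symm (h : Agree D D') : Agree D' D := fun Y x hY => (h Y x hY).symm

/-- Covariant derivatives of tensors are computed with the extensions `ext`, which are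
differentiable at the base point, so agreement on differentiable fields suffices. -/
theorem Agree.covTensor (h : Agree D D') {k : ℕ} (t : CoTensor I N k) (x : N)
    (u : TangentSpace I x) (v : Fin k → TangentSpace I x) :
    covTensor D t x u v = covTensor D' t x u v := by
  simp only [Affine.covTensor, h _ x (mdiffAt_ext _)]

theorem Agree.hess (h : Agree D D') (F : N → ℝ) (x : N) (v w : TangentSpace I x) :
    hess D F x v w = hess D' F x v w := h.covTensor _ x v _

theorem Agree.torsion (h : Agree D D') (hD : D.torsion = 0) : D'.torsion = 0 := by
  rw [CovariantDerivative.torsion_eq_zero_iff] at hD ⊢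
  intro X Y x hX hY
  rw [← h _ x hX, ← h _ x hY, hD hX hY]

theorem Agree.smooth (h : Agree D D')
    (hD : CovariantDerivative.ContMDiffCovariantDerivative D ∞) :
    CovariantDerivative.ContMDiffCovariantDerivative D' ∞ := by
  refine ⟨⟨fun {σ} hσ => (hD.contMDiff.contMDiff hσ).congr fun y _ => ?_⟩⟩
  have : D σ y = D' σ y :=
    h σ y (((contMDiffOn_univ.1 hσ) y).mdifferentiableAt (by simp))
  simp [this]

theorem Agree.along (h : Agree D D') {X Y : Π x : N, TangentSpace I x} (hY : IsSmoothField Y) :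
    along D X Y = along D' X Y := by
  ext x
  rw [Affine.along, Affine.along, h Y x (hY.mdiffAt x)]

/-- Curvature differentiates the fields D_V W again. With smooth extensions these are smooth, hence
differentiable, and the agreement applies twice. -/
theorem Agree.riemann [T2Space N] (h : Agree D D')
    (hD : CovariantDerivative.ContMDiffCovariantDerivative D ∞)
    (x : N) (u v w : TangentSpace I x) : riemann D x u v w = riemann D' x u v w := by
  obtain ⟨U, hU, rfl⟩ := exists_smoothField_apply u
  obtain ⟨V, hV, rfl⟩ := exists_smoothField_apply v
  obtain ⟨W, hW, rfl⟩ := exists_smoothField_apply w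
  rw [riemann_apply hD hU hV hW, riemann_apply (h.smooth hD) hU hV hW, curv, curv,
    ← h.along hW, ← h.along hW, h W x (hW.mdiffAt x),
    h _ x ((along_smooth hD hU hW).mdiffAt x), h _ x ((along_smooth hD hV hW).mdiffAt x)]

theorem Agree.isFlat [T2Space N] (h : Agree D D')
    (hD : CovariantDerivative.ContMDiffCovariantDerivative D ∞) (hf : IsFlat D) : IsFlat D' :=
  ⟨h.torsion hf.1, fun x u v w => by rw [← h.riemann hD, hf.2]⟩

end Agree

end

end Affine

namespace AH

open Affine

noncomputable section

variable {M : Type*} [TopologicalSpace M] [ChartedSpace Plane M] [IsManifold (𝓡 2) ∞ M]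

/-! ### Coordinates on the surface -/

theorem e_sum (x : M) (v : TangentSpace (𝓡 2) x) :
    v = (show Plane from v) 0 • e x 0 + (show Plane from v) 1 • e x 1 := by
  have h : ∀ z : Plane, z = z 0 • EuclideanSpace.single 0 (1 : ℝ) +
      z 1 • EuclideanSpace.single 1 (1 : ℝ) := by
    intro z; ext i; fin_cases i <;> simp
  exact h v

/-- The components of tangent vectors in the preferred chart at `x`. -/
def coord (x : M) (j : Fin 2) (y : M) : TangentSpace (𝓡 2) y →L[ℝ] ℝ :=
  (EuclideanSpace.proj j : Plane →L[ℝ] ℝ).comp (chartVec x y : TangentSpace (𝓡 2) y →L[ℝ] Plane)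

theorem coord_apply (x : M) (j : Fin 2) (y : M) (v : TangentSpace (𝓡 2) y) :
    coord x j y v = (show Plane from chartVec x y v) j := rfl

/-- The coordinate fields of the preferred chart at `x`. -/
def frame (x : M) (j : Fin 2) : Π y : M, TangentSpace (𝓡 2) y := ext (e x j)

theorem frame_self (x : M) (j : Fin 2) : frame x j x = e x j := ext_self _

theorem frame_smoothAt (x : M) (j : Fin 2) :
    FieldSmoothAt (frame x j) x := smoothAt_ext _

theorem frame_mdiffAt (x : M) (j : Fin 2) : FieldDiffAt (frame x j) x := mdiffAt_ext _

theorem frame_sum {x y : M} (hy : y ∈ (chartAt Plane x).source) (v : TangentSpace (𝓡 2) y) :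
    v = ∑ j, coord x j y v • frame x j y := by
  refine eq_of_chartVec hy ?_
  rw [Fin.sum_univ_two, map_add, map_smul, map_smul, frame, frame, chartVec_ext hy,
    chartVec_ext hy]
  exact e_sum x _

theorem coord_frame {x y : M} (hy : y ∈ (chartAt Plane x).source) (i j : Fin 2) :
    coord x i y (frame x j y) = if i = j then 1 else 0 := by
  rw [coord_apply, frame, chartVec_ext hy]
  simp [e]

theorem coord_self (x : M) (j : Fin 2) (v : TangentSpace (𝓡 2) x) :
    coord x j x v = (show Plane from v) j := by
  rw [coord_apply, chartVec_self]

theorem coord_smoothAt {X : Π y : M, TangentSpace (𝓡 2) y} {x : M}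
    (hX : FieldSmoothAt X x) (j : Fin 2) :
    ContMDiffAt (𝓡 2) 𝓘(ℝ, ℝ) ∞ (fun y => coord x j y (X y)) x :=
  (EuclideanSpace.proj j : Plane →L[ℝ] ℝ).contMDiff.contMDiffAt.comp x (smoothAt_iff_comps.1 hX)

theorem coord_mdiffAt {X : Π y : M, TangentSpace (𝓡 2) y} {x : M}
    (hX : FieldDiffAt X x) (j : Fin 2) : MDifferentiableAt (𝓡 2) 𝓘(ℝ, ℝ) (fun y => coord x j y (X y)) x :=
  (EuclideanSpace.proj j : Plane →L[ℝ] ℝ).mdifferentiableAt.comp x (mdiffAt_iff_comps.1 hX)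

/-- The components of a connection in a chart. -/
theorem conn_coord (D : Connection (𝓡 2) M) {X : Π y : M, TangentSpace (𝓡 2) y} {x : M}
    (hX : FieldDiffAt X x) (u : TangentSpace (𝓡 2) x) :
    D X x u = ∑ j, (mvfderiv (𝓡 2) (fun y => coord x j y (X y)) x u • e x j
      + coord x j x (X x) • D (frame x j) x u) := by
  have he : ∀ᶠ y in 𝓝 x, X y = ∑ j, ((fun z => coord x j z (X z)) • frame x j) y :=
    (chart_source_eventually x).mono fun y hy => frame_sum hy _
  have hs : ∀ j, FieldDiffAt ((fun z => coord x j z (X z)) • frame x j) x := fun j =>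
    (coord_mdiffAt hX j).smul_section (frame_mdiffAt x j)
  rw [conn_congr D hX he, conn_sum D _ fun i _ => hs i, sum_apply]
  refine Finset.sum_congr rfl fun j _ => ?_
  rw [conn_smul D (coord_mdiffAt hX j) (frame_mdiffAt x j), frame_self, add_comm]

end

end AH

namespace AH

open Affine

noncomputable section

variable {M : Type*} [TopologicalSpace M] [ChartedSpace Plane M] [IsManifold (𝓡 2) ∞ M]

/-! ### Metrics on the surface -/

section Metric

variable (h : Metric M)

section Smooth

variable {E' : Type*} [NormedAddCommGroup E'] [NormedSpace ℝ E'] {H' : Type*} [TopologicalSpace H']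
  {I' : ModelWithCorners ℝ E' H'} {N' : Type*} [TopologicalSpace N'] [ChartedSpace H' N']
  {b : N' → M} {X Y : Π z, TangentSpace (𝓡 2) (b z)} {z : N'}

/-- The fields are taken along a map b into M, so that the lemma also covers projections of vector
fields on the cone. -/
theorem inner_smoothAt
    (hX : ContMDiffAt I' (𝓡 2).tangent ∞ (fun z => (⟨b z, X z⟩ : TangentBundle (𝓡 2) M)) z)
    (hY : ContMDiffAt I' (𝓡 2).tangent ∞ (fun z => (⟨b z, Y z⟩ : TangentBundle (𝓡 2) M)) z) :
    ContMDiffAt I' 𝓘(ℝ, ℝ) ∞ (fun z => h.inner (b z) (X z) (Y z)) z := by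
  have hb : ContMDiffAt I' (𝓡 2) ∞ b z := (contMDiffAt_totalSpace.1 hX).1
  have : ContMDiffAt I' ((𝓡 2).prod 𝓘(ℝ)) ∞
      (fun m => TotalSpace.mk' ℝ (E := Bundle.Trivial M ℝ) (b m) (h.inner (b m) (X m) (Y m))) z := by
    apply ContMDiffAt.clm_bundle_apply₂ (F₁ := Plane) (F₂ := Plane)
    · exact ContMDiffAt.comp z h.contMDiff.contMDiffAt hb
    · exact hX
    · exact hY
  exact (contMDiffAt_totalSpace.1 this).2

theorem inner_mdiffAt
    (hX : MDifferentiableAt I' (𝓡 2).tangent (fun z => (⟨b z, X z⟩ : TangentBundle (𝓡 2) M)) z)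
    (hY : MDifferentiableAt I' (𝓡 2).tangent (fun z => (⟨b z, Y z⟩ : TangentBundle (𝓡 2) M)) z) :
    MDifferentiableAt I' 𝓘(ℝ, ℝ) (fun z => h.inner (b z) (X z) (Y z)) z := by
  have hb : MDifferentiableAt I' (𝓡 2) b z := ((mdifferentiableAt_totalSpace _ _).1 hX).1
  have : MDifferentiableAt I' ((𝓡 2).prod 𝓘(ℝ))
      (fun m => TotalSpace.mk' ℝ (E := Bundle.Trivial M ℝ) (b m) (h.inner (b m) (X m) (Y m))) z := by
    apply MDifferentiableAt.clm_bundle_apply₂ (F₁ := Plane) (F₂ := Plane)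
    · exact MDifferentiableAt.comp z (h.contMDiff.mdifferentiable (by simp) _) hb
    · exact hX
    · exact hY
  exact ((mdifferentiableAt_totalSpace _ _).1 this).2

end Smooth

theorem inner_eq (x : M) (v w : TangentSpace (𝓡 2) x) : h.inner x v w =
    (show Plane from v) 0 * (show Plane from w) 0 * h.inner x (e x 0) (e x 0) +
    ((show Plane from v) 0 * (show Plane from w) 1 +
      (show Plane from v) 1 * (show Plane from w) 0) * h.inner x (e x 0) (e x 1) +
    (show Plane from v) 1 * (show Plane from w) 1 * h.inner x (e x 1) (e x 1) := by
  conv_lhs => rw [e_sum x v, e_sum x w]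
  simp only [map_add, map_smul, add_apply, smul_apply, smul_eq_mul, h.symm x (e x 1) (e x 0)]
  ring

theorem gram_det (x : M) : (gram h x).det = h.inner x (e x 0) (e x 0) * h.inner x (e x 1) (e x 1) -
    h.inner x (e x 0) (e x 1) ^ 2 := by
  rw [Matrix.det_fin_two]
  simp only [gram, Matrix.of_apply, h.symm x (e x 1) (e x 0)]
  ring

theorem detTensor_apply (x : M) (v : Fin 4 → TangentSpace (𝓡 2) x) :
    detTensor h x v = (gram h x).det * (wedge (v 0) (v 1) * wedge (v 2) (v 3)) := by
  rw [detTensor, gram_det]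
  simp only [inner_eq h x (v 0), inner_eq h x (v 1), wedge]
  ring

theorem e_ne_zero (x : M) (i : Fin 2) : e x i ≠ 0 := by
  intro h
  have := congrArg (fun z : Plane => z i) (show (EuclideanSpace.single i (1 : ℝ) : Plane) = 0 from h)
  simp at this

/-- Gram–Schmidt: the vector h₀₀e₁ − h₀₁e₀ is nonzero and its squared length is h₀₀ times the
determinant. -/
theorem gram_det_pos (x : M) : 0 < (gram h x).det := by
  have h0 := h.pos x (e x 0) (e_ne_zero x 0)
  have hne : h.inner x (e x 0) (e x 0) • e x 1 - h.inner x (e x 0) (e x 1) • e x 0 ≠ 0 := by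
    intro hz
    have h1 := congrArg (coord x 1 x) hz
    rw [map_sub, map_smul, map_smul, map_zero, coord_self, coord_self] at h1
    simp [e] at h1
    exact h0.ne' h1
  have h1 := h.pos x _ hne
  have h2 : 0 < h.inner x (e x 0) (e x 0) * (gram h x).det := by
    refine h1.trans_eq ?_
    rw [gram_det]
    simp only [map_sub, map_smul, sub_apply, smul_apply, smul_eq_mul, h.symm x (e x 1) (e x 0)]
    ring
  exact pos_of_mul_pos_right h2 h0.le

/-- The determinant of `h` with respect to the coordinates of the preferred chart at `x`. -/
def chartDet (x y : M) : ℝ :=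
  detTensor h y ![frame x 0 y, frame x 1 y, frame x 0 y, frame x 1 y]

theorem chartDet_eq {x y : M} (hy : y ∈ (chartAt Plane x).source) :
    chartDet h x y = (gram h y).det * (chartJac x y).det ^ 2 := by
  rw [chartDet, detTensor_apply]
  have : wedge (frame x 0 y) (frame x 1 y) = (chartJac x y).det := by
    rw [frame, frame, ext_eq_chartJac hy, ext_eq_chartJac hy]
    refine (wedge_map _ _ _).trans ?_
    simp [wedge, e]
  simp only [Matrix.cons_val_zero, Matrix.cons_val_one, Matrix.cons_val]
  rw [this]
  ring

theorem chartDet_smoothAt (x : M) : ContMDiffAt (𝓡 2) 𝓘(ℝ, ℝ) ∞ (chartDet h x) x := by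
  have hs := fun i j => inner_smoothAt h (frame_smoothAt x i) (frame_smoothAt x j)
  exact ((hs 0 0).mul (hs 1 1)).sub ((hs 0 1).mul (hs 1 0))

theorem chartDet_self (x : M) : chartDet h x x = (gram h x).det := by
  rw [chartDet_eq h (mem_chart_source Plane x), chartJac_self]
  simp [ContinuousLinearMap.det]

end Metric

/-! ### The logarithm of the homogeneous radial coordinate -/

section Radius

variable (h : Metric M)

/-- The function `ρ` with `ρ (R_{e^t} p) = ρ p + t` such that `e^{3ρ}` is the ratio of a point
of `Cone M` to the area form of `h`. -/
def logRadius (p : Cone M) : ℝ := (1 / 6) * Real.log (component p ^ 2 / (gram h (proj p)).det)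

/-- The squared component of a two-form and det h both scale by the square of the Jacobian
determinant, so their quotient may be computed in any chart. This is what makes `logRadius` smooth
although `component` need not be. -/
theorem logRadius_eq {x : M} {q : Cone M} (hq : proj q ∈ (chartAt Plane x).source) :
    logRadius h q = (1 / 6) * Real.log (fib x q ^ 2 / chartDet h x (proj q)) := by
  have hJ : (chartJac x (proj q)).det ≠ 0 := fun h0 => fib_ne_zero hq (by rw [fib_eq, h0, zero_mul])
  rw [logRadius, chartDet_eq h hq, fib_eq, mul_pow, mul_comm _ (component q ^ 2),
    mul_div_mul_right _ _ (pow_ne_zero 2 hJ)]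

theorem logRadius_smooth : ContMDiff coneModel 𝓘(ℝ, ℝ) ∞ (logRadius h) := by
  intro p
  have h1 := fib_smoothAt (mem_chart_source Plane (proj p))
  have h2 : ContMDiffAt coneModel 𝓘(ℝ, ℝ) ∞ (fun q => chartDet h (proj p) (proj q)) p :=
    (chartDet_smoothAt h (proj p)).comp p (proj_smooth p)
  have h3 : chartDet h (proj p) (proj p) ≠ 0 := by
    rw [chartDet_self]; exact (gram_det_pos h _).ne'
  have h4 : ContMDiffAt coneModel 𝓘(ℝ, ℝ) ∞
      (fun q => fib (proj p) q ^ 2 / chartDet h (proj p) (proj q)) p := (h1.pow 2).div₀ h2 h3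
  have h5 : fib (proj p) p ^ 2 / chartDet h (proj p) (proj p) ≠ 0 :=
    div_ne_zero (pow_ne_zero 2 (fib_ne_zero (mem_chart_source Plane (proj p)))) h3
  have h6 := (Real.contDiffAt_log (n := ∞).2 h5).contMDiffAt.comp p h4
  refine ((contMDiffAt_const (c := (1 / 6 : ℝ))).mul h6).congr_of_eventuallyEq ?_
  exact (proj_source_eventually p).mono fun q hq => logRadius_eq h hq

theorem logRadius_scale (r : ℝˣ) (p : Cone M) :
    logRadius h (scale r p) = Real.log |(r : ℝ)| + logRadius h p := by
  have h1 : component p ^ 2 / (gram h (proj p)).det ≠ 0 :=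
    div_ne_zero (pow_ne_zero 2 (component_ne_zero p)) (gram_det_pos h _).ne'
  have h2 : ((r : ℝ) ^ 6) ≠ 0 := pow_ne_zero _ r.ne_zero
  rw [logRadius, logRadius, proj_scale, component_scale,
    show ((r : ℝ) ^ 3 * component p) ^ 2 / (gram h (proj p)).det =
      r ^ 6 * (component p ^ 2 / (gram h (proj p)).det) by ring, Real.log_mul h2 h1, Real.log_pow,
    Real.log_abs]
  push_cast
  ring

/-- The differential of `logRadius`. -/
def eta (p : Cone M) : TangentSpace coneModel p →L[ℝ] ℝ := mvfderiv coneModel (logRadius h) p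

theorem eta_radial (p : Cone M) : eta h p (radial p) = 1 := by
  rw [eta, mvfderiv_radial (smooth_mdiffAt (logRadius_smooth h) p)]
  have : (fun t => logRadius h (orbit p t)) = fun t => t + logRadius h p := by
    ext t
    rw [orbit, logRadius_scale]
    simp
  rw [this]
  simp

theorem radial_ne_zero (p : Cone M) (h : Metric M) : radial p ≠ 0 := fun h0 => by
  have := eta_radial h p
  rw [h0, map_zero] at this
  exact zero_ne_one this

/-- The kernel of the differential of the projection is spanned by the radial vector, on which η
takes the value 1. Identities on the cone are verified by comparing these two components. -/
theorem cone_ext {p : Cone M} {v w : TangentSpace coneModel p} (h1 : dproj p v = dproj p w)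
    (h2 : eta h p v = eta h p w) : v = w := by
  rw [← sub_eq_zero] at h1 h2 ⊢
  rw [← map_sub] at h1 h2
  set z := v - w with hz
  clear_value z
  have hr : z = ((show Plane × ℝ from z).2 / (3 * component p)) • radial p := by
    rw [radial_eq]
    rw [dproj_apply] at h1
    have hc : 3 * component p ≠ 0 := mul_ne_zero three_ne_zero (component_ne_zero p)
    refine Prod.ext (h1.trans (smul_zero _).symm) ?_
    exact (div_mul_cancel₀ _ hc).symm
  rw [hr, map_smul, eta_radial, smul_eq_mul, mul_one] at h2
  rw [hr, h2, zero_smul]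

/-- Tangent vectors of `M` as tangent vectors of `Cone M`, in the preferred chart. -/
def chartLift (p : Cone M) : TangentSpace (𝓡 2) (proj p) →L[ℝ] TangentSpace coneModel p :=
  (ContinuousLinearMap.inl ℝ Plane ℝ : Plane →L[ℝ] Plane × ℝ)

theorem dproj_chartLift (p : Cone M) (w : TangentSpace (𝓡 2) (proj p)) :
    dproj p (chartLift p w) = w := dproj_apply p _

/-- The horizontal lift of tangent vectors of `M`, with respect to the kernel of `eta`. -/
def hlift (p : Cone M) : TangentSpace (𝓡 2) (proj p) →L[ℝ] TangentSpace coneModel p :=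
  chartLift p - ((eta h p).comp (chartLift p)).smulRight (radial p)

theorem dproj_hlift (p : Cone M) (w : TangentSpace (𝓡 2) (proj p)) :
    dproj p (hlift h p w) = w := by
  rw [hlift]
  simp only [sub_apply, ContinuousLinearMap.smulRight_apply, map_sub, map_smul, dproj_radial,
    smul_zero, sub_zero, dproj_chartLift]

theorem eta_hlift (p : Cone M) (w : TangentSpace (𝓡 2) (proj p)) : eta h p (hlift h p w) = 0 := by
  rw [hlift]
  simp only [sub_apply, ContinuousLinearMap.smulRight_apply, map_sub, map_smul, eta_radial,
    smul_eq_mul, mul_one]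
  exact sub_self _

theorem cone_decomp (p : Cone M) (v : TangentSpace coneModel p) :
    v = eta h p v • radial p + hlift h p (dproj p v) := by
  refine cone_ext h ?_ ?_
  · rw [map_add, map_smul, dproj_radial, smul_zero, zero_add, dproj_hlift]
  · rw [map_add, map_smul, eta_radial, eta_hlift, add_zero, smul_eq_mul, mul_one]

end Radius

/-! ### Separation -/

/-- Points of one fibre are separated by the fibre coordinate, points of different fibres by their
projections. -/
instance cone_t2Space [T2Space M] : T2Space (Cone M) := by
  refine ⟨fun p q hpq => ?_⟩
  by_cases hx : proj p = proj q
  · have hf : fib (proj p) p ≠ fib (proj p) q := by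
      intro hf
      refine hpq ?_
      have hp : p ∈ (chartAt (ModelProd Plane ℝ) p).source := mem_chart_source _ p
      have hq : q ∈ (chartAt (ModelProd Plane ℝ) p).source := by
        rw [mem_chart_source_cone, ← hx]; exact mem_chart_source Plane _
      rw [← extChartAt_source coneModel] at hp hq
      refine (extChartAt coneModel p).injOn hp hq ?_
      rw [extChartAt_cone, extChartAt_cone, hf, hx]
    obtain ⟨u, v, hu, hv, hup, hvq, huv⟩ := t2_separation hf
    have hopen : ∀ {w : Set ℝ}, IsOpen w →
        IsOpen ({q : Cone M | proj q ∈ (chartAt Plane (proj p)).source} ∩ fib (proj p) ⁻¹' w) :=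
      fun hw => (fib_smoothOn (proj p)).continuousOn.isOpen_inter_preimage
        (isOpen_proj_source _) hw
    refine ⟨_, _, hopen hu, hopen hv, ⟨mem_chart_source Plane _, hup⟩, ⟨?_, hvq⟩, ?_⟩
    · rw [mem_ofPred_eq, ← hx]; exact mem_chart_source Plane _
    · exact (huv.preimage _).mono inter_subset_right inter_subset_right
  · obtain ⟨u, v, hu, hv, hup, hvq, huv⟩ := t2_separation hx
    exact ⟨_, _, hu.preimage proj_smooth.continuous, hv.preimage proj_smooth.continuous, hup, hvq,
      huv.preimage _⟩

end

end AH

namespace Affine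

noncomputable section

variable {E : Type*} [NormedAddCommGroup E] [NormedSpace ℝ E] [FiniteDimensional ℝ E]
  [CompleteSpace E] {H : Type*} [TopologicalSpace H] {I : ModelWithCorners ℝ E H}
  {N : Type*} [TopologicalSpace N] [ChartedSpace H N] [IsManifold I ∞ N]

/-- A smooth function which is a linear function of the coordinates near `x`. -/
theorem exists_smooth_mvfderiv_eq_chartVec [T2Space N] (x : N) (l : E →L[ℝ] ℝ) :
    ∃ f : N → ℝ, ContMDiff I 𝓘(ℝ, ℝ) ∞ f ∧ ∀ᶠ y in 𝓝 x, ∀ v : TangentSpace I y,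
      mvfderiv I f y v = l (chartVec x y v : E) := by
  have h : ContMDiffOn I 𝓘(ℝ, ℝ) ∞ (fun y => l (extChartAt I x y)) (chartAt H x).source :=
    l.contMDiff.comp_contMDiffOn (contMDiffOn_extChartAt (x := x))
  obtain ⟨f, hf, he⟩ := exists_smooth_of_contMDiffOn (chartAt H x).open_source h
    (mem_chart_source H x)
  refine ⟨f, hf, ?_⟩
  filter_upwards [he.eventually_nhds, chart_source_eventually (H := H) x] with y hy hys v
  rw [mvfderiv_congr hy]
  have hc : MDifferentiableAt I 𝓘(ℝ, E) (extChartAt I x) y := mdifferentiableAt_extChartAt (I := I) hys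
  have h2 := mvfderiv_comp_apply (I := 𝓘(ℝ, E)) (I' := I) (g := l) y l.mdifferentiableAt hc v
  refine h2.trans ?_
  have h4 : (mvfderiv 𝓘(ℝ, E) l (extChartAt I x y) : E →L[ℝ] ℝ) = l :=
    ContinuousLinearMap.mfderiv_eq l
  exact (congrArg (fun L : E →L[ℝ] ℝ => L _) h4).trans (congrArg l (mfderiv_extChartAt hys v))

end

end Affine

namespace AH

open Affine

noncomputable section

variable {M : Type*} [TopologicalSpace M] [ChartedSpace Plane M] [IsManifold (𝓡 2) ∞ M]

theorem exists_smooth_frame_eq [T2Space M] (x : M) :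
    ∃ E : Fin 2 → Π y : M, TangentSpace (𝓡 2) y, (∀ j, IsSmoothField (E j)) ∧
      ∀ᶠ y in 𝓝 x, ∀ j, E j y = frame x j y := by
  choose E hE he using fun j => exists_smoothField_eq_ext (e x j)
  exact ⟨E, hE, Filter.eventually_all.2 he⟩

theorem exists_smooth_coord [T2Space M] (x : M) :
    ∃ f : Fin 2 → M → ℝ, (∀ j, ContMDiff (𝓡 2) 𝓘(ℝ, ℝ) ∞ (f j)) ∧
      ∀ᶠ y in 𝓝 x, ∀ j, ∀ v : TangentSpace (𝓡 2) y, mvfderiv (𝓡 2) (f j) y v = coord x j y v := by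
  choose f hf he using fun j => exists_smooth_mvfderiv_eq_chartVec (I := 𝓡 2) x
    (EuclideanSpace.proj j : Plane →L[ℝ] ℝ)
  exact ⟨f, hf, Filter.eventually_all.2 he⟩

/-! ### Fields on `Cone M` -/

theorem mvfderiv_comp_proj {f : M → ℝ} {p : Cone M}
    (hf : MDifferentiableAt (𝓡 2) 𝓘(ℝ, ℝ) f (proj p)) (v : TangentSpace coneModel p) :
    mvfderiv coneModel (fun q => f (proj q)) p v = mvfderiv (𝓡 2) f (proj p) (dproj p v) :=
  mvfderiv_comp_apply (I := 𝓡 2) (I' := coneModel) (g := f) (f := proj) p hf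
    (proj_smooth.mdifferentiable (by simp) p) v

theorem chartVec_cone {p q : Cone M} (hq : proj q ∈ (chartAt Plane (proj p)).source)
    (v : TangentSpace coneModel q) : (show Plane × ℝ from chartVec p q v) =
      (chartVec (proj p) (proj q) (dproj q v), mvfderiv coneModel (fib (proj p)) q v) := by
  have hs : q ∈ (chartAt (ModelProd Plane ℝ) p).source := mem_chart_source_cone.2 hq
  rw [← mfderiv_extChartAt hs v]
  have he : MDifferentiableAt coneModel 𝓘(ℝ, Plane × ℝ) (extChartAt coneModel p) q :=
    mdifferentiableAt_extChartAt (I := coneModel) hs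
  have h3 : mfderiv coneModel 𝓘(ℝ, Plane)
      (fun q : Cone M => extChartAt (𝓡 2) (proj p) (proj q)) q v =
      chartVec (proj p) (proj q) (dproj q v) := by
    rw [← mfderiv_extChartAt hq]
    exact congrArg (fun L : Plane × ℝ →L[ℝ] Plane => L v) (mfderiv_comp (I := coneModel)
      (I' := 𝓡 2) (I'' := 𝓘(ℝ, Plane)) q (mdifferentiableAt_extChartAt hq)
      (proj_smooth.mdifferentiable (by simp) q))
  have h4 := congrArg (fun L : Plane × ℝ →L[ℝ] Plane => L v) (mfderiv_comp (I := coneModel)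
    (I' := 𝓘(ℝ, Plane × ℝ)) (I'' := 𝓘(ℝ, Plane)) (g := ContinuousLinearMap.fst ℝ Plane ℝ)
    (f := extChartAt coneModel p) q (ContinuousLinearMap.fst ℝ Plane ℝ).mdifferentiableAt he)
  have h5 := mvfderiv_comp_apply (I := 𝓘(ℝ, Plane × ℝ)) (I' := coneModel)
    (g := ContinuousLinearMap.snd ℝ Plane ℝ) (f := extChartAt coneModel p) q
    (ContinuousLinearMap.snd ℝ Plane ℝ).mdifferentiableAt he v
  have hL : ∀ {F : Type} [NormedAddCommGroup F] [NormedSpace ℝ F] (L : Plane × ℝ →L[ℝ] F) z,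
      (mvfderiv 𝓘(ℝ, Plane × ℝ) L z : Plane × ℝ →L[ℝ] F) = L :=
    fun L z => ContinuousLinearMap.mfderiv_eq L
  have h6 := congrArg (fun L : Plane × ℝ →L[ℝ] Plane => L
    ((mfderiv coneModel 𝓘(ℝ, Plane × ℝ) (extChartAt coneModel p) q : Plane × ℝ →L[ℝ] Plane × ℝ) v))
    (hL (ContinuousLinearMap.fst ℝ Plane ℝ) (extChartAt coneModel p q))
  have h7 := congrArg (fun L : Plane × ℝ →L[ℝ] ℝ => L
    ((mfderiv coneModel 𝓘(ℝ, Plane × ℝ) (extChartAt coneModel p) q : Plane × ℝ →L[ℝ] Plane × ℝ) v))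
    (hL (ContinuousLinearMap.snd ℝ Plane ℝ) (extChartAt coneModel p q))
  exact Prod.ext ((h4.trans h6).symm.trans h3) (h5.trans h7).symm

theorem radial_smooth : IsSmoothField (radial : Π p : Cone M, TangentSpace coneModel p) := by
  intro p
  refine smoothAt_iff_comps.2 ?_
  have h : ContMDiffAt coneModel 𝓘(ℝ, Plane × ℝ) ∞
      (fun q : Cone M => ((0 : Plane), 3 * fib (proj p) q)) p :=
    contMDiffAt_const.prodMk_space
      (contMDiffAt_const.mul (fib_smoothAt (mem_chart_source Plane (proj p))))
  refine h.congr_of_eventuallyEq ?_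
  filter_upwards [proj_source_eventually p] with q hq
  refine (chartVec_cone hq _).trans ?_
  rw [dproj_radial, map_zero, fib_radial hq]
  rfl

/-- The components of the projections of tangent vectors. -/
def coneCoord (p : Cone M) (j : Fin 2) (q : Cone M) : TangentSpace coneModel q →L[ℝ] ℝ :=
  (coord (proj p) j (proj q)).comp (dproj q)

theorem coneCoord_apply (p : Cone M) (j : Fin 2) (q : Cone M) (v : TangentSpace coneModel q) :
    coneCoord p j q v = coord (proj p) j (proj q) (dproj q v) := rfl

theorem coneCoord_smoothAt {Y : Π q : Cone M, TangentSpace coneModel q} {p : Cone M}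
    (hY : FieldSmoothAt Y p) (j : Fin 2) :
    ContMDiffAt coneModel 𝓘(ℝ, ℝ) ∞ (fun q => coneCoord p j q (Y q)) p := by
  have h := ((EuclideanSpace.proj j : Plane →L[ℝ] ℝ).comp
    (ContinuousLinearMap.fst ℝ Plane ℝ)).contMDiff.contMDiffAt.comp p (smoothAt_iff_comps.1 hY)
  refine h.congr_of_eventuallyEq ?_
  filter_upwards [proj_source_eventually p] with q hq
  exact congrArg (fun z : Plane × ℝ => z.1 j) (chartVec_cone hq (Y q)).symm

theorem coneCoord_mdiffAt {Y : Π q : Cone M, TangentSpace coneModel q} {p : Cone M}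
    (hY : FieldDiffAt Y p) (j : Fin 2) :
    MDifferentiableAt coneModel 𝓘(ℝ, ℝ) (fun q => coneCoord p j q (Y q)) p := by
  have h := ((EuclideanSpace.proj j : Plane →L[ℝ] ℝ).comp
    (ContinuousLinearMap.fst ℝ Plane ℝ)).mdifferentiableAt.comp p (mdiffAt_iff_comps.1 hY)
  refine h.congr_of_eventuallyEq ?_
  filter_upwards [proj_source_eventually p] with q hq
  exact congrArg (fun z : Plane × ℝ => z.1 j) (chartVec_cone hq (Y q)).symm

section Lift

variable (h : Metric M)

theorem eta_smoothAt {Y : Π q : Cone M, TangentSpace coneModel q} {p : Cone M}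
    (hY : FieldSmoothAt Y p) : ContMDiffAt coneModel 𝓘(ℝ, ℝ) ∞ (fun q => eta h q (Y q)) p :=
  smoothAt_mvfderiv_apply (logRadius_smooth h) hY

theorem eta_smooth {Y : Π q : Cone M, TangentSpace coneModel q}
    (hY : IsSmoothField Y) : ContMDiff coneModel 𝓘(ℝ, ℝ) ∞ (fun q => eta h q (Y q)) :=
  smooth_mvfderiv_apply (logRadius_smooth h) hY

theorem eta_mdiffAt {Y : Π q : Cone M, TangentSpace coneModel q} {p : Cone M}
    (hY : FieldDiffAt Y p) :
    MDifferentiableAt coneModel 𝓘(ℝ, ℝ) (fun q => eta h q (Y q)) p :=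
  mdiffAt_mvfderiv_apply (logRadius_smooth h) hY

/-- The horizontal lift of a vector field. -/
def lift (X : Π x : M, TangentSpace (𝓡 2) x) (q : Cone M) : TangentSpace coneModel q :=
  hlift h q (X (proj q))

theorem lift_add (X Y : Π x : M, TangentSpace (𝓡 2) x) : lift h (X + Y) = lift h X + lift h Y := by
  ext q : 1
  exact map_add (hlift h q) _ _

theorem dproj_lift (X : Π x : M, TangentSpace (𝓡 2) x) (q : Cone M) :
    dproj q (lift h X q) = X (proj q) := dproj_hlift h q _

theorem eta_lift (X : Π x : M, TangentSpace (𝓡 2) x) (q : Cone M) : eta h q (lift h X q) = 0 :=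
  eta_hlift h q _

/-- The extension of e_j with constant components on the cone projects to the coordinate field of M.
It differs from the horizontal lift only by its η-component times the radial field, which is smooth.
-/
theorem lift_frame_smoothAt (p : Cone M) (j : Fin 2) :
    FieldSmoothAt (lift h (frame (proj p) j)) p := by
  let w : TangentSpace coneModel p := chartLift p (e (proj p) j)
  have hW : FieldSmoothAt (ext w) p := smoothAt_ext w
  have hs : FieldSmoothAt (ext w - (fun q => eta h q (ext w q)) • radial) p :=
    hW.sub_section ((eta_smoothAt h hW).smul_section (radial_smooth p))
  refine smoothAt_congr_field hs ?_
  filter_upwards [proj_source_eventually p] with q hq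
  have hd : dproj q (ext w q) = frame (proj p) j (proj q) := by
    refine eq_of_chartVec hq ?_
    have h1 := chartVec_cone hq (ext w q)
    have h2 := chartVec_ext (mem_chart_source_cone.2 hq) w
    rw [h2] at h1
    refine (congrArg Prod.fst h1).symm.trans ?_
    exact (chartVec_ext hq (e (proj p) j)).symm
  refine cone_ext h ?_ ?_
  · rw [dproj_lift, Pi.sub_apply, map_sub, Pi.smul_apply', map_smul, dproj_radial, hd]
    simp
  · rw [eta_lift, Pi.sub_apply, map_sub, Pi.smul_apply', map_smul, eta_radial]
    simp

theorem cone_frame_sum {p q : Cone M} (hq : proj q ∈ (chartAt Plane (proj p)).source)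
    (v : TangentSpace coneModel q) : v = eta h q v • radial q +
      ∑ j, coneCoord p j q v • lift h (frame (proj p) j) q := by
  conv_lhs => rw [cone_decomp h q v, frame_sum hq (dproj q v), map_sum]
  simp only [map_smul]
  rfl

theorem smoothAt_of_coneCoord {Y : Π q : Cone M, TangentSpace coneModel q} {p : Cone M}
    (h1 : ContMDiffAt coneModel 𝓘(ℝ, ℝ) ∞ (fun q => eta h q (Y q)) p)
    (h2 : ∀ j, ContMDiffAt coneModel 𝓘(ℝ, ℝ) ∞ (fun q => coneCoord p j q (Y q)) p) :
    FieldSmoothAt Y p := by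
  have hs : FieldSmoothAt ((fun q => eta h q (Y q)) • radial +
      ((fun q => coneCoord p 0 q (Y q)) • lift h (frame (proj p) 0) +
      (fun q => coneCoord p 1 q (Y q)) • lift h (frame (proj p) 1))) p :=
    (h1.smul_section (radial_smooth p)).add_section
      (((h2 0).smul_section (lift_frame_smoothAt h p 0)).add_section
      ((h2 1).smul_section (lift_frame_smoothAt h p 1)))
  refine smoothAt_congr_field hs ?_
  filter_upwards [proj_source_eventually p] with q hq
  conv_rhs => rw [cone_frame_sum h hq (Y q), Fin.sum_univ_two]
  rfl

theorem diffAt_of_coneCoord {Y : Π q : Cone M, TangentSpace coneModel q} {p : Cone M}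
    (h1 : MDifferentiableAt coneModel 𝓘(ℝ, ℝ) (fun q => eta h q (Y q)) p)
    (h2 : ∀ j, MDifferentiableAt coneModel 𝓘(ℝ, ℝ) (fun q => coneCoord p j q (Y q)) p) :
    FieldDiffAt Y p := by
  have hl := fun j => (lift_frame_smoothAt h p j).diffAt
  have hs : FieldDiffAt ((fun q => eta h q (Y q)) • radial +
      ((fun q => coneCoord p 0 q (Y q)) • lift h (frame (proj p) 0) +
      (fun q => coneCoord p 1 q (Y q)) • lift h (frame (proj p) 1))) p :=
    mdifferentiableAt_add_section (h1.smul_section (radial_smooth.mdiffAt p))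
      (mdifferentiableAt_add_section ((h2 0).smul_section (hl 0)) ((h2 1).smul_section (hl 1)))
  refine mdiffAt_congr_field hs ?_
  filter_upwards [proj_source_eventually p] with q hq
  conv_rhs => rw [cone_frame_sum h hq (Y q), Fin.sum_univ_two]
  rfl

theorem lift_smoothAt {X : Π x : M, TangentSpace (𝓡 2) x} {p : Cone M}
    (hX : FieldSmoothAt X (proj p)) : FieldSmoothAt (lift h X) p := by
  refine smoothAt_of_coneCoord h ?_ fun j => ?_
  · simpa only [eta_lift] using contMDiffAt_const
  · simp only [coneCoord_apply, dproj_lift]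
    exact (coord_smoothAt hX j).comp p (proj_smooth p)

theorem lift_diffAt {X : Π x : M, TangentSpace (𝓡 2) x} {p : Cone M}
    (hX : FieldDiffAt X (proj p)) : FieldDiffAt (lift h X) p := by
  refine diffAt_of_coneCoord h ?_ fun j => ?_
  · simpa only [eta_lift] using mdifferentiableAt_const
  · simp only [coneCoord_apply, dproj_lift]
    exact (coord_mdiffAt hX j).comp p (proj_smooth.mdifferentiable (by simp) p)

theorem lift_smooth {X : Π x : M, TangentSpace (𝓡 2) x} (hX : IsSmoothField X) :
    IsSmoothField (lift h X) := fun p => lift_smoothAt h (hX (proj p))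

end Lift

/-! ### Brackets of lifted fields -/

section Bracket

variable [T2Space M] (h : Metric M) {X Y : Π x : M, TangentSpace (𝓡 2) x}

/-- Tested on functions pulled back from M, the bracket of the lifts acts as the bracket of the
fields. Tested on ρ it gives zero because both lifts kill ρ: the horizontal distribution is
integrable, being the kernel of dρ. -/
theorem bracket_lift (hX : IsSmoothField X) (hY : IsSmoothField Y) :
    VectorField.mlieBracket coneModel (lift h X) (lift h Y) =
      lift h (VectorField.mlieBracket (𝓡 2) X Y) := by
  ext p : 1
  have hl := lift_smooth h hX
  have hl' := lift_smooth h hY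
  refine cone_ext h (eq_of_mvfderiv fun f hf => ?_) ?_
  · have hfp : ContMDiff coneModel 𝓘(ℝ, ℝ) ∞ (fun q : Cone M => f (proj q)) := hf.comp proj_smooth
    rw [dproj_lift, mvfderiv_bracket hX hY hf, ← mvfderiv_comp_proj (smooth_mdiffAt hf _),
      mvfderiv_bracket hl hl' hfp]
    simp only [mvfderiv_comp_proj (smooth_mdiffAt hf _), dproj_lift]
    rw [mvfderiv_comp_proj (smooth_mdiffAt (smooth_mvfderiv_apply hf hY) _),
      mvfderiv_comp_proj (smooth_mdiffAt (smooth_mvfderiv_apply hf hX) _), dproj_lift, dproj_lift]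
  · rw [eta_lift, eta, mvfderiv_bracket hl hl' (logRadius_smooth h)]
    have : ∀ {Z : Π x : M, TangentSpace (𝓡 2) x},
        (fun q => mvfderiv coneModel (logRadius h) q (lift h Z q)) = fun _ => 0 :=
      funext fun q => eta_lift h _ q
    rw [this, this, mvfderiv_const]
    simp

/-- The radial field kills functions pulled back from M, and both fields have constant derivative on
ρ. -/
theorem bracket_radial_lift (hX : IsSmoothField X) :
    VectorField.mlieBracket coneModel radial (lift h X) = 0 := by
  ext p : 1
  have hl := lift_smooth h hX
  refine cone_ext h (eq_of_mvfderiv fun f hf => ?_) ?_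
  · have hfp : ContMDiff coneModel 𝓘(ℝ, ℝ) ∞ (fun q : Cone M => f (proj q)) := hf.comp proj_smooth
    rw [← mvfderiv_comp_proj (smooth_mdiffAt hf _), mvfderiv_bracket radial_smooth hl hfp]
    simp only [mvfderiv_comp_proj (smooth_mdiffAt hf _), dproj_lift, dproj_radial, map_zero]
    rw [mvfderiv_comp_proj (smooth_mdiffAt (smooth_mvfderiv_apply hf hX) _), dproj_radial,
      mvfderiv_const]
    simp
  · rw [eta, mvfderiv_bracket radial_smooth hl (logRadius_smooth h)]
    have h1 : (fun q => mvfderiv coneModel (logRadius h) q (lift h X q)) = fun _ => 0 :=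
      funext fun q => eta_lift h _ q
    have h2 : (fun q => mvfderiv coneModel (logRadius h) q (radial q)) = fun _ => 1 :=
      funext fun q => eta_radial h q
    rw [h1, h2, mvfderiv_const, mvfderiv_const]
    simp

end Bracket

end

end AH

namespace AH

open Affine

noncomputable section

variable {M : Type*} [TopologicalSpace M] [ChartedSpace Plane M] [IsManifold (𝓡 2) ∞ M]

variable (M) in
/-- A smooth symmetric bilinear form. -/
structure SymForm where
  form : Π x : M, TangentSpace (𝓡 2) x →L[ℝ] TangentSpace (𝓡 2) x →L[ℝ] ℝ
  symm : ∀ x v w, form x v w = form x w v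
  smooth : ∀ X Y : Π x : M, TangentSpace (𝓡 2) x, IsSmoothField X → IsSmoothField Y →
    ContMDiff (𝓡 2) 𝓘(ℝ, ℝ) ∞ (fun x => form x (X x) (Y x))

/-! ### Connections on `Cone M` induced by connections on `M` -/

section PullConn

variable (D : Connection (𝓡 2) M)

/-- The connection induced by `D` on the pullback to `Cone M` of the tangent bundle of `M`,
applied to the projection of a field on `Cone M`. -/
def pullConn (Y : Π q : Cone M, TangentSpace coneModel q) (p : Cone M) :
    TangentSpace coneModel p →L[ℝ] TangentSpace (𝓡 2) (proj p) :=
  ∑ j, ((mvfderiv coneModel (fun q => coneCoord p j q (Y q)) p).smulRight (e (proj p) j)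
    + coneCoord p j p (Y p) • (D (frame (proj p) j) (proj p)).comp (dproj p))

theorem pullConn_apply (Y : Π q : Cone M, TangentSpace coneModel q) (p : Cone M)
    (v : TangentSpace coneModel p) : pullConn D Y p v =
      ∑ j, (mvfderiv coneModel (fun q => coneCoord p j q (Y q)) p v • e (proj p) j
        + coneCoord p j p (Y p) • D (frame (proj p) j) (proj p) (dproj p v)) := by
  rw [pullConn, sum_apply]
  rfl

theorem e_sum_coneCoord (p : Cone M) (v : TangentSpace coneModel p) :
    ∑ j, coneCoord p j p v • e (proj p) j = dproj p v := by
  rw [frame_sum (mem_chart_source Plane (proj p)) (dproj p v)]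
  simp only [frame_self]
  rfl

theorem pullConn_add {Y Z : Π q : Cone M, TangentSpace coneModel q} {p : Cone M}
    (hY : FieldDiffAt Y p) (hZ : FieldDiffAt Z p) :
    pullConn D (Y + Z) p = pullConn D Y p + pullConn D Z p := by
  ext1 v
  rw [add_apply]
  simp only [pullConn_apply]
  rw [← Finset.sum_add_distrib]
  refine Finset.sum_congr rfl fun j _ => ?_
  have h : (fun q => coneCoord p j q ((Y + Z) q)) =
      (fun q => coneCoord p j q (Y q)) + fun q => coneCoord p j q (Z q) := by
    ext q; exact map_add _ _ _
  rw [h, mvfderiv_add (coneCoord_mdiffAt hY j) (coneCoord_mdiffAt hZ j), Pi.add_apply, map_add,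
    add_apply]
  module

theorem pullConn_smul {f : Cone M → ℝ} {Y : Π q : Cone M, TangentSpace coneModel q} {p : Cone M}
    (hf : MDifferentiableAt coneModel 𝓘(ℝ, ℝ) f p) (hY : FieldDiffAt Y p)
    (v : TangentSpace coneModel p) :
    pullConn D (f • Y) p v = f p • pullConn D Y p v + mvfderiv coneModel f p v • dproj p (Y p) := by
  simp only [pullConn_apply]
  rw [← e_sum_coneCoord p (Y p), Finset.smul_sum, Finset.smul_sum, ← Finset.sum_add_distrib]
  refine Finset.sum_congr rfl fun j _ => ?_
  have h : (fun q => coneCoord p j q ((f • Y) q)) = f * fun q => coneCoord p j q (Y q) := by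
    ext q; exact (coneCoord p j q).map_smul _ _
  rw [h, mvfderiv_mul hf (coneCoord_mdiffAt hY j), Pi.smul_apply', map_smul, add_apply, smul_apply,
    smul_apply]
  simp only [smul_eq_mul]
  module

theorem pullConn_radial (p : Cone M) : pullConn D radial p = 0 := by
  ext1 v
  rw [pullConn_apply]
  simp only [coneCoord_apply, dproj_radial, map_zero, mvfderiv_const]
  simp

theorem pullConn_lift (h : Metric M) {X : Π x : M, TangentSpace (𝓡 2) x} {p : Cone M}
    (hX : FieldDiffAt X (proj p)) (v : TangentSpace coneModel p) :
    pullConn D (lift h X) p v = D X (proj p) (dproj p v) := by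
  rw [pullConn_apply, conn_coord D hX]
  simp only [coneCoord_apply, dproj_lift]
  refine Finset.sum_congr rfl fun j _ => ?_
  rw [mvfderiv_comp_proj (coord_mdiffAt hX j)]

end PullConn

section ConeConn

variable (h : Metric M) (D : Connection (𝓡 2) M) (P : SymForm M) (a : ℝ)

/-- The function underlying `coneConn`. -/
def coneConnFun (Y : Π q : Cone M, TangentSpace coneModel q) (p : Cone M) :
    TangentSpace coneModel p →L[ℝ] TangentSpace coneModel p :=
  (mvfderiv coneModel (fun q => eta h q (Y q)) p).smulRight (radial p)
    + (hlift h p).comp (pullConn D Y p)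
    + a • (eta h p (Y p) • ContinuousLinearMap.id ℝ _
      + (eta h p).smulRight (hlift h p (dproj p (Y p)))
      - ((P.form (proj p) (dproj p (Y p))).comp (dproj p)).smulRight (radial p))

theorem coneConnFun_apply (Y : Π q : Cone M, TangentSpace coneModel q) (p : Cone M)
    (v : TangentSpace coneModel p) : coneConnFun h D P a Y p v =
      mvfderiv coneModel (fun q => eta h q (Y q)) p v • radial p + hlift h p (pullConn D Y p v)
      + a • (eta h p (Y p) • v + eta h p v • hlift h p (dproj p (Y p))
        - P.form (proj p) (dproj p (Y p)) (dproj p v) • radial p) := rfl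

/-- A connection on `Cone M`, determined by a connection on `M`, a symmetric form `P` and a
number `a`: the radial field `𝕏` satisfies `∇𝕏 = a id`, and
`∇_v X̂ = (∇_v X)^ + a (η(v) X̂ - P(X, v) 𝕏)` for horizontal lifts `X̂`. -/
def coneConn : Connection coneModel (Cone M) where
  toFun := coneConnFun h D P a
  isCovariantDerivativeOnUniv :=
    { add := by
        intro Y Z p hY hZ _
        ext1 v
        have he : (fun q => eta h q ((Y + Z) q)) =
            (fun q => eta h q (Y q)) + fun q => eta h q (Z q) := by
          ext q; exact map_add _ _ _
        rw [add_apply]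
        simp only [coneConnFun_apply]
        rw [he, mvfderiv_add (eta_mdiffAt h hY) (eta_mdiffAt h hZ), pullConn_add D hY hZ]
        simp only [Pi.add_apply, map_add, add_apply]
        module
      leibniz := by
        intro Y f p hY hf _
        ext1 v
        have he : (fun q => eta h q ((f • Y) q)) = f * fun q => eta h q (Y q) := by
          ext q; exact (eta h q).map_smul _ _
        rw [add_apply, smul_apply, ContinuousLinearMap.smulRight_apply]
        simp only [coneConnFun_apply]
        rw [he, mvfderiv_mul hf (eta_mdiffAt h hY), pullConn_smul D hf hY]
        simp only [Pi.smul_apply', map_smul, map_add, add_apply, smul_apply, smul_eq_mul]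
        conv_rhs => enter [2, 2]; rw [cone_decomp h p (Y p)]
        module }

theorem coneConn_apply (Y : Π q : Cone M, TangentSpace coneModel q) (p : Cone M)
    (v : TangentSpace coneModel p) : coneConn h D P a Y p v =
      mvfderiv coneModel (fun q => eta h q (Y q)) p v • radial p + hlift h p (pullConn D Y p v)
      + a • (eta h p (Y p) • v + eta h p v • hlift h p (dproj p (Y p))
        - P.form (proj p) (dproj p (Y p)) (dproj p v) • radial p) := rfl

theorem eta_coneConn (Y : Π q : Cone M, TangentSpace coneModel q) (p : Cone M)
    (v : TangentSpace coneModel p) : eta h p (coneConn h D P a Y p v) =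
      mvfderiv coneModel (fun q => eta h q (Y q)) p v
        + a * (eta h p (Y p) * eta h p v - P.form (proj p) (dproj p (Y p)) (dproj p v)) := by
  rw [coneConn_apply]
  simp only [map_add, map_sub, map_smul, eta_radial, eta_hlift, smul_eq_mul]
  ring

theorem dproj_coneConn (Y : Π q : Cone M, TangentSpace coneModel q) (p : Cone M)
    (v : TangentSpace coneModel p) : dproj p (coneConn h D P a Y p v) = pullConn D Y p v
      + a • (eta h p (Y p) • dproj p v + eta h p v • dproj p (Y p)) := by
  rw [coneConn_apply]
  simp only [map_add, map_sub, map_smul, dproj_radial, dproj_hlift]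
  module

theorem coneConn_radial (p : Cone M) (v : TangentSpace coneModel p) :
    coneConn h D P a radial p v = a • v := by
  rw [coneConn_apply, pullConn_radial]
  simp only [eta_radial, dproj_radial, mvfderiv_const, map_zero, zero_apply]
  simp

theorem coneConn_lift {X : Π x : M, TangentSpace (𝓡 2) x} {p : Cone M}
    (hX : FieldDiffAt X (proj p)) (v : TangentSpace coneModel p) :
    coneConn h D P a (lift h X) p v = hlift h p (D X (proj p) (dproj p v))
      + a • (eta h p v • lift h X p - P.form (proj p) (X (proj p)) (dproj p v) • radial p) := by
  rw [coneConn_apply, pullConn_lift D h hX]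
  simp only [eta_lift, dproj_lift, mvfderiv_const, zero_apply, zero_smul, zero_add]
  rfl

theorem eventually_cone_expand {p : Cone M} {E : Fin 2 → Π y : M, TangentSpace (𝓡 2) y}
    (hE : ∀ᶠ y in 𝓝 (proj p), ∀ j, E j y = frame (proj p) j y)
    (Y : Π q : Cone M, TangentSpace coneModel q) : ∀ᶠ q in 𝓝 p, Y q =
      ((((fun q => eta h q (Y q)) • radial + ((fun q => coneCoord p 0 q (Y q)) • lift h (E 0) +
        (fun q => coneCoord p 1 q (Y q)) • lift h (E 1))) :
        Π q : Cone M, TangentSpace coneModel q)) q := by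
  filter_upwards [proj_source_eventually p, proj_smooth.continuous.continuousAt.eventually hE]
    with q hq hEq
  conv_lhs => rw [cone_frame_sum h hq (Y q), Fin.sum_univ_two]
  simp only [Pi.add_apply, Pi.smul_apply', lift, hEq]

/-- The Leibniz rule in a frame made of the radial field and two horizontal lifts: any connection on
the cone is determined on differentiable fields by its values on these. -/
theorem conn_cone_expand {p : Cone M} {E : Fin 2 → Π y : M, TangentSpace (𝓡 2) y}
    (hE : ∀ j, IsSmoothField (E j)) (hEe : ∀ᶠ y in 𝓝 (proj p), ∀ j, E j y = frame (proj p) j y)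
    (S : Connection coneModel (Cone M)) {Y : Π q : Cone M, TangentSpace coneModel q}
    (hY : FieldDiffAt Y p) (v : TangentSpace coneModel p) : S Y p v =
      (eta h p (Y p) • S radial p v + mvfderiv coneModel (fun q => eta h q (Y q)) p v • radial p) +
      ((coneCoord p 0 p (Y p) • S (lift h (E 0)) p v
        + mvfderiv coneModel (fun q => coneCoord p 0 q (Y q)) p v • lift h (E 0) p) +
      (coneCoord p 1 p (Y p) • S (lift h (E 1)) p v
        + mvfderiv coneModel (fun q => coneCoord p 1 q (Y q)) p v • lift h (E 1) p)) := by
  have k0 := radial_smooth.mdiffAt p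
  have kl := fun j => (lift_smooth h (hE j)).mdiffAt p
  have kE := eta_mdiffAt h hY
  have kc := coneCoord_mdiffAt hY
  have m0 : FieldDiffAt ((fun q => eta h q (Y q)) • radial) p := kE.smul_section k0
  have m1 : ∀ j, FieldDiffAt ((fun q => coneCoord p j q (Y q)) • lift h (E j)) p := fun j =>
    (kc j).smul_section (kl j)
  rw [conn_congr S hY (eventually_cone_expand h hEe Y),
    conn_add S m0 (mdifferentiableAt_add_section (m1 0) (m1 1)),
    conn_add S (m1 0) (m1 1), add_apply, add_apply, conn_smul S kE k0, conn_smul S (kc 0) (kl 0),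
    conn_smul S (kc 1) (kl 1)]

/-- A connection which is given by the same formulas as `coneConn` on the radial field and on
horizontal lifts agrees with it. -/
theorem agree_coneConn [T2Space M] {T : Connection coneModel (Cone M)}
    (h1 : ∀ (p : Cone M) (v : TangentSpace coneModel p), T radial p v = a • v)
    (h2 : ∀ X : Π x : M, TangentSpace (𝓡 2) x, IsSmoothField X → ∀ p, ∀ v : TangentSpace coneModel p,
      T (lift h X) p v = coneConn h D P a (lift h X) p v) : Agree T (coneConn h D P a) := by
  intro Y p hY
  ext1 v
  obtain ⟨E, hE, hEe⟩ := exists_smooth_frame_eq (proj p)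
  rw [conn_cone_expand h hE hEe T hY, conn_cone_expand h hE hEe (coneConn h D P a) hY, h1,
    coneConn_radial, h2 _ (hE 0), h2 _ (hE 1)]

end ConeConn

end

end AH

namespace Affine

noncomputable section

variable {E : Type*} [NormedAddCommGroup E] [NormedSpace ℝ E] [FiniteDimensional ℝ E]
  [CompleteSpace E] {H : Type*} [TopologicalSpace H] {I : ModelWithCorners ℝ E H}
  {N : Type*} [TopologicalSpace N] [ChartedSpace H N] [IsManifold I ∞ N]

/-- The trace can be computed with any pair of dual bases. -/
theorem trace_eq_sum {x : N} {A : TangentSpace I x → TangentSpace I x} (hA : IsLinearMap ℝ A)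
    {ι : Type*} [Fintype ι] (b : ι → TangentSpace I x) (φ : ι → TangentSpace I x →ₗ[ℝ] ℝ)
    (h : ∀ v, v = ∑ k, φ k v • b k) : trace A = ∑ k, φ k (A (b k)) := by
  let L : TangentSpace I x →ₗ[ℝ] TangentSpace I x := hA.mk' A
  let β : Module.Basis (Fin (Module.finrank ℝ E)) ℝ (TangentSpace I x) := Module.finBasis ℝ E
  have h1 : ∀ i, β.coord i (L (β i)) = ∑ k, φ k (β i) * β.coord i (L (b k)) := by
    intro i
    conv_lhs => rw [h (β i), map_sum, map_sum]
    simp only [map_smul, smul_eq_mul]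
  have h2 : ∀ k, φ k (L (b k)) = ∑ i, φ k (β i) * β.coord i (L (b k)) := by
    intro k
    conv_lhs => rw [← β.sum_repr (L (b k)), map_sum]
    simp only [map_smul, smul_eq_mul, Module.Basis.coord_apply, mul_comm]
  calc trace A = ∑ i, β.coord i (L (β i)) := rfl
    _ = ∑ k, φ k (L (b k)) := by
      simp only [h1, h2]
      exact Finset.sum_comm

end

end Affine

namespace AH

open Affine

noncomputable section

variable {M : Type*} [TopologicalSpace M] [ChartedSpace Plane M] [IsManifold (𝓡 2) ∞ M] [T2Space M]

section ConeConn

variable (h : Metric M) (D : Connection (𝓡 2) M) (P : SymForm M) (a : ℝ)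

/-- On the radial field and on horizontal lifts of smooth fields the defining formulas are visibly
smooth. A general field is expanded in them near a point. -/
theorem coneConn_smooth (hD : CovariantDerivative.ContMDiffCovariantDerivative D ∞) :
    CovariantDerivative.ContMDiffCovariantDerivative (coneConn h D P a) ∞ := by
  refine contMDiff_of_along fun V Y hV hY p => ?_
  obtain ⟨E, hE, hEe⟩ := exists_smooth_frame_eq (proj p)
  obtain ⟨f, hf, hfe⟩ := exists_smooth_coord (proj p)
  have hfp : ∀ j, ContMDiff coneModel 𝓘(ℝ, ℝ) ∞ (fun q : Cone M => f j (proj q)) := fun j =>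
    (hf j).comp proj_smooth
  have hc : ∀ᶠ q in 𝓝 p, ∀ j, ∀ v : TangentSpace coneModel q,
      mvfderiv coneModel (fun q : Cone M => f j (proj q)) q v = coneCoord p j q v := by
    filter_upwards [proj_smooth.continuous.continuousAt.eventually hfe] with q hq j v
    rw [mvfderiv_comp_proj (smooth_mdiffAt (hf j) _), hq]
    rfl
  -- These are the coordinate components of W near p, obtained from globally defined coordinate
  -- functions so that they are smooth everywhere.
  let c : Fin 2 → (Π q : Cone M, TangentSpace coneModel q) → Cone M → ℝ := fun j W q =>
    mvfderiv coneModel (fun q : Cone M => f j (proj q)) q (W q)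
  have hcs : ∀ j W, IsSmoothField W → ContMDiff coneModel 𝓘(ℝ, ℝ) ∞ (c j W) := fun j W hW =>
    smooth_mvfderiv_apply (hfp j) hW
  have hexp : ∀ W : Π q : Cone M, TangentSpace coneModel q, ∀ᶠ q in 𝓝 p, W q =
      ((((fun q => eta h q (W q)) • radial + (c 0 W • lift h (E 0) + c 1 W • lift h (E 1))) :
        Π q : Cone M, TangentSpace coneModel q)) q := by
    intro W
    filter_upwards [eventually_cone_expand h hEe W, hc] with q hq hcq
    rw [hq]
    simp only [Pi.add_apply, Pi.smul_apply', c, hcq]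
  let T := coneConn h D P a
  have hl : ∀ j, IsSmoothField (lift h (E j)) := fun j => lift_smooth h (hE j)
  have hT : ∀ j, FieldSmoothAt (along T V (lift h (E j))) p := by
    intro j
    have hs : IsSmoothField (c 0 V • lift h (along D (E 0) (E j)) +
        c 1 V • lift h (along D (E 1) (E j)) +
        ((fun q => a * eta h q (V q)) • lift h (E j) -
        (fun q => a * (c 0 V q * P.form (proj q) (E j (proj q)) (E 0 (proj q)) +
          c 1 V q * P.form (proj q) (E j (proj q)) (E 1 (proj q)))) • radial)) := by
      have hP : ∀ i, ContMDiff coneModel 𝓘(ℝ, ℝ) ∞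
          (fun q : Cone M => P.form (proj q) (E j (proj q)) (E i (proj q))) := fun i =>
        (P.smooth _ _ (hE j) (hE i)).comp proj_smooth
      have hDl : ∀ i, IsSmoothField (lift h (along D (E i) (E j))) := fun i =>
        lift_smooth h (along_smooth hD (hE i) (hE j))
      exact (((hDl 0).smul (hcs 0 V hV)).add ((hDl 1).smul (hcs 1 V hV))).add
        (((hl j).smul (contMDiff_const.mul (eta_smooth h hV))).sub (radial_smooth.smul
        (contMDiff_const.mul (((hcs 0 V hV).mul (hP 0)).add ((hcs 1 V hV).mul (hP 1))))))
    refine smoothAt_congr_field (hs p) ?_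
    filter_upwards [hexp V] with q hq
    have hd : dproj q (V q) = c 0 V q • E 0 (proj q) + c 1 V q • E 1 (proj q) := by
      conv_lhs => rw [hq]
      simp only [Pi.add_apply, Pi.smul_apply', map_add, map_smul, dproj_radial, dproj_lift,
        smul_zero, zero_add]
    rw [along_apply, coneConn_lift h D P a ((hE j).mdiffAt _), hd]
    simp only [Pi.add_apply, Pi.sub_apply, Pi.smul_apply', map_add, map_smul, smul_eq_mul, lift,
      along_apply]
    module
  have hs : FieldSmoothAt ((fun q => eta h q (Y q) * a) • V +
      (fun q => mvfderiv coneModel (fun q => eta h q (Y q)) q (V q)) • radial +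
      ((c 0 Y • along T V (lift h (E 0)) +
        (fun q => mvfderiv coneModel (c 0 Y) q (V q)) • lift h (E 0)) +
      (c 1 Y • along T V (lift h (E 1)) +
        (fun q => mvfderiv coneModel (c 1 Y) q (V q)) • lift h (E 1)))) p := by
    have h1 : ∀ j, FieldSmoothAt (c j Y • along T V (lift h (E j)) +
        (fun q => mvfderiv coneModel (c j Y) q (V q)) • lift h (E j)) p := fun j =>
      ((hcs j Y hY p).smul_section (hT j)).add_section
        ((hl j).smul (smooth_mvfderiv_apply (hcs j Y hY) hV) p)
    exact (((hV.smul ((eta_smooth h hY).mul contMDiff_const)).add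
      (radial_smooth.smul (smooth_mvfderiv_apply (eta_smooth h hY) hV))) p).add_section
      ((h1 0).add_section (h1 1))
  refine smoothAt_congr_field hs ?_
  filter_upwards [(hexp Y).eventually_nhds] with q hq
  have m0 : FieldDiffAt ((fun q => eta h q (Y q)) • radial) q :=
    (radial_smooth.smul (eta_smooth h hY)).mdiffAt q
  have m1 : ∀ j, FieldDiffAt (c j Y • lift h (E j)) q := fun j =>
    ((hl j).smul (hcs j Y hY)).mdiffAt q
  rw [along_apply, conn_congr _ (hY.mdiffAt q) hq,
    conn_add _ m0 (mdifferentiableAt_add_section (m1 0) (m1 1)), conn_add _ (m1 0) (m1 1),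
    add_apply, add_apply, conn_smul _ (smooth_mdiffAt (eta_smooth h hY) q) (radial_smooth.mdiffAt q),
    conn_smul _ (smooth_mdiffAt (hcs 0 Y hY) q) ((hl 0).mdiffAt q),
    conn_smul _ (smooth_mdiffAt (hcs 1 Y hY) q) ((hl 1).mdiffAt q), coneConn_radial]
  simp only [Pi.add_apply, Pi.smul_apply', along_apply, T]
  module

theorem exists_lift_apply {p : Cone M} (w : TangentSpace (𝓡 2) (proj p)) :
    ∃ X : Π x : M, TangentSpace (𝓡 2) x, IsSmoothField X ∧ X (proj p) = w ∧
      lift h X p = hlift h p w := by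
  obtain ⟨X, hX, rfl⟩ := exists_smoothField_apply w
  exact ⟨X, hX, rfl, rfl⟩

/-- Torsion is a tensor, so it is enough to insert radial vectors and lifts. The brackets of these
are known, and for two lifts the radial terms cancel by the symmetry of P. -/
theorem coneConn_torsion (hD : D.torsion = 0) : (coneConn h D P a).torsion = 0 := by
  let T := coneConn h D P a
  have h1 : ∀ {X : Π x : M, TangentSpace (𝓡 2) x}, IsSmoothField X → ∀ p,
      T.torsion p (radial p) (lift h X p) = 0 := by
    intro X hX p
    rw [CovariantDerivative.torsion_apply _ (radial_smooth.mdiffAt p)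
      ((lift_smooth h hX).mdiffAt p), coneConn_radial, bracket_radial_lift h hX,
      coneConn_lift h D P a (hX.mdiffAt _), dproj_radial, eta_radial]
    simp
  have h2 : ∀ {X Y : Π x : M, TangentSpace (𝓡 2) x}, IsSmoothField X → IsSmoothField Y → ∀ p,
      T.torsion p (lift h X p) (lift h Y p) = 0 := by
    intro X Y hX hY p
    rw [CovariantDerivative.torsion_apply _ ((lift_smooth h hX).mdiffAt p)
      ((lift_smooth h hY).mdiffAt p), bracket_lift h hX hY,
      coneConn_lift h D P a (hX.mdiffAt _), coneConn_lift h D P a (hY.mdiffAt _), dproj_lift,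
      dproj_lift, eta_lift, eta_lift]
    simp only [lift]
    rw [torsionFree_bracket hD (hX.mdiffAt _) (hY.mdiffAt _),
      map_sub, P.symm _ (X (proj p))]
    module
  refine funext fun p => ContinuousLinearMap.ext fun v => ContinuousLinearMap.ext fun w => ?_
  change T.torsion p v w = 0
  obtain ⟨X, hX, -, hXe⟩ := exists_lift_apply h (dproj p v)
  obtain ⟨Y, hY, -, hYe⟩ := exists_lift_apply h (dproj p w)
  have h3 : T.torsion p (lift h X p) (radial p) = 0 := by
    rw [CovariantDerivative.torsion_antisymm, h1 hX, neg_zero]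
  have h4 : T.torsion p (radial p) (radial p) = 0 := CovariantDerivative.torsion_self _ _
  rw [cone_decomp h p v, cone_decomp h p w, ← hXe, ← hYe]
  simp only [map_add, map_smul, add_apply, smul_apply, h1 hY, h2 hX hY, h3, h4]
  simp

end ConeConn

/-! ### Curvature of connections on `Cone M` -/

/-- A connection on `Cone M` given by the formulas of `coneConn`, with a bilinear form which
may vary along the fibres. -/
structure IsConeLike (h : Metric M) (D : Connection (𝓡 2) M)
    (B : Π p : Cone M, TangentSpace (𝓡 2) (proj p) → TangentSpace (𝓡 2) (proj p) → ℝ)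
    (T : Connection coneModel (Cone M)) : Prop where
  smooth : CovariantDerivative.ContMDiffCovariantDerivative T ∞
  torsion_eq : T.torsion = 0
  radial_eq : ∀ (p : Cone M) (v : TangentSpace coneModel p), T radial p v = v
  lift_eq : ∀ X : Π x : M, TangentSpace (𝓡 2) x, IsSmoothField X → ∀ p,
    ∀ v : TangentSpace coneModel p, T (lift h X) p v = hlift h p (D X (proj p) (dproj p v))
      + eta h p v • lift h X p - B p (X (proj p)) (dproj p v) • radial p
  form_smooth : ∀ X Y : Π x : M, TangentSpace (𝓡 2) x, IsSmoothField X → IsSmoothField Y →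
    ContMDiff coneModel 𝓘(ℝ, ℝ) ∞ (fun p => B p (X (proj p)) (Y (proj p)))

namespace IsConeLike

variable {h : Metric M} {D : Connection (𝓡 2) M}
  {B : Π p : Cone M, TangentSpace (𝓡 2) (proj p) → TangentSpace (𝓡 2) (proj p) → ℝ}
  {T : Connection coneModel (Cone M)} (hT : IsConeLike h D B T)
  {X Y Z : Π x : M, TangentSpace (𝓡 2) x}

include hT

/-- As ∇𝕏 = id, the curvature applied to 𝕏 is the torsion. -/
theorem curv_radial_right {U V : Π q : Cone M, TangentSpace coneModel q} (hU : IsSmoothField U)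
    (hV : IsSmoothField V) (p : Cone M) : curv T U V radial p = 0 := by
  have : ∀ W, along T W radial = W := fun W => funext fun q => hT.radial_eq q _
  rw [curv, this, this, hT.radial_eq,
    torsionFree_bracket hT.torsion_eq (hU.mdiffAt p) (hV.mdiffAt p), sub_self]

/-- The form B is a bare function, not assumed bilinear; the lift formula at v = 0 forces this
value. -/
theorem zero_form (p : Cone M) (hX : IsSmoothField X) : B p (X (proj p)) 0 = 0 := by
  have h1 := hT.lift_eq X hX p 0
  rw [map_zero, map_zero, map_zero, map_zero, map_zero, zero_smul, zero_add, zero_sub, eq_comm,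
    neg_eq_zero] at h1
  exact (smul_eq_zero.1 h1).resolve_right (radial_ne_zero p h)

theorem along_lift (hX : IsSmoothField X) (hY : IsSmoothField Y) :
    along T (lift h X) (lift h Y) = lift h (along D X Y) -
      (fun q => B q (Y (proj q)) (X (proj q))) • radial := by
  ext p : 1
  rw [along_apply, hT.lift_eq Y hY, dproj_lift, eta_lift, zero_smul, add_zero]
  rfl

theorem along_radial_lift (hY : IsSmoothField Y) : along T radial (lift h Y) = lift h Y := by
  ext p : 1
  rw [along_apply, hT.lift_eq Y hY, dproj_radial, eta_radial, hT.zero_form p hY, map_zero, map_zero]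
  simp

/-- Contraction of the curvature with 𝕏 sees only the variation of B along the fibres. It vanishes
when B is pulled back from M. -/
theorem curv_radial_lift (hD : CovariantDerivative.ContMDiffCovariantDerivative D ∞)
    (hY : IsSmoothField Y) (hZ : IsSmoothField Z) (p : Cone M) :
    curv T radial (lift h Y) (lift h Z) p = -
      mvfderiv coneModel (fun q => B q (Z (proj q)) (Y (proj q))) p (radial p) • radial p := by
  have hYZ := along_smooth hD hY hZ
  have hB := hT.form_smooth Z Y hZ hY
  have h1 : T (lift h (along D Y Z)) p (radial p) = lift h (along D Y Z) p :=
    congrFun (hT.along_radial_lift hYZ) p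
  have h2 : T (lift h Z) p (lift h Y p) = lift h (along D Y Z) p -
      B p (Z (proj p)) (Y (proj p)) • radial p := congrFun (hT.along_lift hY hZ) p
  rw [curv, bracket_radial_lift h hY, hT.along_lift hY hZ, hT.along_radial_lift hZ,
    conn_sub T ((lift_smooth h hYZ).mdiffAt p) ((radial_smooth.smul hB).mdiffAt p), sub_apply,
    conn_smul T (smooth_mdiffAt hB p) (radial_smooth.mdiffAt p), hT.radial_eq, h1, h2]
  simp only [Pi.zero_apply, map_zero]
  module

/-- The horizontal part is the curvature of D corrected by B, as in the projective Weyl tensor. When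
B is bilinear and D is torsion-free, the radial coefficient is minus the skew part of ∇B, a Cotton
tensor. -/
theorem curv_lift (hD : CovariantDerivative.ContMDiffCovariantDerivative D ∞)
    (hX : IsSmoothField X) (hY : IsSmoothField Y) (hZ : IsSmoothField Z) (p : Cone M) :
    curv T (lift h X) (lift h Y) (lift h Z) p = lift h (curv D X Y Z) p
      - B p (Z (proj p)) (Y (proj p)) • lift h X p + B p (Z (proj p)) (X (proj p)) • lift h Y p
      + (B p (along D X Z (proj p)) (Y (proj p)) - B p (along D Y Z (proj p)) (X (proj p))
        - mvfderiv coneModel (fun q => B q (Z (proj q)) (Y (proj q))) p (lift h X p)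
        + mvfderiv coneModel (fun q => B q (Z (proj q)) (X (proj q))) p (lift h Y p)
        + B p (Z (proj p)) (VectorField.mlieBracket (𝓡 2) X Y (proj p))) • radial p := by
  have key : ∀ {X Y Z : Π x : M, TangentSpace (𝓡 2) x}, IsSmoothField X → IsSmoothField Y →
      IsSmoothField Z → T (along T (lift h Y) (lift h Z)) p (lift h X p) =
        lift h (along D X (along D Y Z)) p - B p (along D Y Z (proj p)) (X (proj p)) • radial p
        - (B p (Z (proj p)) (Y (proj p)) • lift h X p +
          mvfderiv coneModel (fun q => B q (Z (proj q)) (Y (proj q))) p (lift h X p) • radial p) := by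
    intro X Y Z hX hY hZ
    have hYZ := along_smooth hD hY hZ
    have hB := hT.form_smooth Z Y hZ hY
    have h1 : T (lift h (along D Y Z)) p (lift h X p) = lift h (along D X (along D Y Z)) p -
      B p (along D Y Z (proj p)) (X (proj p)) • radial p := congrFun (hT.along_lift hX hYZ) p
    rw [hT.along_lift hY hZ,
      conn_sub T ((lift_smooth h hYZ).mdiffAt p) ((radial_smooth.smul hB).mdiffAt p), sub_apply,
      conn_smul T (smooth_mdiffAt hB p) (radial_smooth.mdiffAt p), hT.radial_eq, h1]
  have h3 : T (lift h Z) p (lift h (VectorField.mlieBracket (𝓡 2) X Y) p) =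
      lift h (along D (VectorField.mlieBracket (𝓡 2) X Y) Z) p -
      B p (Z (proj p)) (VectorField.mlieBracket (𝓡 2) X Y (proj p)) • radial p :=
    congrFun (hT.along_lift (bracket_smooth hX hY) hZ) p
  have h4 : lift h (curv D X Y Z) p = lift h (along D X (along D Y Z)) p -
      lift h (along D Y (along D X Z)) p - lift h (along D (VectorField.mlieBracket (𝓡 2) X Y) Z) p := by
    simp only [lift, curv, along_apply, map_sub]
  rw [curv, bracket_lift h hX hY, key hX hY hZ, key hY hX hZ, h3, h4]
  module

end IsConeLike

end

end AH

namespace AH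

open Affine

noncomputable section

variable {M : Type*} [TopologicalSpace M] [ChartedSpace Plane M] [IsManifold (𝓡 2) ∞ M]

section Curvature

variable [T2Space M]

theorem coneConn_isConeLike (h : Metric M) {D : Connection (𝓡 2) M} (P : SymForm M)
    (hD : CovariantDerivative.ContMDiffCovariantDerivative D ∞) (htor : D.torsion = 0) :
    IsConeLike h D (fun p v w => P.form (proj p) v w) (coneConn h D P 1) where
  smooth := coneConn_smooth h D P 1 hD
  torsion_eq := coneConn_torsion h D P 1 htor
  radial_eq p v := by rw [coneConn_radial, one_smul]
  lift_eq X hX p v := by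
    rw [coneConn_lift h D P 1 (hX.mdiffAt _), one_smul, add_sub_assoc]
  form_smooth X Y hX hY := (P.smooth X Y hX hY).comp proj_smooth

/-- The covariant derivative of a symmetric form is totally symmetric. -/
def SymForm.IsCodazzi (P : SymForm M) (D : Connection (𝓡 2) M) : Prop :=
  ∀ X Y Z : Π x : M, TangentSpace (𝓡 2) x, IsSmoothField X → IsSmoothField Y → IsSmoothField Z →
    ∀ x, mvfderiv (𝓡 2) (fun y => P.form y (Z y) (Y y)) x (X x)
        - P.form x (D Z x (X x)) (Y x) - P.form x (Z x) (D Y x (X x)) =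
      mvfderiv (𝓡 2) (fun y => P.form y (Z y) (X y)) x (Y x)
        - P.form x (D Z x (Y x)) (X x) - P.form x (Z x) (D X x (Y x))

namespace IsConeLike

variable {h : Metric M} {D : Connection (𝓡 2) M}
  {B : Π p : Cone M, TangentSpace (𝓡 2) (proj p) → TangentSpace (𝓡 2) (proj p) → ℝ}
  {T : Connection coneModel (Cone M)} (hT : IsConeLike h D B T)

include hT

theorem riemann_radial_right (p : Cone M) (u v : TangentSpace coneModel p) :
    riemann T p u v (radial p) = 0 := by
  obtain ⟨U, hU, rfl⟩ := exists_smoothField_apply u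
  obtain ⟨V, hV, rfl⟩ := exists_smoothField_apply v
  rw [riemann_apply hT.smooth hU hV radial_smooth, hT.curv_radial_right hU hV]

/-- The curvature vanishes if it vanishes on the radial field and horizontal lifts. -/
theorem riemann_eq_zero
    (h1 : ∀ (p : Cone M) (v w : TangentSpace (𝓡 2) (proj p)),
      riemann T p (radial p) (hlift h p v) (hlift h p w) = 0)
    (h2 : ∀ (p : Cone M) (u v w : TangentSpace (𝓡 2) (proj p)),
      riemann T p (hlift h p u) (hlift h p v) (hlift h p w) = 0)
    (p : Cone M) (u v w : TangentSpace coneModel p) : riemann T p u v w = 0 := by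
  have hs := hT.smooth
  have h3 : ∀ v w, riemann T p (hlift h p v) (radial p) (hlift h p w) = 0 := fun v w => by
    rw [riemann_swap hs, h1, neg_zero]
  have h4 : ∀ w, riemann T p (radial p) (radial p) w = 0 := fun w => by
    have h0 := eq_neg_iff_add_eq_zero.1 (riemann_swap hs p (radial p) (radial p) w)
    rw [← two_smul ℝ] at h0
    exact (smul_eq_zero.1 h0).resolve_left two_ne_zero
  rw [cone_decomp h p w, riemann_add_right hs, riemann_smul_right hs, hT.riemann_radial_right,
    cone_decomp h p u, riemann_add_left hs, riemann_smul_left hs,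
    cone_decomp h p v, riemann_add_mid hs, riemann_smul_mid hs, riemann_add_mid hs,
    riemann_smul_mid hs, h1, h2, h3, h4]
  simp

/-- The Ricci curvature of horizontal vectors. -/
theorem ric_lift (hD : CovariantDerivative.ContMDiffCovariantDerivative D ∞)
    (hB : ∀ (p : Cone M) v, IsLinearMap ℝ (B p v))
    {Y Z : Π x : M, TangentSpace (𝓡 2) x} (hY : IsSmoothField Y) (hZ : IsSmoothField Z)
    (p : Cone M) : ric T p (lift h Y p) (lift h Z p) =
      ric D (proj p) (Y (proj p)) (Z (proj p)) - B p (Z (proj p)) (Y (proj p))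
      - mvfderiv coneModel (fun q => B q (Z (proj q)) (Y (proj q))) p (radial p) := by
  have hs := hT.smooth
  let x := proj p
  have hlin : IsLinearMap ℝ (fun u => riemann T p u (lift h Y p) (lift h Z p)) :=
    ⟨fun _ _ => riemann_add_left hs _ _ _ _, fun _ _ => riemann_smul_left hs _ _ _ _⟩
  have hlin' : IsLinearMap ℝ (fun u => riemann D x u (Y x) (Z x)) :=
    ⟨fun _ _ => riemann_add_left hD _ _ _ _, fun _ _ => riemann_smul_left hD _ _ _ _⟩
  -- The trace is taken in the frame consisting of the radial vector (`none`) and the two horizontal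
  -- lifts (`some j`), with η and the projected coordinates as dual forms.
  have h1 := trace_eq_sum hlin (ι := Option (Fin 2))
    (fun k => k.elim (radial p) fun j => hlift h p (e x j))
    (fun k => k.elim (eta h p).toLinearMap fun j => (coneCoord p j p).toLinearMap) (fun v => by
      rw [Fintype.sum_option]
      conv_lhs => rw [cone_frame_sum h (mem_chart_source Plane (proj p)) v]
      simp only [lift, frame_self, x]
      rfl)
  have h2 := trace_eq_sum hlin' (e x) (fun j => (coord x j x).toLinearMap) (fun v => by
      conv_lhs => rw [frame_sum (mem_chart_source Plane x) v]
      simp only [frame_self]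
      rfl)
  -- Summation over the two indices gives −2B from the middle term and +B from the last one, by
  -- `h4`. The net coefficient −1 makes the Ricci tensor itself the right choice of P on a surface.
  have h3 : ∀ j, coneCoord p j p (riemann T p (hlift h p (e x j)) (lift h Y p) (lift h Z p)) =
      coord x j x (riemann D x (e x j) (Y x) (Z x)) - B p (Z x) (Y x)
        + B p (Z x) (coord x j x (Y x) • e x j) := by
    intro j
    obtain ⟨X, hX, hXx, hXe⟩ := exists_lift_apply h (p := p) (e x j)
    rw [← hXe, riemann_apply hs (lift_smooth h hX) (lift_smooth h hY) (lift_smooth h hZ),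
      hT.curv_lift hD hX hY hZ, coneCoord_apply]
    simp only [map_add, map_sub, map_smul, dproj_lift, dproj_radial, hXx, smul_zero,
      add_zero, smul_eq_mul]
    rw [← riemann_apply hD hX hY hZ, hXx, (hB p _).map_smul, smul_eq_mul,
      ← frame_self, coord_frame (mem_chart_source Plane _)]
    simp only [if_true, mul_one, frame_self, x]
    ring
  have h4 : B p (Z x) (Y x) = ∑ j, B p (Z x) (coord x j x (Y x) • e x j) := by
    conv_lhs => rw [frame_sum (mem_chart_source Plane x) (Y x), Fin.sum_univ_two,
      (hB p _).map_add]
    rw [Fin.sum_univ_two]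
    simp only [frame_self]
  have h5 : eta h p (riemann T p (radial p) (lift h Y p) (lift h Z p)) =
      - mvfderiv coneModel (fun q => B q (Z (proj q)) (Y (proj q))) p (radial p) := by
    rw [riemann_apply hs radial_smooth (lift_smooth h hY) (lift_smooth h hZ),
      hT.curv_radial_lift hD hY hZ, map_smul, eta_radial, smul_eq_mul, mul_one]
  rw [ric, ric, h1, h2, Fintype.sum_option]
  simp only [Option.elim, ContinuousLinearMap.coe_coe]
  rw [h5, Finset.sum_congr rfl fun j _ => h3 j, Finset.sum_add_distrib, ← h4,
    Finset.sum_sub_distrib]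
  simp only [Finset.sum_const, Finset.card_univ, Fintype.card_fin, nsmul_eq_mul]
  simp only [x]
  push_cast
  ring

end IsConeLike

/-- The curvature hypothesis cancels the horizontal part of `curv_lift`, the Codazzi equation its
radial part, and a form pulled back from M has no derivative along 𝕏. -/
theorem IsConeLike.isFlat {h : Metric M} {P : SymForm M} {D : Connection (𝓡 2) M} {T : Connection coneModel (Cone M)}
    (hT : IsConeLike h D (fun p v w => P.form (proj p) v w) T)
    (hD : CovariantDerivative.ContMDiffCovariantDerivative D ∞) (htor : D.torsion = 0)
    (hP : P.IsCodazzi D)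
    (hR : ∀ x u v w, riemann D x u v w = P.form x v w • u - P.form x u w • v) : IsFlat T := by
  refine ⟨hT.torsion_eq, hT.riemann_eq_zero (fun p v w => ?_) fun p u v w => ?_⟩
  · obtain ⟨Y, hY, -, hYe⟩ := exists_lift_apply h v
    obtain ⟨Z, hZ, -, hZe⟩ := exists_lift_apply h w
    rw [← hYe, ← hZe, riemann_apply hT.smooth radial_smooth (lift_smooth h hY) (lift_smooth h hZ),
      hT.curv_radial_lift hD hY hZ, mvfderiv_comp_proj (f := fun x => P.form x (Z x) (Y x))
      (smooth_mdiffAt (P.smooth Z Y hZ hY) _), dproj_radial]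
    simp
  · obtain ⟨X, hX, rfl, hXe⟩ := exists_lift_apply h u
    obtain ⟨Y, hY, rfl, hYe⟩ := exists_lift_apply h v
    obtain ⟨Z, hZ, rfl, hZe⟩ := exists_lift_apply h w
    have h1 : lift h (curv D X Y Z) p =
        P.form (proj p) (Z (proj p)) (Y (proj p)) • lift h X p -
          P.form (proj p) (Z (proj p)) (X (proj p)) • lift h Y p := by
      simp only [lift]
      rw [← riemann_apply hD hX hY hZ, hR, map_sub, map_smul, map_smul, P.symm _ (Z (proj p)),
        P.symm _ (Z (proj p))]
    have h2 := hP X Y Z hX hY hZ (proj p)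
    rw [← hXe, ← hYe, ← hZe, riemann_apply hT.smooth (lift_smooth h hX) (lift_smooth h hY)
      (lift_smooth h hZ), hT.curv_lift hD hX hY hZ, h1,
      mvfderiv_comp_proj (f := fun x => P.form x (Z x) (Y x))
      (smooth_mdiffAt (P.smooth Z Y hZ hY) _), mvfderiv_comp_proj
      (f := fun x => P.form x (Z x) (X x)) (smooth_mdiffAt (P.smooth Z X hZ hX) _), dproj_lift,
      dproj_lift, torsionFree_bracket htor (hX.mdiffAt _) (hY.mdiffAt _), map_sub]
    simp only [along_apply]
    have h3 : ∀ s : ℝ, s = 0 → ∀ a b : TangentSpace coneModel p, ∀ c d : ℝ,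
        c • a - d • b - c • a + d • b + s • radial p = 0 := by
      intro s hs a b c d
      rw [hs]
      module
    exact h3 _ (by linarith) _ _ _ _

theorem covRiemann_eq_zero_of_flat {T : Connection coneModel (Cone M)}
    (hf : ∀ (p : Cone M) (u v w : TangentSpace coneModel p), riemann T p u v w = 0) (p : Cone M)
    (q a b c : TangentSpace coneModel p) : covRiemann T p q a b c = 0 := by
  have : T (fun y => riemann T y (ext a y) (ext b y) (ext c y)) p = 0 := by
    simp only [hf]
    exact congrFun (CovariantDerivative.zero T) p
  rw [covRiemann, this, hf, hf, hf]
  simp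

end Curvature

/-! ### Invariance -/

section Scale

theorem dproj_scale (r : ℝˣ) (p : Cone M) (v : TangentSpace coneModel p) :
    dproj (scale r p) (mfderiv coneModel coneModel (scale r) p v) = dproj p v :=
  (congrArg (fun L : Plane × ℝ →L[ℝ] Plane => L v) (mfderiv_comp (I := coneModel)
    (I' := coneModel) (I'' := 𝓡 2) p (proj_smooth.mdifferentiable (by simp) _)
    ((scale_smooth r).mdifferentiable (by simp) p))).symm

theorem mvfderiv_scale {f : Cone M → ℝ} (r : ℝˣ) (p : Cone M)
    (hf : MDifferentiableAt coneModel 𝓘(ℝ, ℝ) f (scale r p)) (v : TangentSpace coneModel p) :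
    mvfderiv coneModel f (scale r p) (mfderiv coneModel coneModel (scale r) p v) =
      mvfderiv coneModel (fun q => f (scale r q)) p v :=
  (mvfderiv_comp_apply (I := coneModel) (I' := coneModel) (g := f) (f := scale r) p hf
    ((scale_smooth r).mdifferentiable (by simp) p) v).symm

theorem eta_scale (h : Metric M) (r : ℝˣ) (p : Cone M) (v : TangentSpace coneModel p) :
    eta h (scale r p) (mfderiv coneModel coneModel (scale r) p v) = eta h p v := by
  rw [eta, mvfderiv_scale r p (smooth_mdiffAt (logRadius_smooth h) _)]
  have : (fun q => logRadius h (scale r q)) = (fun _ => Real.log |(r : ℝ)|) + logRadius h :=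
    funext fun q => logRadius_scale h r q
  rw [this, mvfderiv_add mdifferentiableAt_const (smooth_mdiffAt (logRadius_smooth h) _),
    mvfderiv_const, zero_add, eta]

theorem mfderiv_scale_lift (h : Metric M) (r : ℝˣ) (X : Π x : M, TangentSpace (𝓡 2) x)
    (p : Cone M) : mfderiv coneModel coneModel (scale r) p (lift h X p) = lift h X (scale r p) := by
  refine cone_ext h ?_ ?_
  · rw [dproj_scale, dproj_lift, dproj_lift]
    rfl
  · rw [eta_scale, eta_lift, eta_lift]

/-- The action preserves η and the projection, so its differential is injective, hence invertible in
finite dimension. Pullbacks of fields under the action are then given by honest inverses. -/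
theorem mfderiv_scale_invertible (h : Metric M) (r : ℝˣ) (p : Cone M) :
    (mfderiv coneModel coneModel (scale r) p).IsInvertible := by
  let L : Plane × ℝ →L[ℝ] Plane × ℝ := mfderiv coneModel coneModel (scale r) p
  have hinj : Function.Injective L := by
    intro v w hvw
    refine cone_ext h (p := p) (v := v) (w := w) ?_ ?_
    · rw [← dproj_scale r p v, ← dproj_scale r p w]
      exact congrArg (dproj (scale r p)) hvw
    · rw [← eta_scale h r p v, ← eta_scale h r p w]
      exact congrArg (eta h (scale r p)) hvw
  exact ⟨(LinearEquiv.ofInjectiveEndo L.toLinearMap hinj).toContinuousLinearEquiv,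
    ContinuousLinearMap.ext fun v => rfl⟩

theorem mfderiv_scale_mpullback (h : Metric M) (r : ℝˣ)
    (Y : Π p : Cone M, TangentSpace coneModel p) (p : Cone M) :
    mfderiv coneModel coneModel (scale r) p
      (VectorField.mpullback coneModel coneModel (scale r) Y p) = Y (scale r p) := by
  rw [VectorField.mpullback_apply]
  exact (mfderiv_scale_invertible h r p).self_apply_inverse _

/-- The connection is built from η, the projection and objects on M, all preserved by the action.
Both sides are compared through their η-component and their projection. -/
theorem coneConn_invariant (h : Metric M) (D : Connection (𝓡 2) M) (P : SymForm M) (a : ℝ) (r : ℝˣ)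
    {Y : Π p : Cone M, TangentSpace coneModel p} (hY : IsSmoothField Y) (p : Cone M)
    (v : TangentSpace coneModel p) :
    mfderiv coneModel coneModel (scale r) p
        (coneConn h D P a (VectorField.mpullback coneModel coneModel (scale r) Y) p v) =
      coneConn h D P a Y (scale r p) (mfderiv coneModel coneModel (scale r) p v) := by
  set Y' := VectorField.mpullback coneModel coneModel (scale r) Y with hY'
  have hd : ∀ q, dproj q (Y' q) = dproj (scale r q) (Y (scale r q)) := fun q => by
    rw [← dproj_scale r q (Y' q), hY', mfderiv_scale_mpullback h]
  have he : ∀ q, eta h q (Y' q) = eta h (scale r q) (Y (scale r q)) := fun q => by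
    rw [← eta_scale h r q (Y' q), hY', mfderiv_scale_mpullback h]
  have hp : pullConn D Y' p v =
      pullConn D Y (scale r p) (mfderiv coneModel coneModel (scale r) p v) := by
    rw [pullConn_apply]
    refine Eq.trans ?_ (pullConn_apply D Y (scale r p) _).symm
    refine Finset.sum_congr rfl fun j _ => ?_
    rw [mvfderiv_scale r p (coneCoord_mdiffAt (hY.mdiffAt _) j), dproj_scale]
    have : (fun q => coneCoord p j q (Y' q)) =
        fun q => coneCoord (scale r p) j (scale r q) (Y (scale r q)) := by
      ext q
      rw [coneCoord_apply, hd q]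
      rfl
    rw [this, coneCoord_apply, hd p]
    rfl
  refine cone_ext h ?_ ?_
  · rw [dproj_scale, dproj_coneConn, hp, hd, he]
    refine Eq.trans ?_ (dproj_coneConn h D P a Y (scale r p) _).symm
    rw [dproj_scale, eta_scale]
    rfl
  · rw [eta_scale, eta_coneConn, eta_coneConn, dproj_scale, eta_scale, hd, he,
      mvfderiv_scale r p (eta_mdiffAt h (hY.mdiffAt _))]
    simp only [he]
    rfl

end Scale

end

end AH

/-! ### Covariant derivatives of tensors of low rank -/

namespace Affine

noncomputable section

variable {E : Type*} [NormedAddCommGroup E] [NormedSpace ℝ E] [FiniteDimensional ℝ E]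
  [CompleteSpace E] {H : Type*} [TopologicalSpace H] {I : ModelWithCorners ℝ E H}
  {N : Type*} [TopologicalSpace N] [ChartedSpace H N] [IsManifold I ∞ N]

/-- The covariant derivative of a `2`-tensor, computed on vector fields. -/
theorem covTensor_two (T : Connection I N) {t : CoTensor I N 2} {x : N} (ht : IsTensorAt t x)
    (u : TangentSpace I x) {V W : Π y : N, TangentSpace I y} (hV : FieldDiffAt V x)
    (hW : FieldDiffAt W x) : covTensor T t x u ![V x, W x] =
      mvfderiv I (fun y => t y ![V y, W y]) x u - (t x ![T V x u, W x] + t x ![V x, T W x u]) := by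
  have h2 : ∀ (y : N) (Z : Fin 2 → Π y : N, TangentSpace I y),
      (fun i => Z i y) = ![Z 0 y, Z 1 y] := fun y Z => by ext1 i; fin_cases i <;> rfl
  have h := covTensor_apply T ht u (V := ![V, W]) (fun i => by fin_cases i; exacts [hV, hW])
  have h3 : ∀ a b c : TangentSpace I x, Function.update ![a, b] 0 c = ![c, b] := fun a b c => by
    ext1 i; fin_cases i <;> rfl
  have h4 : ∀ a b c : TangentSpace I x, Function.update ![a, b] 1 c = ![a, c] := fun a b c => by
    ext1 i; fin_cases i <;> rfl
  rw [h2] at h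
  simp only [covFields, Fin.sum_univ_two, h2, h3, h4] at h
  exact h

/-- The covariant derivative of a `3`-tensor, computed on vector fields. -/
theorem covTensor_three (T : Connection I N) {t : CoTensor I N 3} {x : N} (ht : IsTensorAt t x)
    (u : TangentSpace I x) {V W Z : Π y : N, TangentSpace I y} (hV : FieldDiffAt V x)
    (hW : FieldDiffAt W x) (hZ : FieldDiffAt Z x) : covTensor T t x u ![V x, W x, Z x] =
      mvfderiv I (fun y => t y ![V y, W y, Z y]) x u -
        (t x ![T V x u, W x, Z x] + t x ![V x, T W x u, Z x] + t x ![V x, W x, T Z x u]) := by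
  have h2 : ∀ (y : N) (Z : Fin 3 → Π y : N, TangentSpace I y),
      (fun i => Z i y) = ![Z 0 y, Z 1 y, Z 2 y] := fun y Z => by ext1 i; fin_cases i <;> rfl
  have h := covTensor_apply T ht u (V := ![V, W, Z])
    (fun i => by fin_cases i; exacts [hV, hW, hZ])
  have h3 : ∀ a b c d : TangentSpace I x, Function.update ![a, b, c] 0 d = ![d, b, c] :=
    fun a b c d => by ext1 i; fin_cases i <;> rfl
  have h4 : ∀ a b c d : TangentSpace I x, Function.update ![a, b, c] 1 d = ![a, d, c] :=
    fun a b c d => by ext1 i; fin_cases i <;> rfl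
  have h5 : ∀ a b c d : TangentSpace I x, Function.update ![a, b, c] 2 d = ![a, b, d] :=
    fun a b c d => by ext1 i; fin_cases i <;> rfl
  rw [h2] at h
  simp only [covFields, Fin.sum_univ_three, h2, h3, h4, h5] at h
  exact h

/-- The covariant derivative of a `4`-tensor, computed on vector fields. -/
theorem covTensor_four (T : Connection I N) {t : CoTensor I N 4} {x : N} (ht : IsTensorAt t x)
    (u : TangentSpace I x) {V W Z Y : Π y : N, TangentSpace I y} (hV : FieldDiffAt V x)
    (hW : FieldDiffAt W x) (hZ : FieldDiffAt Z x) (hY : FieldDiffAt Y x) :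
    covTensor T t x u ![V x, W x, Z x, Y x] =
      mvfderiv I (fun y => t y ![V y, W y, Z y, Y y]) x u -
        (t x ![T V x u, W x, Z x, Y x] + t x ![V x, T W x u, Z x, Y x] +
          t x ![V x, W x, T Z x u, Y x] + t x ![V x, W x, Z x, T Y x u]) := by
  have h2 : ∀ (y : N) (Z : Fin 4 → Π y : N, TangentSpace I y),
      (fun i => Z i y) = ![Z 0 y, Z 1 y, Z 2 y, Z 3 y] := fun y Z => by
    ext1 i; fin_cases i <;> rfl
  have h := covTensor_apply T ht u (V := ![V, W, Z, Y])
    (fun i => by fin_cases i; exacts [hV, hW, hZ, hY])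
  have h3 : ∀ a b c d z : TangentSpace I x, Function.update ![a, b, c, d] 0 z = ![z, b, c, d] :=
    fun a b c d z => by ext1 i; fin_cases i <;> rfl
  have h4 : ∀ a b c d z : TangentSpace I x, Function.update ![a, b, c, d] 1 z = ![a, z, c, d] :=
    fun a b c d z => by ext1 i; fin_cases i <;> rfl
  have h5 : ∀ a b c d z : TangentSpace I x, Function.update ![a, b, c, d] 2 z = ![a, b, z, d] :=
    fun a b c d z => by ext1 i; fin_cases i <;> rfl
  have h6 : ∀ a b c d z : TangentSpace I x, Function.update ![a, b, c, d] 3 z = ![a, b, c, z] :=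
    fun a b c d z => by ext1 i; fin_cases i <;> rfl
  rw [h2] at h
  simp only [covFields, Fin.sum_univ_four, h2, h3, h4, h5, h6] at h
  exact h

end

end Affine

namespace AH

open Affine

noncomputable section

variable {M : Type*} [TopologicalSpace M] [ChartedSpace Plane M] [IsManifold (𝓡 2) ∞ M]

/-! ### Geodesics -/

section Geodesic

theorem pullConn_congr_dproj (D : Connection (𝓡 2) M)
    {Y Z : Π q : Cone M, TangentSpace coneModel q} {p : Cone M}
    (h : ∀ᶠ q in 𝓝 p, dproj q (Y q) = dproj q (Z q)) : pullConn D Y p = pullConn D Z p := by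
  ext1 v
  have hc : ∀ j, ∀ᶠ q in 𝓝 p, coneCoord p j q (Y q) = coneCoord p j q (Z q) := fun j =>
    h.mono fun q hq => by rw [coneCoord_apply, hq]; rfl
  rw [pullConn_apply, pullConn_apply]
  refine Finset.sum_congr rfl fun j _ => ?_
  rw [mvfderiv_congr (f := fun q => coneCoord p j q (Y q)) (g := fun q => coneCoord p j q (Z q))
    (hc j), (hc j).self_of_nhds]

/-- Near p the projection of Z is z · X with a differentiable function z. The Leibniz rule leaves a
multiple of X and a multiple of the derivative of X in its own direction, which is again a multiple
of X by the geodesic equation. -/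
theorem pullConn_mem_span (h : Metric M) (D : Connection (𝓡 2) M)
    {X : Π x : M, TangentSpace (𝓡 2) x} (hX : IsSmoothField X) {p : Cone M} (h0 : X (proj p) ≠ 0)
    (hgeo : ∃ c : ℝ, D X (proj p) (X (proj p)) = c • X (proj p))
    {Z : Π q : Cone M, TangentSpace coneModel q} (hZ : FieldDiffAt Z p)
    (hZX : ∀ q, dproj q (Z q) ∈ Submodule.span ℝ {X (proj q)}) {v : TangentSpace coneModel p}
    (hv : dproj p v ∈ Submodule.span ℝ {X (proj p)}) :
    pullConn D Z p v ∈ Submodule.span ℝ {X (proj p)} := by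
  set x := proj p with hx
  obtain ⟨i, hi⟩ : ∃ i, coord x i x (X x) ≠ 0 := by
    by_contra! hc
    refine h0 ?_
    rw [frame_sum (mem_chart_source Plane x) (X x)]
    simp [hc]
  have hXd : MDifferentiableAt coneModel 𝓘(ℝ, ℝ) (fun q : Cone M => coord x i (proj q) (X (proj q))) p :=
    (coord_mdiffAt (hX.mdiffAt x) i).comp p (proj_smooth.mdifferentiable (by simp) p)
  -- The factor of proportionality, found by dividing in a coordinate in which X does not vanish at
  -- x.
  let z : Cone M → ℝ := fun q => coneCoord p i q (Z q) / coord x i (proj q) (X (proj q))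
  have hz : MDifferentiableAt coneModel 𝓘(ℝ, ℝ) z p := by
    have h2 : MDifferentiableAt coneModel 𝓘(ℝ, ℝ)
        (fun q : Cone M => (coord x i (proj q) (X (proj q)))⁻¹) p :=
      (differentiableAt_inv hi).mdifferentiableAt.comp p hXd
    exact (coneCoord_mdiffAt hZ i).mul h2
  have hne : ∀ᶠ q : Cone M in 𝓝 p, coord x i (proj q) (X (proj q)) ≠ 0 :=
    hXd.continuousAt.eventually_ne hi
  have he : ∀ᶠ q in 𝓝 p, dproj q (Z q) = dproj q ((z • lift h X) q) := by
    filter_upwards [hne] with q hq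
    obtain ⟨c, hc⟩ := Submodule.mem_span_singleton.1 (hZX q)
    rw [Pi.smul_apply', map_smul, dproj_lift]
    have : z q = c := by
      simp only [z, coneCoord_apply, ← hc, map_smul, smul_eq_mul]
      exact mul_div_cancel_right₀ c hq
    rw [this, hc]
  obtain ⟨y, hy⟩ := Submodule.mem_span_singleton.1 hv
  obtain ⟨c, hc⟩ := hgeo
  rw [pullConn_congr_dproj D he, pullConn_smul D hz (lift_diffAt h (hX.mdiffAt _)),
    pullConn_lift D h (hX.mdiffAt _), ← hy, map_smul, dproj_lift, ← hx, hc]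
  have hm := Submodule.mem_span_singleton_self (R := ℝ) (X x)
  exact Submodule.add_mem _ (Submodule.smul_mem _ _ (Submodule.smul_mem _ _
    (Submodule.smul_mem _ _ hm))) (Submodule.smul_mem _ _ hm)

/-- Apart from the term of `pullConn_mem_span`, the projection of the covariant derivative contains
only multiples of the projections of Y and Z. -/
theorem coneConn_geodesic (h : Metric M) (D : Connection (𝓡 2) M) (P : SymForm M) (a : ℝ)
    {X : Π x : M, TangentSpace (𝓡 2) x} (hX : IsSmoothField X) {p : Cone M} (h0 : X (proj p) ≠ 0)
    (hgeo : ∃ c : ℝ, D X (proj p) (X (proj p)) = c • X (proj p))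
    {Y Z : Π q : Cone M, TangentSpace coneModel q} (hZ : FieldDiffAt Z p)
    (hYX : ∀ q, dproj q (Y q) ∈ Submodule.span ℝ {X (proj q)})
    (hZX : ∀ q, dproj q (Z q) ∈ Submodule.span ℝ {X (proj q)}) :
    dproj p (coneConn h D P a Z p (Y p)) ∈ Submodule.span ℝ {X (proj p)} := by
  rw [dproj_coneConn]
  exact Submodule.add_mem _ (pullConn_mem_span h D hX h0 hgeo hZ hZX (hYX p))
    (Submodule.smul_mem _ _ (Submodule.add_mem _ (Submodule.smul_mem _ _ (hYX p))
      (Submodule.smul_mem _ _ (hZX p))))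

theorem ProjEquiv.geodesic {B D : TorsionFree M} (hBD : ProjEquiv B D)
    {X : Π x : M, TangentSpace (𝓡 2) x} (hX : IsSmoothField X) {x : M}
    (hgeo : ∃ c : ℝ, B.conn X x (X x) = c • X x) : ∃ c : ℝ, D.conn X x (X x) = c • X x := by
  obtain ⟨γ, hγ⟩ := hBD
  obtain ⟨c, hc⟩ := hgeo
  refine ⟨c + γ x (X x) + γ x (X x), ?_⟩
  rw [hγ X x (hX.mdiffAt x), hc]
  module

end Geodesic

/-! ### The tautological two-form -/

section Volume

theorem taut_eq (p : Cone M) (v : Fin 2 → TangentSpace coneModel p) :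
    tautological M p v = component p * wedge (dproj p (v 0)) (dproj p (v 1)) := rfl

theorem wedge_add_left (a b c : Plane) : wedge (a + b) c = wedge a c + wedge b c := by
  simp only [wedge, PiLp.add_apply]; ring

theorem wedge_smul_left (r : ℝ) (a c : Plane) : wedge (r • a) c = r * wedge a c := by
  simp only [wedge, PiLp.smul_apply, smul_eq_mul]; ring

theorem wedge_swap (a b : Plane) : wedge a b = - wedge b a := by
  simp only [wedge]; ring

theorem wedge_add_right (a b c : Plane) : wedge a (b + c) = wedge a b + wedge a c := by
  simp only [wedge, PiLp.add_apply]; ring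

theorem taut_swap (p : Cone M) (v w : TangentSpace coneModel p) :
    tautological M p ![v, w] = - tautological M p ![w, v] := by
  rw [taut_eq, taut_eq]
  exact (congrArg _ (wedge_swap _ _)).trans (mul_neg _ _)

theorem taut_add_left (p : Cone M) (u v w : TangentSpace coneModel p) :
    tautological M p ![u + v, w] = tautological M p ![u, w] + tautological M p ![v, w] := by
  simp only [taut_eq, Matrix.cons_val_zero, Matrix.cons_val_one, map_add]
  exact (congrArg _ (wedge_add_left _ _ _)).trans (mul_add _ _ _)

theorem taut_smul_left (p : Cone M) (c : ℝ) (v w : TangentSpace coneModel p) :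
    tautological M p ![c • v, w] = c * tautological M p ![v, w] := by
  simp only [taut_eq, Matrix.cons_val_zero, Matrix.cons_val_one, map_smul]
  exact (congrArg _ (wedge_smul_left _ _ _)).trans (mul_left_comm _ _ _)

theorem taut_add_right (p : Cone M) (u v w : TangentSpace coneModel p) :
    tautological M p ![u, v + w] = tautological M p ![u, v] + tautological M p ![u, w] := by
  rw [taut_swap, taut_add_left, taut_swap p u v, taut_swap p u w]; ring

theorem taut_smul_right (p : Cone M) (c : ℝ) (v w : TangentSpace coneModel p) :
    tautological M p ![v, c • w] = c * tautological M p ![v, w] := by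
  rw [taut_swap, taut_smul_left, taut_swap p v w]; ring

/-- The tautological form in the preferred chart at `x`. -/
theorem taut_eq_fib {x : M} {q : Cone M} (hq : proj q ∈ (chartAt Plane x).source)
    (v : Fin 2 → TangentSpace coneModel q) : tautological M q v = fib x q *
      (coord x 0 (proj q) (dproj q (v 0)) * coord x 1 (proj q) (dproj q (v 1)) -
        coord x 1 (proj q) (dproj q (v 0)) * coord x 0 (proj q) (dproj q (v 1))) := by
  have h1 := fun z => ext_chartVec (I := 𝓡 2) (x := x) hq z
  have h2 := twoForm_ext hq (chartVec x (proj q) (dproj q (v 0)))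
    (chartVec x (proj q) (dproj q (v 1)))
  rw [h1, h1] at h2
  exact h2

theorem taut_isTensorAt (p : Cone M) : IsTensorAt (tautological M) p where
  multilinear q := by
    refine ⟨MultilinearMap.mk' (fun v => tautological M q v) ?_ ?_, fun v => rfl⟩
    · intro v i a b
      have hv : ∀ w : Fin 2 → TangentSpace coneModel q, w = ![w 0, w 1] := fun w => by
        ext1 j; fin_cases j <;> rfl
      rw [hv (Function.update v i (a + b)), hv (Function.update v i a), hv (Function.update v i b)]
      fin_cases i
      · simpa using taut_add_left q a b (v 1)
      · simpa using taut_add_right q (v 0) a b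
    · intro v i c a
      have hv : ∀ w : Fin 2 → TangentSpace coneModel q, w = ![w 0, w 1] := fun w => by
        ext1 j; fin_cases j <;> rfl
      rw [hv (Function.update v i (c • a)), hv (Function.update v i a)]
      fin_cases i
      · simpa using taut_smul_left q c a (v 1)
      · simpa using taut_smul_right q c (v 0) a
  mdiff V hV := by
    have hc := fun i j => coneCoord_mdiffAt (hV i) j
    have hf : MDifferentiableAt coneModel 𝓘(ℝ, ℝ) (fib (proj p)) p :=
      smoothAt_mdiffAt (fib_smoothAt (mem_chart_source Plane (proj p)))
    refine (hf.mul (((hc 0 0).mul (hc 1 1)).sub ((hc 0 1).mul (hc 1 0)))).congr_of_eventuallyEq ?_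
    filter_upwards [proj_source_eventually p] with q hq
    exact taut_eq_fib hq _

/-- The cyclic sum `η ∧ μ`. -/
def etaTaut (h : Metric M) (p : Cone M) (u v w : TangentSpace coneModel p) : ℝ :=
  eta h p u * tautological M p ![v, w] + eta h p v * tautological M p ![w, u] +
    eta h p w * tautological M p ![u, v]

end Volume

end

end AH

namespace AH

open Affine

noncomputable section

variable {M : Type*} [TopologicalSpace M] [ChartedSpace Plane M] [IsManifold (𝓡 2) ∞ M]

/-! ### The determinant of the metric as a parallel tensor -/

section DetTensor

variable (h : Metric M)

theorem detTensor_isTensorAt (x : M) : IsTensorAt (detTensor h) x where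
  multilinear y := by
    refine ⟨MultilinearMap.mk' (fun v => detTensor h y v) ?_ ?_, fun v => rfl⟩
    · intro v i a b
      fin_cases i <;> simp [detTensor] <;> ring
    · intro v i c a
      fin_cases i <;> simp [detTensor] <;> ring
  mdiff V hV := by
    have hc := fun i j => inner_mdiffAt h (hV i) (hV j)
    exact ((hc 0 2).mul (hc 1 3)).sub ((hc 0 3).mul (hc 1 2))

theorem metricTensor_isTensorAt (x : M) : IsTensorAt (metricTensor h) x where
  multilinear y := by
    refine ⟨MultilinearMap.mk' (fun v => metricTensor h y v) ?_ ?_, fun v => rfl⟩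
    · intro v i a b
      fin_cases i <;> simp [metricTensor]
    · intro v i c a
      fin_cases i <;> simp [metricTensor]
  mdiff V hV := inner_mdiffAt h (hV 0) (hV 1)

theorem detTensor_smooth {X Y : Π y : M, TangentSpace (𝓡 2) y} (hX : IsSmoothField X)
    (hY : IsSmoothField Y) :
    ContMDiff (𝓡 2) 𝓘(ℝ, ℝ) ∞ (fun y => detTensor h y ![X y, Y y, X y, Y y]) := fun x =>
  ((inner_smoothAt h (hX x) (hX x)).mul (inner_smoothAt h (hY x) (hY x))).sub
    ((inner_smoothAt h (hX x) (hY x)).mul (inner_smoothAt h (hY x) (hX x)))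

/-- The area form of `h` is parallel. -/
def IsAreaParallel (D : Connection (𝓡 2) M) : Prop :=
  ∀ x u v, covTensor D (detTensor h) x u v = 0

variable {h} {D : Connection (𝓡 2) M}

theorem IsAreaParallel.mvfderiv_det (hD : IsAreaParallel h D) {X Y : Π y : M, TangentSpace (𝓡 2) y}
    {x : M} (hX : FieldDiffAt X x) (hY : FieldDiffAt Y x) (u : TangentSpace (𝓡 2) x) :
    mvfderiv (𝓡 2) (fun y => detTensor h y ![X y, Y y, X y, Y y]) x u =
      2 * ((gram h x).det * wedge (X x) (Y x) *
        (wedge (D X x u) (Y x) + wedge (X x) (D Y x u))) := by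
  have h1 := covTensor_four D (detTensor_isTensorAt h x) u hX hY hX hY
  rw [hD, eq_comm, sub_eq_zero] at h1
  rw [h1]
  simp only [detTensor_apply, Matrix.cons_val_zero, Matrix.cons_val_one, Matrix.cons_val]
  ring

end DetTensor

/-! ### The covariant derivative of the tautological two-form -/

section Taut

variable [T2Space M] {h : Metric M} {D : Connection (𝓡 2) M}

theorem exp_logRadius (p : Cone M) :
    Real.exp (6 * logRadius h p) = component p ^ 2 / (gram h (proj p)).det := by
  have h1 : 0 < component p ^ 2 / (gram h (proj p)).det :=
    div_pos (by have := component_ne_zero p; positivity) (gram_det_pos h _)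
  rw [logRadius, ← mul_assoc, show (6 : ℝ) * (1 / 6) = 1 by norm_num, one_mul, Real.exp_log h1]

theorem exists_wedge_ne_zero {a : Plane} (ha : a ≠ 0) : ∃ c : Plane, wedge a c ≠ 0 := by
  by_contra! hc
  refine ha ?_
  have h0 := hc (EuclideanSpace.single 0 1)
  have h1 := hc (EuclideanSpace.single 1 1)
  simp [wedge] at h0 h1
  ext i
  fin_cases i
  · exact h1
  · exact h0

theorem zero_wedge (a : Plane) : wedge 0 a = 0 := by simp [wedge]

theorem taut_lift_mdiffAt {X Y : Π y : M, TangentSpace (𝓡 2) y} {p : Cone M}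
    (hX : FieldDiffAt X (proj p)) (hY : FieldDiffAt Y (proj p)) :
    MDifferentiableAt coneModel 𝓘(ℝ, ℝ)
      (fun q => tautological M q ![lift h X q, lift h Y q]) p := by
  have := (taut_isTensorAt p).mdiff ![lift h X, lift h Y]
    (fun i => by fin_cases i; exacts [lift_diffAt h hX, lift_diffAt h hY])
  refine this.congr_of_eventuallyEq (Filter.Eventually.of_forall fun q => ?_)
  exact congrArg _ (by ext1 i; fin_cases i <;> rfl)

theorem taut_lift (X Y : Π y : M, TangentSpace (𝓡 2) y) (q : Cone M) :
    tautological M q ![lift h X q, lift h Y q] =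
      component q * wedge (X (proj q)) (Y (proj q)) := by
  rw [taut_eq]
  simp only [Matrix.cons_val_zero, Matrix.cons_val_one, dproj_lift]

/-- The hypothesis concerns det h, which is quadratic in the area form, and no orientation is
available. So the square of μ(X̂, Ŷ) is differentiated: it equals e^{6ρ} times det h evaluated on X,
Y, X, Y. Division by 2μ(X̂, Ŷ) requires X and Y to be independent at the point. -/
theorem mvfderiv_taut_lift_aux (hD : IsAreaParallel h D) {X Y : Π y : M, TangentSpace (𝓡 2) y}
    {p : Cone M} (hX : FieldDiffAt X (proj p)) (hY : FieldDiffAt Y (proj p))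
    (h0 : wedge (X (proj p)) (Y (proj p)) ≠ 0) (u : TangentSpace coneModel p) :
    mvfderiv coneModel (fun q => tautological M q ![lift h X q, lift h Y q]) p u =
      3 * eta h p u * (component p * wedge (X (proj p)) (Y (proj p))) +
        component p * (wedge (D X (proj p) (dproj p u)) (Y (proj p)) +
          wedge (X (proj p)) (D Y (proj p) (dproj p u))) := by
  set f : Cone M → ℝ := fun q => tautological M q ![lift h X q, lift h Y q] with hf
  set F : M → ℝ := fun y => detTensor h y ![X y, Y y, X y, Y y] with hF
  have hfd : MDifferentiableAt coneModel 𝓘(ℝ, ℝ) f p := taut_lift_mdiffAt hX hY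
  have hFd : MDifferentiableAt (𝓡 2) 𝓘(ℝ, ℝ) F (proj p) :=
    ((inner_mdiffAt h hX hX).mul (inner_mdiffAt h hY hY)).sub
      ((inner_mdiffAt h hX hY).mul (inner_mdiffAt h hY hX))
  have hFd' : MDifferentiableAt coneModel 𝓘(ℝ, ℝ) (fun q => F (proj q)) p :=
    hFd.comp p (proj_smooth.mdifferentiable (by simp) p)
  have hρ := smooth_mdiffAt (logRadius_smooth h) p
  have hE : HasMFDerivAt coneModel 𝓘(ℝ, ℝ) (fun q => Real.exp (6 * logRadius h q)) p
      ((Real.exp (6 * logRadius h p) * 6) • (show TangentSpace coneModel p →L[ℝ] ℝ from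
        mvfderiv coneModel (logRadius h) p)) := by
    have h1 : HasFDerivAt (fun t : ℝ => Real.exp (6 * t))
        (ContinuousLinearMap.toSpanSingleton ℝ (Real.exp (6 * logRadius h p) * 6))
        (logRadius h p) := by
      have h2 : HasDerivAt (fun t : ℝ => 6 * t) 6 (logRadius h p) := by
        simpa using (hasDerivAt_id (logRadius h p)).const_mul 6
      exact h2.exp.hasFDerivAt
    have h3 := h1.hasMFDerivAt.comp p hρ.hasMFDerivAt
    refine h3.congr_mfderiv ?_
    ext v
    exact mul_comm (_ : ℝ) _
  have hsq : ∀ q, f q * f q = Real.exp (6 * logRadius h q) * F (proj q) := by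
    intro q
    rw [exp_logRadius]
    simp only [hf, hF, taut_lift, detTensor_apply]
    change _ = component q ^ 2 / (gram h (proj q)).det * ((gram h (proj q)).det *
      (wedge (X (proj q)) (Y (proj q)) * wedge (X (proj q)) (Y (proj q))))
    have := (gram_det_pos h (proj q)).ne'
    field_simp
  have hd : mvfderiv coneModel (fun q => f q * f q) p u = mvfderiv coneModel
      (fun q => Real.exp (6 * logRadius h q) * F (proj q)) p u :=
    congrArg (fun L : TangentSpace coneModel p →L[ℝ] ℝ => L u) (congrArg (fun φ : Cone M → ℝ => mvfderiv coneModel φ p) (funext hsq))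
  have hd1 : mvfderiv coneModel (fun q => f q * f q) p u =
      f p * mvfderiv coneModel f p u + f p * mvfderiv coneModel f p u :=
    congrArg (fun L : TangentSpace coneModel p →L[ℝ] ℝ => L u)
      (hfd.hasMFDerivAt.mul hfd.hasMFDerivAt).mfderiv
  have hd2 : mvfderiv coneModel (fun q => Real.exp (6 * logRadius h q) * F (proj q)) p u =
      Real.exp (6 * logRadius h p) * mvfderiv coneModel (fun q => F (proj q)) p u
        + F (proj p) * (Real.exp (6 * logRadius h p) * 6 * eta h p u) :=
    congrArg (fun L : TangentSpace coneModel p →L[ℝ] ℝ => L u)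
      (hE.mul hFd'.hasMFDerivAt).mfderiv
  rw [mvfderiv_comp_proj hFd, hD.mvfderiv_det hX hY] at hd2
  have hfp : f p = component p * wedge (X (proj p)) (Y (proj p)) := taut_lift X Y p
  have hFp : F (proj p) = (gram h (proj p)).det * (wedge (X (proj p)) (Y (proj p)) *
      wedge (X (proj p)) (Y (proj p))) := by
    exact detTensor_apply h _ _
  have hc := component_ne_zero p
  have hg := (gram_det_pos h (proj p)).ne'
  rw [hd1, hd2, hfp, hFp, exp_logRadius] at hd
  field_simp at hd
  linarith

/-- Differentiation of `μ` on horizontal lifts, as a property of two fields. -/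
def TautLift (h : Metric M) (D : Connection (𝓡 2) M) (p : Cone M) (u : TangentSpace coneModel p)
    (X Y : Π y : M, TangentSpace (𝓡 2) y) : Prop :=
  mvfderiv coneModel (fun q => tautological M q ![lift h X q, lift h Y q]) p u =
      3 * eta h p u * (component p * wedge (X (proj p)) (Y (proj p))) +
        component p * (wedge (D X (proj p) (dproj p u)) (Y (proj p)) +
          wedge (X (proj p)) (D Y (proj p) (dproj p u)))

theorem TautLift.swap {p : Cone M} {u : TangentSpace coneModel p}
    {X Y : Π y : M, TangentSpace (𝓡 2) y} (hX : FieldDiffAt X (proj p))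
    (hY : FieldDiffAt Y (proj p)) (hXY : TautLift h D p u X Y) : TautLift h D p u Y X := by
  unfold TautLift at hXY ⊢
  have e1 : (fun q => tautological M q ![lift h Y q, lift h X q]) =
      fun q => - tautological M q ![lift h X q, lift h Y q] := funext fun q => taut_swap q _ _
  have e2 : mvfderiv coneModel (fun q => - tautological M q ![lift h X q, lift h Y q]) p u =
      - mvfderiv coneModel (fun q => tautological M q ![lift h X q, lift h Y q]) p u :=
    congrArg (fun L : TangentSpace coneModel p →L[ℝ] ℝ => L u)
      (taut_lift_mdiffAt hX hY).hasMFDerivAt.neg.mfderiv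
  rw [e1, e2, hXY]
  simp only [wedge]
  ring

/-- Both sides are additive in the second field, so the formula passes to a difference. This removes
the independence assumption of `mvfderiv_taut_lift_aux`. -/
theorem TautLift.of_add {p : Cone M} {u : TangentSpace coneModel p}
    {X Y C : Π y : M, TangentSpace (𝓡 2) y} (hX : FieldDiffAt X (proj p))
    (hY : FieldDiffAt Y (proj p)) (hC : FieldDiffAt C (proj p))
    (e1 : TautLift h D p u X (Y + C)) (e2 : TautLift h D p u X C) : TautLift h D p u X Y := by
  unfold TautLift at e1 e2 ⊢
  have e3 : mvfderiv coneModel (fun q => tautological M q ![lift h X q, lift h (Y + C) q]) p u =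
      mvfderiv coneModel (fun q => tautological M q ![lift h X q, lift h Y q]) p u +
      mvfderiv coneModel (fun q => tautological M q ![lift h X q, lift h C q]) p u := by
    have e4 : (fun q => tautological M q ![lift h X q, lift h (Y + C) q]) =
        (fun q => tautological M q ![lift h X q, lift h Y q]) +
        fun q => tautological M q ![lift h X q, lift h C q] := by
      ext q
      rw [lift_add, Pi.add_apply, taut_add_right, Pi.add_apply]
    rw [e4]
    exact congrArg (fun L : TangentSpace coneModel p →L[ℝ] ℝ => L u)
      ((taut_lift_mdiffAt hX hY).hasMFDerivAt.add (taut_lift_mdiffAt hX hC).hasMFDerivAt).mfderiv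
  rw [e3, e2, conn_add D hY hC] at e1
  have e8 : wedge (X (proj p)) ((Y + C) (proj p)) = _ :=
    wedge_add_right (X (proj p)) (Y (proj p)) (C (proj p))
  have e9 : wedge (D X (proj p) (dproj p u)) ((Y + C) (proj p)) = _ :=
    wedge_add_right (D X (proj p) (dproj p u)) (Y (proj p)) (C (proj p))
  have e10 : wedge (X (proj p)) ((D Y (proj p) + D C (proj p)) (dproj p u)) = _ :=
    wedge_add_right (X (proj p)) (D Y (proj p) (dproj p u)) (D C (proj p) (dproj p u))
  rw [e8, e9, e10] at e1
  linarith

/-- If Y is proportional to X at the point, a field C independent of X is added: then both C and Y +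
C are independent of X there. -/
theorem tautLift_of_ne_zero (hD : IsAreaParallel h D) {X Y : Π y : M, TangentSpace (𝓡 2) y}
    {p : Cone M} (hX : FieldDiffAt X (proj p)) (hY : FieldDiffAt Y (proj p))
    (h0 : X (proj p) ≠ 0) (u : TangentSpace coneModel p) : TautLift h D p u X Y := by
  by_cases hXY : wedge (X (proj p)) (Y (proj p)) = 0
  · obtain ⟨c, hc⟩ := exists_wedge_ne_zero (a := X (proj p)) h0
    let c' : TangentSpace (𝓡 2) (proj p) := c
    have hC : FieldDiffAt (ext c') (proj p) := mdiffAt_ext c'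
    have hYC : FieldDiffAt (Y + ext c') (proj p) := mdifferentiableAt_add_section hY hC
    have hc' : wedge (X (proj p)) (ext c' (proj p)) ≠ 0 := by
      rw [ext_self]; exact hc
    refine TautLift.of_add hX hY hC (mvfderiv_taut_lift_aux hD hX hYC ?_ u)
      (mvfderiv_taut_lift_aux hD hX hC hc' u)
    intro h1
    have h2 : wedge (X (proj p)) ((Y + ext c') (proj p)) = _ :=
      wedge_add_right (X (proj p)) (Y (proj p)) (ext c' (proj p))
    rw [h2, hXY, zero_add] at h1
    exact hc' h1
  · exact mvfderiv_taut_lift_aux hD hX hY hXY u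

/-- A field X vanishing at the point is the difference of X + E and E with E a coordinate field,
neither of which vanishes. -/
theorem tautLift (hD : IsAreaParallel h D) {X Y : Π y : M, TangentSpace (𝓡 2) y}
    {p : Cone M} (hX : FieldDiffAt X (proj p)) (hY : FieldDiffAt Y (proj p))
    (u : TangentSpace coneModel p) : TautLift h D p u X Y := by
  by_cases h0 : X (proj p) = 0
  · have hE : FieldDiffAt (ext (e (proj p) 0)) (proj p) := mdiffAt_ext _
    have hXE : FieldDiffAt (X + ext (e (proj p) 0)) (proj p) := mdifferentiableAt_add_section hX hE
    have hE0 : ext (e (proj p) 0) (proj p) ≠ 0 := by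
      rw [ext_self]; exact e_ne_zero _ _
    refine (TautLift.of_add hY hX hE ((tautLift_of_ne_zero hD hXE hY ?_ u).swap hXE hY)
      ((tautLift_of_ne_zero hD hE hY hE0 u).swap hE hY)).swap hY hX
    rwa [Pi.add_apply, h0, zero_add]
  · exact tautLift_of_ne_zero hD hX hY h0 u

/-- The covariant derivative of the tautological two-form. -/
theorem covTensor_taut (hD : IsAreaParallel h D) (P : SymForm M) (p : Cone M)
    (u v w : TangentSpace coneModel p) :
    covTensor (coneConn h D P 1) (tautological M) p u ![v, w] = etaTaut h p u v w := by
  -- Vectors are extended with constant radial coefficient. The radial part then drops out of μ, and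
  -- only μ on horizontal lifts has to be differentiated.
  have hex : ∀ v : TangentSpace coneModel p, ∃ (c : ℝ) (X : Π y : M, TangentSpace (𝓡 2) y),
      FieldDiffAt X (proj p) ∧ v = ((c • radial + lift h X :) : Π q : Cone M, TangentSpace coneModel q) p ∧ c = eta h p v := by
    intro v
    refine ⟨eta h p v, ext (dproj p v), mdiffAt_ext _, ?_, rfl⟩
    have := cone_decomp h p v
    rwa [Pi.add_apply, Pi.smul_apply, lift, ext_self]
  obtain ⟨a, X, hX, hv, ha⟩ := hex v
  obtain ⟨b, Y, hY, hw, hb⟩ := hex w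
  have hr : FieldDiffAt (radial : Π q : Cone M, TangentSpace coneModel q) p :=
    radial_smooth.mdiffAt p
  have hcr : ∀ c : ℝ, FieldDiffAt (c • radial : Π q : Cone M, TangentSpace coneModel q) p :=
    fun c => mdifferentiableAt_const.smul_section hr
  have hV : FieldDiffAt (a • radial + lift h X) p :=
    mdifferentiableAt_add_section (hcr a) (lift_diffAt h hX)
  have hW : FieldDiffAt (b • radial + lift h Y) p :=
    mdifferentiableAt_add_section (hcr b) (lift_diffAt h hY)
  have hrad : ∀ (q : Cone M) (z : TangentSpace coneModel q), tautological M q ![radial q, z] = 0 := by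
    intro q z
    rw [taut_eq]
    simp only [Matrix.cons_val_zero, Matrix.cons_val_one, dproj_radial]
    exact (congrArg _ (zero_wedge _)).trans (mul_zero _)
  have hrad' : ∀ (q : Cone M) (z : TangentSpace coneModel q),
      tautological M q ![z, radial q] = 0 := fun q z => by rw [taut_swap, hrad, neg_zero]
  have hc : ∀ {c : ℝ} {Z : Π y : M, TangentSpace (𝓡 2) y}, FieldDiffAt Z (proj p) →
      coneConn h D P 1 (c • radial + lift h Z) p u = c • u + (hlift h p (D Z (proj p) (dproj p u)) +
        (eta h p u • lift h Z p - P.form (proj p) (Z (proj p)) (dproj p u) • radial p)) := by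
    intro c Z hZ
    rw [conn_add _ (hcr c) (lift_diffAt h hZ), conn_const_smul _ _ hr, add_apply, smul_apply,
      coneConn_radial, coneConn_lift h D P 1 hZ, one_smul, one_smul]
  have hl : ∀ (z : TangentSpace (𝓡 2) (proj p)) (Z : Π y : M, TangentSpace (𝓡 2) y),
      tautological M p ![hlift h p z, lift h Z p] = component p * wedge z (Z (proj p)) := by
    intro z Z
    rw [taut_eq]
    simp only [Matrix.cons_val_zero, Matrix.cons_val_one, dproj_lift, dproj_hlift]
  have hfun : (fun q => tautological M q ![((a • radial + lift h X :) : Π q : Cone M, TangentSpace coneModel q) q,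
        ((b • radial + lift h Y :) : Π q : Cone M, TangentSpace coneModel q) q]) =
      fun q => tautological M q ![lift h X q, lift h Y q] := by
    ext q
    simp only [Pi.add_apply, Pi.smul_apply, taut_add_left, taut_add_right, taut_smul_left,
      taut_smul_right, hrad, hrad', mul_zero, zero_add]
  have hsub : ∀ (r : ℝ) (x y z : TangentSpace coneModel p), tautological M p ![x - r • y, z] =
      tautological M p ![x, z] - r * tautological M p ![y, z] := by
    intro r x y z
    rw [sub_eq_add_neg, ← neg_smul, taut_add_left, taut_smul_left]; ring
  have hsub' : ∀ (r : ℝ) (x y z : TangentSpace coneModel p), tautological M p ![z, x - r • y] =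
      tautological M p ![z, x] - r * tautological M p ![z, y] := by
    intro r x y z
    rw [sub_eq_add_neg, ← neg_smul, taut_add_right, taut_smul_right]; ring
  have hT := tautLift hD hX hY u
  unfold TautLift at hT
  rw [etaTaut, ← ha, ← hb, hv, hw, covTensor_two _ (taut_isTensorAt p) u hV hW, hfun, hT, hc hX,
    hc hY]
  simp only [Pi.add_apply, Pi.smul_apply, taut_add_left, taut_add_right, taut_smul_left,
    taut_smul_right, hrad, hrad', hsub, hsub', mul_zero, zero_add, hl]
  rw [taut_swap p (lift h X p) (hlift h p _), hl, taut_lift,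
    taut_swap p (lift h Y p) u, taut_swap p (lift h X p) u]
  have := wedge_swap (X (proj p)) (D Y (proj p) (dproj p u))
  rw [this]
  ring

end Taut

end

end AH

namespace Affine

noncomputable section

variable {E : Type*} [NormedAddCommGroup E] [NormedSpace ℝ E] [FiniteDimensional ℝ E]
  [CompleteSpace E] {H : Type*} [TopologicalSpace H] {I : ModelWithCorners ℝ E H}
  {N : Type*} [TopologicalSpace N] [ChartedSpace H N] [IsManifold I ∞ N]

/-! ### Differentials of functions and exterior derivatives -/

section Calculus

variable {f g : N → ℝ} {x : N}

theorem mvfderiv_add (hf : MDiffAt f x) (hg : MDiffAt g x) (u : TangentSpace I x) :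
    mvfderiv I (fun y => f y + g y) x u = mvfderiv I f x u + mvfderiv I g x u :=
  congrArg (fun L : TangentSpace I x →L[ℝ] ℝ => L u) (hf.hasMFDerivAt.add hg.hasMFDerivAt).mfderiv

theorem mvfderiv_sub (hf : MDiffAt f x) (hg : MDiffAt g x) (u : TangentSpace I x) :
    mvfderiv I (fun y => f y - g y) x u = mvfderiv I f x u - mvfderiv I g x u :=
  congrArg (fun L : TangentSpace I x →L[ℝ] ℝ => L u) (hf.hasMFDerivAt.sub hg.hasMFDerivAt).mfderiv

theorem mvfderiv_mul (hf : MDiffAt f x) (hg : MDiffAt g x) (u : TangentSpace I x) :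
    mvfderiv I (fun y => f y * g y) x u = f x * mvfderiv I g x u + g x * mvfderiv I f x u :=
  congrArg (fun L : TangentSpace I x →L[ℝ] ℝ => L u) (hf.hasMFDerivAt.mul hg.hasMFDerivAt).mfderiv

theorem mvfderiv_const_mul (c : ℝ) (hf : MDiffAt f x) (u : TangentSpace I x) :
    mvfderiv I (fun y => c * f y) x u = c * mvfderiv I f x u :=
  congrArg (fun L : TangentSpace I x →L[ℝ] ℝ => L u) (hf.hasMFDerivAt.const_smul c).mfderiv

theorem mvfderiv_comp_real {φ : ℝ → ℝ} {c : ℝ} (hφ : HasDerivAt φ c (f x)) (hf : MDiffAt f x)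
    (u : TangentSpace I x) : mvfderiv I (fun y => φ (f y)) x u = c * mvfderiv I f x u := by
  have h := (hφ.hasFDerivAt.hasMFDerivAt.comp x hf.hasMFDerivAt).mfderiv
  exact (congrArg (fun L : TangentSpace I x →L[ℝ] ℝ => L u) h).trans (mul_comm (_ : ℝ) _)

end Calculus

/-- The exterior derivative of a two-form is the alternation of its covariant derivative with
respect to a torsion-free connection. -/
theorem dTwo_eq {T : Connection I N} (hT : T.torsion = 0) {t : CoTensor I N 2} {x : N}
    (ht : IsTensorAt t x) (hs : ∀ v w, t x ![v, w] = - t x ![w, v]) (v : Fin 3 → TangentSpace I x) :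
    dTwo t x v = covTensor T t x (v 0) ![v 1, v 2] - covTensor T t x (v 1) ![v 0, v 2]
      + covTensor T t x (v 2) ![v 0, v 1] := by
  have h := fun i j k => covTensor_two T ht (v i) (mdiffAt_ext (v j)) (mdiffAt_ext (v k))
  have hb := fun i j => torsionFree_bracket hT (mdiffAt_ext (v i)) (mdiffAt_ext (v j))
  have hadd : ∀ a b c : TangentSpace I x, t x ![a - b, c] = t x ![a, c] - t x ![b, c] := by
    intro a b c
    obtain ⟨m, hm⟩ := ht.multilinear x
    have h1 : ∀ z, t x ![z, c] = m (Function.update ![0, c] 0 z) := fun z => by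
      rw [hm]; exact congrArg _ (by ext1 i; fin_cases i <;> rfl)
    rw [h1, h1, h1, m.map_update_sub]
  simp only [ext_self] at h hb
  rw [dTwo, h 0 1 2, h 1 0 2, h 2 0 1, hb, hb, hb, hadd, hadd, hadd, hs (v 0) (T (ext (v 2)) x (v 1)),
    hs (v 0) (T (ext (v 1)) x (v 2)), hs (v 1) (T (ext (v 2)) x (v 0))]
  ring

end

end Affine

namespace AH

open Affine

noncomputable section

variable {M : Type*} [TopologicalSpace M] [ChartedSpace Plane M] [IsManifold (𝓡 2) ∞ M]

/-! ### The volume form dμ on the cone -/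

section Volume

variable [T2Space M] {h : Metric M} {D : Connection (𝓡 2) M}

/-- The exterior derivative is the alternation of ∇μ for a torsion-free connection. Since ∇μ is
already the alternating form η ∧ μ, the three terms coincide. -/
theorem coneVolume_eq (hD : IsAreaParallel h D) (htor : D.torsion = 0) (P : SymForm M) (p : Cone M)
    (v : Fin 3 → TangentSpace coneModel p) :
    coneVolume M p v = 3 * etaTaut h p (v 0) (v 1) (v 2) := by
  rw [coneVolume, dTwo_eq (coneConn_torsion h D P 1 htor) (taut_isTensorAt p)
    (fun v w => taut_swap p v w), covTensor_taut hD P, covTensor_taut hD P, covTensor_taut hD P]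
  simp only [etaTaut]
  rw [taut_swap p (v 0) (v 2), taut_swap p (v 1) (v 0), taut_swap p (v 2) (v 1)]
  ring

theorem etaTaut_isTensorAt (h : Metric M) (c : ℝ) (p : Cone M) : IsTensorAt
    (fun q v => c * etaTaut h q (v 0) (v 1) (v 2) : CoTensor coneModel (Cone M) 3) p where
  multilinear q := by
    refine ⟨MultilinearMap.mk' (fun v => c * etaTaut h q (v 0) (v 1) (v 2)) ?_ ?_, fun v => rfl⟩
    · intro v i a b
      fin_cases i <;> simp [etaTaut, taut_add_left, taut_add_right] <;> ring
    · intro v i a b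
      fin_cases i <;> simp [etaTaut, taut_smul_left, taut_smul_right] <;> ring
  mdiff V hV := by
    have h1 := fun i => eta_mdiffAt h (hV i)
    have h2 : ∀ i j, MDifferentiableAt coneModel 𝓘(ℝ, ℝ)
        (fun q => tautological M q ![V i q, V j q]) p := by
      intro i j
      refine ((taut_isTensorAt p).mdiff ![V i, V j]
        (fun k => by fin_cases k; exacts [hV i, hV j])).congr_of_eventuallyEq
        (Filter.Eventually.of_forall fun q => ?_)
      exact congrArg _ (by ext1 k; fin_cases k <;> rfl)
    exact mdifferentiableAt_const.mul ((((h1 0).mul (h2 1 2)).add ((h1 1).mul (h2 2 0))).add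
      ((h1 2).mul (h2 0 1)))

/-- This is the identity ∇η = P − η ⊗ η, arranged for substitution. The Hessians of both potentials
rest on it. -/
theorem mvfderiv_eta (P : SymForm M) {V : Π q : Cone M, TangentSpace coneModel q} (p : Cone M)
    (u : TangentSpace coneModel p) : mvfderiv coneModel (fun q => eta h q (V q)) p u =
      eta h p (coneConn h D P 1 V p u) - (eta h p (V p) * eta h p u
        - P.form (proj p) (dproj p (V p)) (dproj p u)) := by
  rw [eta_coneConn]; ring

/-- The left side is an alternating three-form on a plane. -/
theorem wedge_cyclic (l : Plane →L[ℝ] ℝ) (a b c : Plane) :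
    l a * wedge b c + l b * wedge c a + l c * wedge a b = 0 := by
  have hl : ∀ a : Plane, l a = a 0 * l (EuclideanSpace.single 0 1) +
      a 1 * l (EuclideanSpace.single 1 1) := by
    intro a
    rw [← smul_eq_mul, ← smul_eq_mul, ← map_smul, ← map_smul, ← map_add]
    congr 1
    ext i
    fin_cases i <;> simp
  rw [hl a, hl b, hl c]
  simp only [wedge]
  ring

/-- The sum is, up to the factor `component`, a three-form pulled back from the surface M. It is the
only place where P enters the derivative of the volume form. -/
theorem form_taut_cyclic (P : SymForm M) (p : Cone M) (u v w z : TangentSpace coneModel p) :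
    P.form (proj p) (dproj p v) (dproj p u) * tautological M p ![w, z] +
      P.form (proj p) (dproj p w) (dproj p u) * tautological M p ![z, v] +
      P.form (proj p) (dproj p z) (dproj p u) * tautological M p ![v, w] = 0 := by
  have h1 := wedge_cyclic (show Plane →L[ℝ] ℝ from P.form (proj p) (dproj p u)) (dproj p v) (dproj p w)
    (dproj p z)
  simp only [taut_eq, Matrix.cons_val_zero, Matrix.cons_val_one, P.symm (proj p) _ (dproj p u)]
  linear_combination component p * h1

/-- Write ∇_u(η ∧ μ) = (∇_u η) ∧ μ + η ∧ ∇_u μ. The first term is −η(u) η ∧ μ, because P(u, ·) ∧ μ =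
0. In the second, ∇_u μ is η(u)μ − η ∧ ι_u μ, so η ∧ ∇_u μ = η(u) η ∧ μ, and the two cancel. -/
theorem covTensor_etaTaut (hD : IsAreaParallel h D) (P : SymForm M) (c : ℝ) (p : Cone M)
    (u : TangentSpace coneModel p) (v : Fin 3 → TangentSpace coneModel p) :
    covTensor (coneConn h D P 1)
      (fun q v => c * etaTaut h q (v 0) (v 1) (v 2) : CoTensor coneModel (Cone M) 3) p u v = 0 := by
  have hV := fun i => mdiffAt_ext (I := coneModel) (v i)
  have hv : v = ![ext (v 0) p, ext (v 1) p, ext (v 2) p] := by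
    ext1 i; fin_cases i <;> exact (ext_self _).symm
  have h1 := fun i => eta_mdiffAt h (hV i)
  have h2 : ∀ i j, MDifferentiableAt coneModel 𝓘(ℝ, ℝ)
      (fun q => tautological M q ![ext (v i) q, ext (v j) q]) p := by
    intro i j
    refine ((taut_isTensorAt p).mdiff ![ext (v i), ext (v j)]
      (fun k => by fin_cases k; exacts [hV i, hV j])).congr_of_eventuallyEq
      (Filter.Eventually.of_forall fun q => ?_)
    exact congrArg _ (by ext1 k; fin_cases k <;> rfl)
  have h3 : ∀ i j, mvfderiv coneModel (fun q => tautological M q ![ext (v i) q, ext (v j) q]) p u =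
      etaTaut h p u (v i) (v j) + (tautological M p ![coneConn h D P 1 (ext (v i)) p u, v j] +
        tautological M p ![v i, coneConn h D P 1 (ext (v j)) p u]) := by
    intro i j
    have := covTensor_two (coneConn h D P 1) (taut_isTensorAt p) u (hV i) (hV j)
    rw [covTensor_taut hD P] at this
    simp only [ext_self] at this
    linarith
  have h4 : mvfderiv coneModel (fun q => c * etaTaut h q (ext (v 0) q) (ext (v 1) q) (ext (v 2) q)) p u
      = c * ((eta h p (v 0) * mvfderiv coneModel (fun q => tautological M q ![ext (v 1) q, ext (v 2) q]) p u
        + tautological M p ![v 1, v 2] * mvfderiv coneModel (fun q => eta h q (ext (v 0) q)) p u) +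
       (eta h p (v 1) * mvfderiv coneModel (fun q => tautological M q ![ext (v 2) q, ext (v 0) q]) p u
        + tautological M p ![v 2, v 0] * mvfderiv coneModel (fun q => eta h q (ext (v 1) q)) p u) +
       (eta h p (v 2) * mvfderiv coneModel (fun q => tautological M q ![ext (v 0) q, ext (v 1) q]) p u
        + tautological M p ![v 0, v 1] * mvfderiv coneModel (fun q => eta h q (ext (v 2) q)) p u)) := by
    have hp := fun i j k => (h1 i).mul (h2 j k)
    have h6 := fun i j k => mvfderiv_mul (h1 i) (h2 j k) u
    simp only [ext_self] at h6
    have ha := (mvfderiv_add ((hp 0 1 2).add (hp 1 2 0)) (hp 2 0 1) u).trans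
      (congrArg₂ (· + ·) (mvfderiv_add (hp 0 1 2) (hp 1 2 0) u) rfl)
    refine (mvfderiv_const_mul c (((hp 0 1 2).add (hp 1 2 0)).add (hp 2 0 1)) u).trans
      (congrArg (c * ·) (ha.trans ?_))
    exact congrArg₂ (· + ·) (congrArg₂ (· + ·) (h6 0 1 2) (h6 1 2 0)) (h6 2 0 1)
  have h5 := fun i => mvfderiv_eta (h := h) (D := D) P (V := ext (v i)) p u
  rw [hv, covTensor_three _ (etaTaut_isTensorAt h c p) u (hV 0) (hV 1) (hV 2)]
  simp only [Matrix.cons_val_zero, Matrix.cons_val_one, Matrix.cons_val]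
  rw [h4, h3, h3, h3, h5, h5, h5]
  simp only [ext_self, etaTaut]
  have h6 := form_taut_cyclic P p u (v 0) (v 1) (v 2)
  have h7 := fun i => taut_swap p u (v i)
  rw [h7, h7, h7]
  linear_combination c * h6

end Volume

end

end AH

namespace AH

open Affine

noncomputable section

variable {M : Type*} [TopologicalSpace M] [ChartedSpace Plane M] [IsManifold (𝓡 2) ∞ M]

/-! ### Existence of the Thomas connection -/

section Thomas

variable [T2Space M]

theorem trace_zero (p : Cone M) : trace (fun _ : TangentSpace coneModel p =>
    (0 : TangentSpace coneModel p)) = 0 :=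
  Finset.sum_eq_zero fun i _ => map_zero ((Module.finBasis ℝ (Plane × ℝ)).coord i)

/-- The cone connection is the Thomas connection when `P` is the Schouten tensor. -/
theorem isThomas_coneConn {h : Metric M} {D : TorsionFree M} (hD : IsAreaParallel h D.conn)
    {P : SymForm M} (hP : P.IsCodazzi D.conn)
    (hR : ∀ x u v w, riemann D.conn x u v w = P.form x v w • u - P.form x u w • v) :
    IsThomas (Quotient.mk _ D) (coneConn h D.conn P 1) := by
  have hflat : IsFlat (coneConn h D.conn P 1) :=
    IsConeLike.isFlat (coneConn_isConeLike h P D.smooth D.torsion_eq) D.smooth D.torsion_eq hP hR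
  refine ⟨coneConn_smooth h D.conn P 1 D.smooth, hflat.1, fun p v => ?_, fun p u v => ?_,
    fun p v w => ?_, fun r Y hY p v => coneConn_invariant h D.conn P 1 r hY p v,
    fun B hB X hX x h0 hgeo Y Z hY hZ hYX hZX p hp => ?_, fun p a b c => ?_⟩
  · rw [coneConn_radial, one_smul]
  · have : (coneVolume M : CoTensor coneModel (Cone M) 3) =
        fun q v => 3 * etaTaut h q (v 0) (v 1) (v 2) := by
      funext q v
      exact coneVolume_eq hD D.torsion_eq P q v
    rw [this]
    exact covTensor_etaTaut hD P 3 p u v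
  · have : (fun u => riemann (coneConn h D.conn P 1) p u v w) = fun _ => 0 :=
      funext fun u => hflat.2 p u v w
    rw [ric, this, trace_zero]
  · subst hp
    exact coneConn_geodesic h D.conn P 1 hX h0 (ProjEquiv.geodesic (Quotient.exact hB) hX hgeo)
      (hZ.mdiffAt p) hYX hZX
  · have : (fun q => covRiemann (coneConn h D.conn P 1) p q a b c) = fun _ => 0 :=
      funext fun u => covRiemann_eq_zero_of_flat hflat.2 p u a b c
    rw [this, trace_zero]

end Thomas

/-! ### The trace of the covariant derivative of the metric -/

section DetDerivative

variable {h : Metric M} {D : TorsionFree M}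

theorem mvfderiv_inner {x : M} (u : TangentSpace (𝓡 2) x) {X Y : Π y : M, TangentSpace (𝓡 2) y}
    (hX : FieldDiffAt X x) (hY : FieldDiffAt Y x) :
    mvfderiv (𝓡 2) (fun y => h.inner y (X y) (Y y)) x u = nablaMetric D h x u (X x) (Y x)
      + h.inner x (D.conn X x u) (Y x) + h.inner x (X x) (D.conn Y x u) := by
  have := covTensor_two D.conn (metricTensor_isTensorAt h x) u hX hY
  rw [nablaMetric, this]
  simp only [metricTensor, Matrix.cons_val_zero, Matrix.cons_val_one]
  ring

theorem mvfderiv_det_tensor (hD : IsAreaParallel h D.conn) {x : M} (u : TangentSpace (𝓡 2) x)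
    {A B C E : Π y : M, TangentSpace (𝓡 2) y} (hA : FieldDiffAt A x) (hB : FieldDiffAt B x)
    (hC : FieldDiffAt C x) (hE : FieldDiffAt E x) :
    mvfderiv (𝓡 2) (fun y => detTensor h y ![A y, B y, C y, E y]) x u =
      detTensor h x ![D.conn A x u, B x, C x, E x] + detTensor h x ![A x, D.conn B x u, C x, E x] +
      detTensor h x ![A x, B x, D.conn C x u, E x] + detTensor h x ![A x, B x, C x, D.conn E x u] := by
  have h1 := covTensor_four D.conn (detTensor_isTensorAt h x) u hA hB hC hE
  rw [hD, eq_comm, sub_eq_zero] at h1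
  exact h1

theorem detTensor_mdiffAt {x : M} {A B C E : Π y : M, TangentSpace (𝓡 2) y} (hA : FieldDiffAt A x)
    (hB : FieldDiffAt B x) (hC : FieldDiffAt C x) (hE : FieldDiffAt E x) :
    MDifferentiableAt (𝓡 2) 𝓘(ℝ, ℝ) (fun y => detTensor h y ![A y, B y, C y, E y]) x :=
  ((inner_mdiffAt h hA hC).mul (inner_mdiffAt h hB hE)).sub
    ((inner_mdiffAt h hA hE).mul (inner_mdiffAt h hB hC))

/-- The area form being parallel, the trace of `∇h` vanishes. -/
theorem faradayPrimitive_eq_zero (hD : IsAreaParallel h D.conn) (x : M)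
    (u : TangentSpace (𝓡 2) x) : faradayPrimitive D h x u = 0 := by
  have hF := fun i => frame_mdiffAt x i
  have h1 := fun i j => mvfderiv_inner (h := h) (D := D) u (hF i) (hF j)
  -- The function det h of the coordinate frame is differentiated twice over: here by parallelism of
  -- det h, in `h3` by the product rule for the entries of h. The terms with derivatives of the
  -- frame agree, and what remains is the determinant times the trace of ∇h.
  have h2 := mvfderiv_det_tensor hD u (hF 0) (hF 1) (hF 0) (hF 1)
  have h3 : mvfderiv (𝓡 2) (fun y => detTensor h y ![frame x 0 y, frame x 1 y, frame x 0 y, frame x 1 y])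
      x u = _ := (mvfderiv_sub ((inner_mdiffAt h (hF 0) (hF 0)).mul (inner_mdiffAt h (hF 1) (hF 1)))
        ((inner_mdiffAt h (hF 0) (hF 1)).mul (inner_mdiffAt h (hF 1) (hF 0))) u).trans
      (congrArg₂ (· - ·) (mvfderiv_mul (inner_mdiffAt h (hF 0) (hF 0)) (inner_mdiffAt h (hF 1) (hF 1)) u)
      (mvfderiv_mul (inner_mdiffAt h (hF 0) (hF 1)) (inner_mdiffAt h (hF 1) (hF 0)) u))
  rw [h2] at h3
  simp only [h1, detTensor, frame_self, Matrix.cons_val_zero, Matrix.cons_val_one, Matrix.cons_val]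
    at h3
  rw [faradayPrimitive, trH]
  simp only [Fin.sum_univ_two, Matrix.inv_def, Matrix.adjugate_fin_two, Ring.inverse_eq_inv',
    Matrix.smul_apply, Matrix.of_apply, smul_eq_mul, Matrix.cons_val_zero, Matrix.cons_val_one,
    Matrix.cons_val', Matrix.empty_val', Matrix.cons_val_fin_one]
  simp only [gram, Matrix.of_apply]
  rw [← sub_eq_zero] at h3
  have key : h.inner x (e x 1) (e x 1) * nablaMetric D h x u (e x 0) (e x 0)
      - h.inner x (e x 0) (e x 1) * nablaMetric D h x u (e x 0) (e x 1)
      - h.inner x (e x 1) (e x 0) * nablaMetric D h x u (e x 1) (e x 0)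
      + h.inner x (e x 0) (e x 0) * nablaMetric D h x u (e x 1) (e x 1) = 0 := by
    have hs : ∀ i j, h.inner x (e x i) (D.conn (frame x j) x u) =
        h.inner x (D.conn (frame x j) x u) (e x i) := fun i j => h.symm x _ _
    rw [h.symm x (e x 1) (e x 0)] at h3 ⊢
    simp only [hs] at h3
    linear_combination -h3
  linear_combination (1 / 4) * (Matrix.of fun i j => h.inner x (e x i) (e x j)).det⁻¹ * key

end DetDerivative

end

end AH

namespace AH

open Affine

noncomputable section

variable {M : Type*} [TopologicalSpace M] [ChartedSpace Plane M] [IsManifold (𝓡 2) ∞ M]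

/-! ### Curvature of an area preserving connection on a surface -/

section Curvature

variable [T2Space M] {h : Metric M} {D : TorsionFree M}

/-- The curvature of an area preserving connection is trace-free. -/
theorem curv_wedge (hD : IsAreaParallel h D.conn) {U V X Y : Π y : M, TangentSpace (𝓡 2) y}
    (hU : IsSmoothField U) (hV : IsSmoothField V) (hX : IsSmoothField X) (hY : IsSmoothField Y)
    {x : M} (h0 : wedge (X x) (Y x) ≠ 0) :
    wedge (curv D.conn U V X x) (Y x) + wedge (X x) (curv D.conn U V Y x) = 0 := by
  have hf := detTensor_smooth h hX hY
  -- The commutator of U and V acting on det h(X, Y; X, Y) is computed by parallelism on both sides.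
  -- First-order products cancel by symmetry in U and V, and the second-order terms assemble into
  -- the curvature. The function is quadratic in X ∧ Y, hence the nonzero factor divided out at the
  -- end.
  have hb := mvfderiv_bracket hU hV hf x
  have hal : ∀ {A B : Π y : M, TangentSpace (𝓡 2) y}, IsSmoothField A → IsSmoothField B → ∀ y,
      FieldDiffAt (along D.conn A B) y := fun hA hB y => (along_smooth D.smooth hA hB).mdiffAt y
  have h1 : ∀ {A : Π y : M, TangentSpace (𝓡 2) y}, IsSmoothField A → (fun y =>
      mvfderiv (𝓡 2) (fun z => detTensor h z ![X z, Y z, X z, Y z]) y (A y)) = fun y =>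
      detTensor h y ![along D.conn A X y, Y y, X y, Y y] +
      detTensor h y ![X y, along D.conn A Y y, X y, Y y] +
      detTensor h y ![X y, Y y, along D.conn A X y, Y y] +
      detTensor h y ![X y, Y y, X y, along D.conn A Y y] := fun hA => funext fun y =>
    mvfderiv_det_tensor hD _ (hX.mdiffAt y) (hY.mdiffAt y) (hX.mdiffAt y) (hY.mdiffAt y)
  have hXd := hX.mdiffAt x
  have hYd := hY.mdiffAt x
  have h2 := fun (A : Π y : M, TangentSpace (𝓡 2) y) (hA : IsSmoothField A)
      (u : TangentSpace (𝓡 2) x) =>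
    have hAX := hal hA hX x
    have hAY := hal hA hY x
    have m1 := detTensor_mdiffAt (h := h) hAX hYd hXd hYd
    have m2 := detTensor_mdiffAt (h := h) hXd hAY hXd hYd
    have m3 := detTensor_mdiffAt (h := h) hXd hYd hAX hYd
    have m4 := detTensor_mdiffAt (h := h) hXd hYd hXd hAY
    (mvfderiv_add ((m1.add m2).add m3) m4 u).trans (congrArg₂ (· + ·)
      ((mvfderiv_add (m1.add m2) m3 u).trans (congrArg₂ (· + ·) ((mvfderiv_add m1 m2 u).trans
        (congrArg₂ (· + ·) (mvfderiv_det_tensor hD u hAX hYd hXd hYd)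
        (mvfderiv_det_tensor hD u hXd hAY hXd hYd)))
        (mvfderiv_det_tensor hD u hXd hYd hAX hYd))) (mvfderiv_det_tensor hD u hXd hYd hXd hAY))
  rw [h1 hU, h1 hV, mvfderiv_det_tensor hD _ hXd hYd hXd hYd] at hb
  replace hb := hb.trans (congrArg₂ (· - ·) (h2 V hV (U x)) (h2 U hU (V x)))
  have hsub : ∀ a b c d : Plane, wedge (a - b - c) d = wedge a d - wedge b d - wedge c d := by
    intro a b c d
    simp only [wedge, PiLp.sub_apply]; ring
  have hsub' : ∀ a b c d : Plane, wedge d (a - b - c) = wedge d a - wedge d b - wedge d c := by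
    intro a b c d
    simp only [wedge, PiLp.sub_apply]; ring
  have e1 : wedge (curv D.conn U V X x) (Y x) = _ := hsub _ _ _ _
  have e2 : wedge (X x) (curv D.conn U V Y x) = _ := hsub' _ _ _ _
  rw [e1, e2]
  simp only [detTensor_apply, Matrix.cons_val_zero, Matrix.cons_val_one, Matrix.cons_val,
    along_apply] at hb
  have hg := (gram_det_pos h x).ne'
  refine (mul_eq_zero.1 ?_).resolve_left (mul_ne_zero hg h0)
  linear_combination (-1/2) * hb

/-- In dimension two the curvature is determined by the Ricci tensor. -/
theorem riemann_eq_ric (D : TorsionFree M) (x : M) (u v w : TangentSpace (𝓡 2) x) :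
    riemann D.conn x u v w = ric D.conn x v w • u - ric D.conn x u w • v ∧
    ric D.conn x v w = wedge (riemann D.conn x (e x 0) (e x 1) w) v := by
  have hs := D.smooth
  set A := riemann D.conn x (e x 0) (e x 1) w with hA
  have h0 : ∀ u, riemann D.conn x u u w = 0 := fun u => by
    have := riemann_swap hs x u u w
    have h2 : (2 : ℝ) • riemann D.conn x u u w = 0 := by
      rw [two_smul]
      nth_rewrite 1 [this]
      exact neg_add_cancel _
    exact (smul_eq_zero.1 h2).resolve_left two_ne_zero
  -- An alternating bilinear map on a plane is determined by its value on a basis.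
  have hR : ∀ u v, riemann D.conn x u v w = wedge u v • A := by
    intro u v
    conv_lhs => rw [e_sum x u, e_sum x v]
    simp only [riemann_add_left hs, riemann_add_mid hs, riemann_smul_left hs, riemann_smul_mid hs, h0]
    rw [riemann_swap hs x (e x 1) (e x 0), ← hA]
    unfold wedge
    module
  have hric : ∀ v, ric D.conn x v w = wedge A v := by
    intro v
    have hlin : IsLinearMap ℝ (fun u => riemann D.conn x u v w) :=
      ⟨fun _ _ => riemann_add_left hs _ _ _ _, fun _ _ => riemann_smul_left hs _ _ _ _⟩
    rw [ric, trace_eq_sum hlin (e x) (fun j => (coord x j x).toLinearMap) fun z => by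
      rw [Fin.sum_univ_two]
      simp only [ContinuousLinearMap.coe_coe, coord_self]
      exact e_sum x z]
    simp only [hR, Fin.sum_univ_two, map_smul, ContinuousLinearMap.coe_coe, coord_self, smul_eq_mul]
    simp [wedge, e]
    ring
  refine ⟨?_, hric v⟩
  rw [hR, hric, hric]
  -- The linear relation among three vectors of a plane, by Cramer's rule.
  have : ∀ a u v : Plane, wedge u v • a = wedge a v • u - wedge a u • v := by
    intro a u v
    ext i
    fin_cases i <;> simp [wedge] <;> ring
  exact this _ _ _

/-- With A_w = R(e₀, e₁)w one has Ric(v, w) = A_w ∧ v. The endomorphism w ↦ A_w is trace-free by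
`curv_wedge`, that is, skew with respect to the area form, so the expression is symmetric. -/
theorem ric_symm (hD : IsAreaParallel h D.conn) (x : M) (v w : TangentSpace (𝓡 2) x) :
    ric D.conn x v w = ric D.conn x w v := by
  obtain ⟨U, hU, hUx⟩ := exists_smoothField_apply (e x 0)
  obtain ⟨V, hV, hVx⟩ := exists_smoothField_apply (e x 1)
  have h1 := curv_wedge hD hU hV hU hV (x := x) (by rw [hUx, hVx]; simp [wedge, e])
  rw [← riemann_apply D.smooth hU hV hU, ← riemann_apply D.smooth hU hV hV, hUx, hVx] at h1
  rw [(riemann_eq_ric D x v v w).2, (riemann_eq_ric D x w w v).2]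
  have h2 : ∀ w, riemann D.conn x (e x 0) (e x 1) w =
      (show Plane from w) 0 • riemann D.conn x (e x 0) (e x 1) (e x 0) +
      (show Plane from w) 1 • riemann D.conn x (e x 0) (e x 1) (e x 1) := by
    intro w
    conv_lhs => rw [e_sum x w]
    rw [riemann_add_right D.smooth, riemann_smul_right D.smooth, riemann_smul_right D.smooth]
  have h3 : ∀ B C v w : Plane, wedge B (EuclideanSpace.single 1 1) +
      wedge (EuclideanSpace.single 0 1) C = 0 →
      wedge (w 0 • B + w 1 • C) v = wedge (v 0 • B + v 1 • C) w := by
    intro B C v w hBC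
    simp [wedge] at hBC ⊢
    linear_combination (w 0 * v 1 - w 1 * v 0) * hBC
  rw [h2 w, h2 v]
  exact h3 _ _ _ _ h1

end Curvature

end

end AH

/-! ### Surfaces with totally symmetric ∇h and curvature of constant type -/

namespace AH

open Affine

noncomputable section

variable {M : Type*} [TopologicalSpace M] [ChartedSpace Plane M] [IsManifold (𝓡 2) ∞ M]

/-- The local geometry of an exact Einstein AH structure of negative scalar curvature: `∇` preserves
the area form of `h`, `∇h` is totally symmetric, and the curvature of `∇` is that of a metric
of constant negative curvature. -/
structure IsSpecial (D : TorsionFree M) (h : Metric M) (κ : M → ℝ) : Prop where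
  area : IsAreaParallel h D.conn
  codazzi : ∀ x u v w, nablaMetric D h x u v w = nablaMetric D h x v u w
  curvature : ∀ x u v w, riemann D.conn x u v w =
    (κ x * h.inner x v w) • u - (κ x * h.inner x u w) • v
  smooth : ContMDiff (𝓡 2) 𝓘(ℝ, ℝ) ∞ κ
  mvfderiv_eq : ∀ x, mvfderiv (𝓡 2) κ x = 0
  neg : ∀ x, κ x < 0

theorem nablaMetric_swap (D : TorsionFree M) (h : Metric M) (x : M) (u v w : TangentSpace (𝓡 2) x) :
    nablaMetric D h x u v w = nablaMetric D h x u w v := by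
  have h1 := mvfderiv_inner (h := h) (D := D) u (mdiffAt_ext v) (mdiffAt_ext w)
  have h2 := mvfderiv_inner (h := h) (D := D) u (mdiffAt_ext w) (mdiffAt_ext v)
  have h3 : (fun y => h.inner y (ext v y) (ext w y)) = fun y => h.inner y (ext w y) (ext v y) :=
    funext fun y => h.symm y _ _
  rw [h3, h2] at h1
  simp only [ext_self] at h1
  rw [h.symm x (D.conn (ext w) x u), h.symm x w] at h1
  linarith

/-- The form `κ h`. -/
def schouten (h : Metric M) {κ : M → ℝ} (hκ : ContMDiff (𝓡 2) 𝓘(ℝ, ℝ) ∞ κ) : SymForm M where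
  form x := κ x • h.inner x
  symm x v w := by simp only [smul_apply, h.symm x v w]
  smooth X Y hX hY := hκ.mul fun x => inner_smoothAt h (hX x) (hY x)

theorem schouten_apply (h : Metric M) {κ : M → ℝ} (hκ : ContMDiff (𝓡 2) 𝓘(ℝ, ℝ) ∞ κ) (x : M)
    (v w : TangentSpace (𝓡 2) x) : (schouten h hκ).form x v w = κ x * h.inner x v w := rfl

section Special

variable [T2Space M] {D : TorsionFree M} {h : Metric M} {κ : M → ℝ} (hs : IsSpecial D h κ)

-- As dκ = 0, the covariant derivative of κh is κ∇h, which is totally symmetric by assumption.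
include hs in
theorem IsSpecial.schouten_codazzi : (schouten h hs.smooth).IsCodazzi D.conn := by
  intro X Y Z hX hY hZ x
  have h1 : ∀ {A B : Π y : M, TangentSpace (𝓡 2) y}, IsSmoothField A → IsSmoothField B →
      ∀ u, mvfderiv (𝓡 2) (fun y => (schouten h hs.smooth).form y (A y) (B y)) x u =
        κ x * (nablaMetric D h x u (A x) (B x)
      + h.inner x (D.conn A x u) (B x) + h.inner x (A x) (D.conn B x u)) := by
    intro A B hA hB u
    refine (mvfderiv_mul (smooth_mdiffAt hs.smooth x)
      (inner_mdiffAt h (hA.mdiffAt x) (hB.mdiffAt x)) u).trans ?_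
    rw [hs.mvfderiv_eq, mvfderiv_inner u (hA.mdiffAt x) (hB.mdiffAt x), zero_apply, mul_zero,
      add_zero]
  rw [h1 hZ hY, h1 hZ hX, nablaMetric_swap, hs.codazzi, nablaMetric_swap D h x (Y x)]
  simp only [schouten_apply]
  ring

include hs in
theorem IsSpecial.isThomas :
    IsThomas (Quotient.mk _ D) (coneConn h D.conn (schouten h hs.smooth) 1) :=
  isThomas_coneConn hs.area hs.schouten_codazzi fun x u v w => hs.curvature x u v w

end Special

/-! ### Consequences of exactness and the Einstein equations -/

section Einstein

variable [T2Space M] {D : TorsionFree M} {h : Metric M}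

/-- The function κ is recovered as a quotient of smooth functions, h(R(E₀, E₁)E₁, E₀) divided by det
h on a smooth frame. -/
theorem contMDiff_of_curvature {κ : M → ℝ} (hc : ∀ x u v w, riemann D.conn x u v w =
    (κ x * h.inner x v w) • u - (κ x * h.inner x u w) • v) :
    ContMDiff (𝓡 2) 𝓘(ℝ, ℝ) ∞ κ := by
  intro x
  obtain ⟨E, hE, hEe⟩ := exists_smooth_frame_eq x
  have h0 : ∀ y, h.inner y (curv D.conn (E 0) (E 1) (E 1) y) (E 0 y) =
      κ y * detTensor h y ![E 0 y, E 1 y, E 0 y, E 1 y] := by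
    intro y
    rw [← riemann_apply D.smooth (hE 0) (hE 1) (hE 1), hc]
    simp only [map_sub, map_smul, sub_apply, smul_apply, smul_eq_mul, detTensor,
      Matrix.cons_val_zero, Matrix.cons_val_one, Matrix.cons_val]
    rw [h.symm y (E 1 y) (E 0 y)]
    ring
  have hsm : IsSmoothField (curv D.conn (E 0) (E 1) (E 1)) := by
    have h1 := along_smooth D.smooth (hE 0) (along_smooth D.smooth (hE 1) (hE 1))
    have h2 := along_smooth D.smooth (hE 1) (along_smooth D.smooth (hE 0) (hE 1))
    have h3 := along_smooth D.smooth (bracket_smooth (hE 0) (hE 1)) (hE 1)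
    exact (h1.sub h2).sub h3
  have hd : detTensor h x ![E 0 x, E 1 x, E 0 x, E 1 x] ≠ 0 := by
    have he := hEe.self_of_nhds
    rw [he, he, frame_self, frame_self, detTensor_apply]
    refine mul_ne_zero (gram_det_pos h x).ne' ?_
    simp [wedge, e]
  have hds := detTensor_smooth h (hE 0) (hE 1)
  have hq := (inner_smoothAt h (hsm x) (hE 0 x)).div₀ (hds x) hd
  refine hq.congr_of_eventuallyEq ?_
  filter_upwards [hds.continuous.continuousAt.eventually_ne hd] with y hy
  exact (mul_div_cancel_right₀ _ hy).symm.trans (congrArg (· / _) (h0 y).symm)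

/-- A parallel area form makes the Faraday primitive zero and Ric symmetric, hence also the Faraday
form zero. The trace-free Einstein equation then gives Ric = κh, the second one gives d scal = 0,
and alignment becomes the total symmetry of ∇h. -/
theorem isSpecial_of_isEinstein {A : Structure M} (heinstein : A.IsEinstein)
    (hneg : A.HasNegativeScalar) (hD : A.IsAligned D)
    (hh : (Quotient.mk _ h : ConformalStructure M) = A.conf) (hpar : IsAreaParallel h D.conn) :
    IsSpecial D h (fun x => scal D h x / 2) := by
  obtain ⟨h1, h2⟩ := heinstein D h hD hh
  have hric : ∀ x v w, ric D.conn x v w = scal D h x / 2 * h.inner x v w := fun x v w => by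
    rw [← h1, ric_symm hpar x w v]; ring
  have hcurv : ∀ x u v w, riemann D.conn x u v w =
    (scal D h x / 2 * h.inner x v w) • u - (scal D h x / 2 * h.inner x u w) • v := fun x u v w => by
    rw [← hric, ← hric]
    exact (riemann_eq_ric D x u v w).1
  have hsm := contMDiff_of_curvature hcurv
  have hfar : faraday D = fun _ _ => 0 := by
    funext x v
    rw [faraday, ric_symm hpar x (v 1) (v 0)]
    simp
  have hd : ∀ x u, mvfderiv (𝓡 2) (scal D h) x u = 0 := by
    intro x u
    have h3 := h2 x u
    have h4 : ∀ p q, covTensor D.conn (faraday D) x p ![u, q] = 0 := by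
      intro p q
      rw [hfar, covTensor]
      simp [mvfderiv_const]
    simp only [h4, faradayPrimitive_eq_zero hpar] at h3
    simpa [trH] using h3
  refine ⟨hpar, fun x u v w => ?_, hcurv, hsm, fun x => ?_, fun x => ?_⟩
  · have := hD.2 h hh x u v w
    rw [faradayPrimitive_eq_zero hpar, faradayPrimitive_eq_zero hpar] at this
    linarith
  · ext u
    have h5 : MDifferentiableAt (𝓡 2) 𝓘(ℝ, ℝ) (scal D h) x := by
      have := (hsm.mul (contMDiff_const (c := (2 : ℝ)))) x
      refine smoothAt_mdiffAt (this.congr_of_eventuallyEq (Filter.Eventually.of_forall fun y => ?_))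
      exact (div_mul_cancel₀ _ two_ne_zero).symm
    have h6 := mvfderiv_const_mul (1 / 2) h5 u
    rw [hd, mul_zero] at h6
    have h7 : (fun y => scal D h y / 2) = fun y => 1 / 2 * scal D h y := by ext y; ring
    rw [h7, h6, zero_apply]
  · have := hneg D h hD hh x
    linarith

/-! ### The aligned representative is unique -/

theorem trH_eq (h : Metric M) (x : M) (B : TangentSpace (𝓡 2) x → TangentSpace (𝓡 2) x → ℝ) :
    trH h x B = (gram h x).det⁻¹ * (h.inner x (e x 1) (e x 1) * B (e x 0) (e x 0)
      - h.inner x (e x 0) (e x 1) * (B (e x 0) (e x 1) + B (e x 1) (e x 0))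
      + h.inner x (e x 0) (e x 0) * B (e x 1) (e x 1)) := by
  rw [trH]
  simp only [Fin.sum_univ_two, Matrix.inv_def, Matrix.adjugate_fin_two, Ring.inverse_eq_inv',
    Matrix.smul_apply, Matrix.of_apply, smul_eq_mul, Matrix.cons_val_zero, Matrix.cons_val_one,
    Matrix.cons_val', Matrix.empty_val', Matrix.cons_val_fin_one]
  have h1 : ∀ i j, gram h x i j = h.inner x (e x i) (e x j) := fun i j => rfl
  simp only [h1, h.symm x (e x 1) (e x 0)]
  ring

theorem trH_add (h : Metric M) (x : M) (B C : TangentSpace (𝓡 2) x → TangentSpace (𝓡 2) x → ℝ) :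
    trH h x (fun v w => B v w + C v w) = trH h x B + trH h x C := by
  simp only [trH_eq]
  ring

/-- The metric has trace 2, so the first term contributes 4γ(u), and each of the other two
contributes γ(u). -/
theorem trH_inner (h : Metric M) (x : M) (γ : TangentSpace (𝓡 2) x →ₗ[ℝ] ℝ)
    (u : TangentSpace (𝓡 2) x) : trH h x (fun v w => 2 * γ u * h.inner x v w +
      (γ v * h.inner x u w + γ w * h.inner x u v)) = 6 * γ u := by
  have hγ : γ u = (show Plane from u) 0 * γ (e x 0) + (show Plane from u) 1 * γ (e x 1) := by
    conv_lhs => rw [e_sum x u]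
    simp only [map_add, map_smul, smul_eq_mul]
  have hu : ∀ j, h.inner x u (e x j) = (show Plane from u) 0 * h.inner x (e x 0) (e x j) +
      (show Plane from u) 1 * h.inner x (e x 1) (e x j) := by
    intro j
    conv_lhs => rw [e_sum x u]
    simp only [map_add, map_smul, smul_eq_mul, add_apply, smul_apply]
  have hd := (gram_det_pos h x).ne'
  rw [trH_eq, inv_mul_eq_iff_eq_mul₀ hd]
  rw [gram_det] at hd ⊢
  rw [hγ, hu, hu, h.symm x (e x 1) (e x 0)]
  ring

/-- Let γ be the one-form relating the two connections. The skew part of ∇'h computed from the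
difference tensor is γ_u h_vw − γ_v h_uw, whereas alignment of D' with Faraday primitive (3/2)γ asks
for three times this. Hence γ_u h_vw is symmetric in u and v, which on a surface forces γ = 0. -/
theorem agree_of_aligned {D' : TorsionFree M} (hp : ProjEquiv D' D) (hD' : AlignedWith D' h)
    (hpar : IsAreaParallel h D.conn) (hD : AlignedWith D h) : Agree D.conn D'.conn := by
  obtain ⟨γ, hγ⟩ := hp
  have h1 : ∀ x u v w, nablaMetric D' h x u v w = nablaMetric D h x u v w
      + 2 * γ x u * h.inner x v w + γ x v * h.inner x u w + γ x w * h.inner x u v := by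
    intro x u v w
    have e1 := mvfderiv_inner (h := h) (D := D) u (mdiffAt_ext v) (mdiffAt_ext w)
    have e2 := mvfderiv_inner (h := h) (D := D') u (mdiffAt_ext v) (mdiffAt_ext w)
    rw [e1, hγ _ _ (mdiffAt_ext v), hγ _ _ (mdiffAt_ext w)] at e2
    simp only [ext_self, map_add, map_smul, add_apply, smul_apply, smul_eq_mul, h.symm x v u] at e2
    linarith
  have htr : ∀ x u, faradayPrimitive D' h x u = (3 / 2) * γ x u := by
    intro x u
    have h0 := faradayPrimitive_eq_zero hpar x u
    rw [faradayPrimitive] at h0 ⊢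
    have h4 : (fun v w => nablaMetric D' h x u v w) = fun v w => nablaMetric D h x u v w +
        (2 * γ x u * h.inner x v w + (γ x v * h.inner x u w + γ x w * h.inner x u v)) := by
      funext v w
      rw [h1]; ring
    rw [h4, trH_add, mul_add, h0, trH_inner]
    ring
  have h3 : ∀ x u, γ x u = 0 := by
    intro x u
    have h4 : ∀ u v w, γ x u * h.inner x v w = γ x v * h.inner x u w := by
      intro u v w
      have e1 := hD x u v w
      have e2 := hD' x u v w
      rw [htr, htr, h1, h1, h.symm x v u] at e2
      rw [faradayPrimitive_eq_zero hpar, faradayPrimitive_eq_zero hpar] at e1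
      linarith
    have e1 := h4 (e x 0) (e x 1) (e x 1)
    have e2 := h4 (e x 1) (e x 0) (e x 0)
    have hd := (gram_det_pos h x).ne'
    have hg := gram_det h x
    rw [h.symm x (e x 1) (e x 0)] at e2
    have g0 : γ x (e x 0) = 0 := by
      refine (mul_eq_zero.1 ?_).resolve_right hd
      rw [hg]
      linear_combination h.inner x (e x 0) (e x 0) * e1 + h.inner x (e x 0) (e x 1) * e2
    have g1 : γ x (e x 1) = 0 := by
      refine (mul_eq_zero.1 ?_).resolve_right hd
      rw [hg]
      linear_combination h.inner x (e x 1) (e x 1) * e2 + h.inner x (e x 0) (e x 1) * e1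
    rw [e_sum x u, map_add, map_smul, map_smul, g0, g1, smul_zero, smul_zero, add_zero]
  intro Y x hY
  ext1 u
  rw [hγ Y x hY]
  simp [h3]

/-- Under h ↦ φh the trace of Ric is divided by φ and the area density is multiplied by φ. The Ricci
tensor itself is common to agreeing connections. -/
theorem scalarLift_congr {D' : TorsionFree M} (hDD : Agree D.conn D'.conn) {h' : Metric M}
    (hh : ConfEquiv h h') : scalarLift D' h' = scalarLift D h := by
  obtain ⟨φ, hφ, hh⟩ := hh
  have hric : ∀ x v w, ric D'.conn x v w = ric D.conn x v w := by
    intro x v w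
    have : (fun u => riemann D'.conn x u v w) = fun u => riemann D.conn x u v w :=
      funext fun u => (hDD.riemann D.smooth x u v w).symm
    rw [ric, ric, this]
  ext p
  have hx := hφ (proj p)
  have hdet : (gram h' (proj p)).det = φ (proj p) ^ 2 * (gram h (proj p)).det := by
    rw [gram_det, gram_det, hh, hh, hh]; ring
  have hd := (gram_det_pos h (proj p)).ne'
  have hs : scal D' h' (proj p) = (φ (proj p))⁻¹ * scal D h (proj p) := by
    rw [scal, scal, trH_eq, trH_eq, hdet, hh, hh, hh]
    simp only [hric]
    field_simp
  rw [scalarLift, scalarLift, hs, hdet, Real.sqrt_mul (by positivity), Real.sqrt_sq hx.le]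
  field_simp

end Einstein

end

end AH

/-! ### Difference tensors of connections -/

namespace Affine

noncomputable section

variable {E : Type*} [NormedAddCommGroup E] [NormedSpace ℝ E] [FiniteDimensional ℝ E]
  [CompleteSpace E] {H : Type*} [TopologicalSpace H] {I : ModelWithCorners ℝ E H}
  {N : Type*} [TopologicalSpace N] [ChartedSpace H N] [IsManifold I ∞ N]

/-- The difference tensor of two connections. -/
def diffTensor (T T' : Connection I N) (x : N) :
    TangentSpace I x →L[ℝ] TangentSpace I x →L[ℝ] TangentSpace I x :=
  CovariantDerivative.difference T T' x

theorem diffTensor_apply (T T' : Connection I N) {x : N} {Y : Π y : N, TangentSpace I y}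
    (hY : FieldDiffAt Y x) (u : TangentSpace I x) :
    diffTensor T T' x (Y x) u = T Y x u - T' Y x u :=
  congrArg (fun L : TangentSpace I x →L[ℝ] TangentSpace I x => L u)
    (IsCovariantDerivativeOn.difference_apply T.isCovariantDerivativeOnUniv
      T'.isCovariantDerivativeOnUniv trivial hY)

/-- For torsion-free connections both antisymmetrized derivatives are the Lie bracket. -/
theorem diffTensor_symm {T T' : Connection I N} (hT : T.torsion = 0) (hT' : T'.torsion = 0) (x : N)
    (u v : TangentSpace I x) : diffTensor T T' x u v = diffTensor T T' x v u := by
  have h1 := diffTensor_apply T T' (mdiffAt_ext u) v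
  have h2 := diffTensor_apply T T' (mdiffAt_ext v) u
  have h3 := torsionFree_bracket hT (mdiffAt_ext u) (mdiffAt_ext v)
  have h4 := torsionFree_bracket hT' (mdiffAt_ext u) (mdiffAt_ext v)
  rw [h3] at h4
  simp only [ext_self] at h1 h2 h4
  rw [h1, h2, sub_eq_sub_iff_add_eq_add]
  rw [sub_eq_sub_iff_add_eq_add] at h4
  rw [add_comm, add_comm (T (ext v) x u)]
  rw [h4.symm, add_comm]

end

end Affine

namespace AH

open Affine

noncomputable section

variable {M : Type*} [TopologicalSpace M] [ChartedSpace Plane M] [IsManifold (𝓡 2) ∞ M]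

/-! ### Uniqueness of the Thomas connection -/

section Algebra

theorem wedge_self (a : Plane) : wedge a a = 0 := by simp only [wedge]; ring

/-- A symmetric bilinear map which is trace-free and proportional to the identity on the diagonal
vanishes. -/
theorem eq_zero_of_trace_diagonal (b : Plane →ₗ[ℝ] Plane →ₗ[ℝ] Plane) (hs : ∀ v w, b v w = b w v)
    (hd : ∀ w, wedge (b w w) w = 0)
    (ht : ∀ u, wedge (b u (EuclideanSpace.single 0 1)) (EuclideanSpace.single 1 1) +
      wedge (EuclideanSpace.single 0 1) (b u (EuclideanSpace.single 1 1)) = 0) (v w : Plane) :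
    b v w = 0 := by
  set e0 : Plane := EuclideanSpace.single 0 1 with he0
  set e1 : Plane := EuclideanSpace.single 1 1 with he1
  have h0 := hd e0
  have h1 := hd e1
  -- Polarization: the diagonal condition on e₀ ± e₁ determines b(e₀, e₁) in terms of the diagonal
  -- values, and the two trace conditions then leave only zero.
  have h2 := hd (e0 + e1)
  have h3 := hd (e0 - e1)
  have h4 := ht e0
  have h5 := ht e1
  have hs' := hs e1 e0
  simp only [map_add, map_sub, LinearMap.add_apply, LinearMap.sub_apply, hs', wedge, PiLp.add_apply, PiLp.sub_apply]
    at h0 h1 h2 h3 h4 h5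
  have c00 : e0 0 = 1 := by simp [he0]
  have c01 : e0 1 = 0 := by simp [he0]
  have c10 : e1 0 = 0 := by simp [he1]
  have c11 : e1 1 = 1 := by simp [he1]
  simp only [c00, c01, c10, c11] at h0 h1 h2 h3 h4 h5
  have b00 : b e0 e0 = 0 := by
    ext i; fin_cases i <;> simp <;> linarith
  have b01 : b e0 e1 = 0 := by
    ext i; fin_cases i <;> simp <;> linarith
  have b11 : b e1 e1 = 0 := by
    ext i; fin_cases i <;> simp <;> linarith
  have hv : ∀ v : Plane, v = v 0 • e0 + v 1 • e1 := by
    intro v; ext i; fin_cases i <;> simp [c00, c01, c10, c11]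
  rw [hv v, hv w]
  simp only [map_add, map_smul, LinearMap.add_apply, LinearMap.smul_apply, hs', b00, b01, b11, smul_zero, add_zero]

end Algebra

section Unique

variable [T2Space M]

/-- An arbitrary extension X of w is corrected by −fZ, where f vanishes at x with df(w) = 1 and Z
takes the value D_w X at x. The value at x is unchanged and the derivative along w is cancelled. -/
theorem exists_geodesic_field (D : Connection (𝓡 2) M) {x : M} {w : TangentSpace (𝓡 2) x}
    (hw : w ≠ 0) : ∃ X : Π y : M, TangentSpace (𝓡 2) y, IsSmoothField X ∧ X x = w ∧ D X x w = 0 := by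
  obtain ⟨X, hX, hXx⟩ := exists_smoothField_apply w
  obtain ⟨Z, hZ, hZx⟩ := exists_smoothField_apply (D X x w)
  obtain ⟨f, hf, hf0, hf1⟩ := exists_smooth_mvfderiv_eq_one hw
  refine ⟨X - f • Z, hX.sub (hZ.smul hf), ?_, ?_⟩
  · rw [Pi.sub_apply, Pi.smul_apply', hf0, zero_smul, sub_zero, hXx]
  · rw [conn_sub D (hX.mdiffAt x) ((hZ.smul hf).mdiffAt x), sub_apply,
      conn_smul D (smooth_mdiffAt hf x) (hZ.mdiffAt x), hf0, hf1, hZx]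
    simp

variable {D : TorsionFree M} {h : Metric M} {P : SymForm M} {T : Connection coneModel (Cone M)}

/-- The difference from the model connection kills 𝕏, so its projection is a symmetric bilinear map
on the tangent plane of M. It is trace-free because both connections preserve the volume, and maps
(w, w) into the line of w because both respect geodesics. Hence `eq_zero_of_trace_diagonal` applies.
-/
theorem dproj_diffTensor (hpar : IsAreaParallel h D.conn) (hT : IsThomas (Quotient.mk _ D) T)
    (p : Cone M) (u v : TangentSpace coneModel p) :
    dproj p (diffTensor T (coneConn h D.conn P 1) p u v) = 0 := by
  set T0 := coneConn h D.conn P 1 with hT0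
  have htor0 : T0.torsion = 0 := coneConn_torsion h D.conn P 1 D.torsion_eq
  set a := diffTensor T T0 p with ha
  have hsym : ∀ u v, a u v = a v u := diffTensor_symm hT.torsion_eq htor0 p
  have hrad : ∀ u, a (radial p) u = 0 := fun u => by
    have := diffTensor_apply T T0 (radial_smooth.mdiffAt p) u
    rw [ha, this, hT.radial_eq, hT0, coneConn_radial, one_smul, sub_self]
  -- preservation of the volume form
  have hvol : ∀ u : TangentSpace coneModel p, ∀ v w : TangentSpace coneModel p,
      tautological M p ![a v u, w] + tautological M p ![v, a w u] = 0 := by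
    intro u v w
    have hvt : (coneVolume M : CoTensor coneModel (Cone M) 3) =
        fun q v => 3 * etaTaut h q (v 0) (v 1) (v 2) := by
      funext q v
      exact coneVolume_eq hpar D.torsion_eq P q v
    -- With 𝕏 in the first slot the volume form reduces to 3μ, and both connections have the same
    -- derivative of 𝕏. The difference of the two equations is the trace condition for the
    -- difference tensor.
    have h1 := hT.volume_parallel p u ![radial p, v, w]
    have h2 := covTensor_etaTaut hpar P 3 p u ![radial p, v, w]
    rw [hvt] at h1
    have hr := radial_smooth.mdiffAt p
    have h3 := covTensor_three T (etaTaut_isTensorAt h 3 p) u hr (mdiffAt_ext v) (mdiffAt_ext w)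
    have h4 := covTensor_three T0 (etaTaut_isTensorAt h 3 p) u hr (mdiffAt_ext v) (mdiffAt_ext w)
    have a1 := diffTensor_apply T T0 (mdiffAt_ext v) u
    have a2 := diffTensor_apply T T0 (mdiffAt_ext w) u
    simp only [ext_self] at h3 h4 a1 a2
    rw [h1] at h3
    rw [h2] at h4
    have hE : ∀ x y, etaTaut h p (radial p) x y = tautological M p ![x, y] := by
      intro x y
      have h5 : ∀ z, tautological M p ![radial p, z] = 0 := fun z => by
        rw [taut_eq]
        simp only [Matrix.cons_val_zero, Matrix.cons_val_one, dproj_radial]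
        exact (congrArg _ (zero_wedge _)).trans (mul_zero _)
      rw [etaTaut, eta_radial, taut_swap p y, h5, h5]
      ring
    have b1 : T (ext v) p u = T0 (ext v) p u + a v u := by rw [ha, a1]; abel
    have b2 : T (ext w) p u = T0 (ext w) p u + a w u := by rw [ha, a2]; abel
    have b3 : T0 radial p u = u := by rw [hT0, coneConn_radial, one_smul]
    simp only [Matrix.cons_val_zero, Matrix.cons_val_one, Matrix.cons_val, hE, hT.radial_eq, b1, b2,
      b3, taut_add_left, taut_add_right] at h3 h4
    linarith
  -- preservation of geodesics
  have hgeo : ∀ w : TangentSpace (𝓡 2) (proj p), w ≠ 0 →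
      dproj p (a (hlift h p w) (hlift h p w)) ∈ Submodule.span ℝ {w} := by
    intro w hw
    obtain ⟨X, hX, rfl, hXX⟩ := exists_geodesic_field D.conn hw
    have hc : ∃ c : ℝ, D.conn X (proj p) (X (proj p)) = c • X (proj p) := ⟨0, by rw [hXX, zero_smul]⟩
    have hl := lift_smooth h hX
    have hsp : ∀ q, dproj q (lift h X q) ∈ Submodule.span ℝ {X (proj q)} := fun q => by
      rw [dproj_lift]
      exact Submodule.mem_span_singleton_self _
    have h1 := hT.geodesic D rfl X hX (proj p) hw hc _ _ hl hl hsp hsp p rfl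
    have h2 := coneConn_geodesic h D.conn P 1 hX hw hc (hl.mdiffAt p) hsp hsp
    have h3 := diffTensor_apply T T0 (hl.mdiffAt p) (lift h X p)
    have h4 : a (hlift h p (X (proj p))) (hlift h p (X (proj p))) = _ := h3
    rw [h4, map_sub]
    exact Submodule.sub_mem _ h1 h2
  let b : TangentSpace (𝓡 2) (proj p) →ₗ[ℝ] TangentSpace (𝓡 2) (proj p) →ₗ[ℝ]
      TangentSpace (𝓡 2) (proj p) :=
    LinearMap.mk₂ ℝ (fun v w => dproj p (a (hlift h p v) (hlift h p w)))
      (fun v v' w => by simp only [map_add, add_apply]) (fun c v w => by simp only [map_smul, smul_apply])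
      (fun v w w' => by simp only [map_add]) (fun c v w => by simp only [map_smul])
  have hb : ∀ v w, b v w = dproj p (a (hlift h p v) (hlift h p w)) := fun _ _ => rfl
  have hzero : ∀ v w : TangentSpace (𝓡 2) (proj p), b v w = 0 := by
    refine eq_zero_of_trace_diagonal (show Plane →ₗ[ℝ] Plane →ₗ[ℝ] Plane from b)
      (fun v w => ?_) (fun w => ?_) fun u => ?_
    · exact congrArg (dproj p) (hsym _ _)
    · by_cases hw : w = 0
      · subst hw
        simp [wedge]
      · obtain ⟨c, hc⟩ := Submodule.mem_span_singleton.1 (hgeo w hw)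
        have h1 : (show Plane →ₗ[ℝ] Plane →ₗ[ℝ] Plane from b) w w = c • w := hc.symm
        rw [h1, wedge_smul_left, wedge_self, mul_zero]
    · have h1 := hvol (hlift h p u) (hlift h p (e (proj p) 0)) (hlift h p (e (proj p) 1))
      rw [hsym _ (hlift h p u), hsym _ (hlift h p u)] at h1
      simp only [taut_eq, Matrix.cons_val_zero, Matrix.cons_val_one, dproj_hlift] at h1
      rw [← mul_add] at h1
      exact (mul_eq_zero.1 h1).resolve_left (component_ne_zero p)
  rw [cone_decomp h p u, cone_decomp h p v]
  simp only [map_add, map_smul, add_apply, smul_apply, hrad, hsym _ (radial p), ← hb, hzero, map_zero,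
    smul_zero, add_zero]

/-- Once its horizontal part vanishes, the difference tensor is a form times 𝕏, and subtracting this
form from P absorbs it. The new form may at this stage depend on the point of the fibre. -/
theorem IsThomas.isConeLike (hpar : IsAreaParallel h D.conn) (hT : IsThomas (Quotient.mk _ D) T) :
    IsConeLike h D.conn (fun p v w => P.form (proj p) v w -
      eta h p (diffTensor T (coneConn h D.conn P 1) p (hlift h p v) (hlift h p w))) T := by
  set T0 := coneConn h D.conn P 1 with hT0
  have htor0 : T0.torsion = 0 := coneConn_torsion h D.conn P 1 D.torsion_eq
  have hsm0 := coneConn_smooth h D.conn P 1 D.smooth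
  have hl : ∀ X : Π x : M, TangentSpace (𝓡 2) x, IsSmoothField X → ∀ p,
      ∀ v : TangentSpace coneModel p, T (lift h X) p v = T0 (lift h X) p v +
        diffTensor T T0 p (hlift h p (X (proj p))) v := by
    intro X hX p v
    have := diffTensor_apply T T0 ((lift_smooth h hX).mdiffAt p) v
    rw [← sub_eq_iff_eq_add', ← this]
    rfl
  have hrad : ∀ (p : Cone M) u, diffTensor T T0 p u (radial p) = 0 := fun p u => by
    have := diffTensor_apply T T0 (radial_smooth.mdiffAt p) u
    rw [diffTensor_symm hT.torsion_eq htor0, this, hT.radial_eq, hT0, coneConn_radial, one_smul,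
      sub_self]
  refine ⟨hT.smooth, hT.torsion_eq, hT.radial_eq, fun X hX p v => ?_, fun X Y hX hY => ?_⟩
  · have h1 : diffTensor T T0 p (hlift h p (X (proj p))) v = eta h p (diffTensor T T0 p
        (hlift h p (X (proj p))) (hlift h p (dproj p v))) • radial p := by
      conv_lhs => rw [cone_decomp h p v, map_add, map_smul, hrad, smul_zero, zero_add]
      refine cone_ext h ?_ ?_
      · rw [dproj_diffTensor hpar hT, map_smul, dproj_radial, smul_zero]
      · rw [map_smul, eta_radial, smul_eq_mul, mul_one]
    rw [hl X hX, h1, hT0, coneConn_lift h D.conn P 1 (hX.mdiffAt _)]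
    module
  · have h1 : (fun p : Cone M => P.form (proj p) (X (proj p)) (Y (proj p)) -
        eta h p (diffTensor T T0 p (hlift h p (X (proj p))) (hlift h p (Y (proj p))))) =
        fun p => - eta h p (along T (lift h Y) (lift h X) p) := by
      funext p
      rw [along_apply, hl X hX, map_add, hT0, coneConn_lift h D.conn P 1 (hX.mdiffAt _)]
      simp only [map_add, map_smul, map_sub, eta_hlift, eta_lift, eta_radial, dproj_lift, smul_eq_mul]
      simp only [lift]
      ring
    rw [h1]
    exact (eta_smooth h (along_smooth hT.smooth (lift_smooth h hY) (lift_smooth h hX))).neg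

/-- Uniqueness of the Thomas connection. -/
theorem IsThomas.agree (hpar : IsAreaParallel h D.conn) (hric : ∀ x v w, ric D.conn x v w = P.form x v w)
    (hT : IsThomas (Quotient.mk _ D) T) : Agree T (coneConn h D.conn P 1) := by
  have hc := hT.isConeLike (P := P) hpar
  set B : Π p : Cone M, TangentSpace (𝓡 2) (proj p) → TangentSpace (𝓡 2) (proj p) → ℝ :=
    fun p v w => P.form (proj p) v w -
      eta h p (diffTensor T (coneConn h D.conn P 1) p (hlift h p v) (hlift h p w)) with hB
  have heta : ∀ {X Y : Π x : M, TangentSpace (𝓡 2) x}, IsSmoothField X → IsSmoothField Y → ∀ p : Cone M,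
      B p (X (proj p)) (Y (proj p)) = - eta h p (T (lift h X) p (lift h Y p)) := by
    intro X Y hX hY p
    rw [hc.lift_eq X hX, dproj_lift]
    simp only [map_add, map_smul, map_sub, eta_hlift, eta_lift, eta_radial, smul_eq_mul]
    ring
  -- Horizontal lifts and η are invariant under the action, so the invariance of T makes B constant
  -- along the fibres.
  have hinv : ∀ {X Y : Π x : M, TangentSpace (𝓡 2) x}, IsSmoothField X → IsSmoothField Y →
      ∀ (r : ℝˣ) (p : Cone M), B (scale r p) (X (proj p)) (Y (proj p)) =
        B p (X (proj p)) (Y (proj p)) := by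
    intro X Y hX hY r p
    have h1 : B (scale r p) (X (proj p)) (Y (proj p)) = _ := heta hX hY (scale r p)
    have h2 := hT.invariant r (lift h X) (lift_smooth h hX) p (lift h Y p)
    have h3 : VectorField.mpullback coneModel coneModel (scale r) (lift h X) = lift h X := by
      funext q
      refine (mfderiv_scale_invertible h r q).injective ?_
      rw [mfderiv_scale_mpullback h, mfderiv_scale_lift]
    rw [h3, mfderiv_scale_lift] at h2
    rw [h1, heta hX hY p, ← h2, eta_scale]
  refine agree_coneConn h D.conn P 1 (fun p v => by rw [hT.radial_eq, one_smul]) fun X hX p v => ?_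
  -- The radial derivative of B being zero, Ricci flatness in `ric_lift` reads Ric = B, which is P
  -- by hypothesis.
  have hBP : ∀ v w : TangentSpace (𝓡 2) (proj p), B p v w = P.form (proj p) v w := by
    intro v w
    obtain ⟨Z, hZ, rfl⟩ := exists_smoothField_apply v
    obtain ⟨Y, hY, rfl⟩ := exists_smoothField_apply w
    have h1 := hc.ric_lift D.smooth (fun p v => by
      refine ⟨fun x y => ?_, fun c x => ?_⟩
      · simp only [hB, map_add]; ring
      · simp only [hB, map_smul, smul_eq_mul]; ring) hY hZ p
    have h2 : mvfderiv coneModel (fun q => B q (Z (proj q)) (Y (proj q))) p (radial p) = 0 := by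
      rw [mvfderiv_radial (smooth_mdiffAt (hc.form_smooth Z Y hZ hY) p)]
      have : (fun t => B (orbit p t) (Z (proj (orbit p t))) (Y (proj (orbit p t)))) =
          fun _ => B p (Z (proj p)) (Y (proj p)) := funext fun t => hinv hZ hY _ p
      rw [this, deriv_const]
    rw [hT.ricci_flat, h2, hric, P.symm] at h1
    linarith
  rw [hc.lift_eq X hX, coneConn_lift h D.conn P 1 (hX.mdiffAt _), hBP, one_smul, add_sub_assoc]

end Unique

end

end AH

namespace AH

open Affine

noncomputable section

variable {M : Type*} [TopologicalSpace M] [ChartedSpace Plane M] [IsManifold (𝓡 2) ∞ M]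

/-! ### The Levi-Civita connection of the base metric -/

section Raise

variable (h : Metric M)

theorem eq_of_inner {x : M} {v w : TangentSpace (𝓡 2) x}
    (hvw : ∀ z, h.inner x v z = h.inner x w z) : v = w := by
  by_contra hne
  have h1 := h.pos x (v - w) (sub_ne_zero.2 hne)
  have h2 : h.inner x (v - w) (v - w) = h.inner x v (v - w) - h.inner x w (v - w) := by
    rw [(h.inner x).map_sub, sub_apply]
  rw [h2, hvw, sub_self] at h1
  exact lt_irrefl _ h1

/-- The vector which corresponds to a linear form. -/
def raise (x : M) (φ : TangentSpace (𝓡 2) x →ₗ[ℝ] ℝ) : TangentSpace (𝓡 2) x :=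
  (gram h x).det⁻¹ • ((h.inner x (e x 1) (e x 1) * φ (e x 0) -
      h.inner x (e x 0) (e x 1) * φ (e x 1)) • e x 0 +
    (h.inner x (e x 0) (e x 0) * φ (e x 1) - h.inner x (e x 0) (e x 1) * φ (e x 0)) • e x 1)

theorem inner_raise (x : M) (φ : TangentSpace (𝓡 2) x →ₗ[ℝ] ℝ) (w : TangentSpace (𝓡 2) x) :
    h.inner x (raise h x φ) w = φ w := by
  have hd := (gram_det_pos h x).ne'
  rw [raise, map_smul, map_add, map_smul, map_smul, smul_apply, add_apply, smul_apply, smul_apply]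
  conv_lhs => rw [e_sum x w]
  conv_rhs => rw [e_sum x w]
  simp only [map_add, map_smul, smul_eq_mul, h.symm x (e x 1) (e x 0)]
  rw [inv_mul_eq_iff_eq_mul₀ hd, gram_det]
  ring

variable {h}

/-- Cramer's rule for the Gram matrix of a smooth frame expresses the components of Z by its inner
products with the frame. -/
theorem smooth_of_inner [T2Space M] {Z : Π y : M, TangentSpace (𝓡 2) y}
    (hZ : ∀ W : Π y : M, TangentSpace (𝓡 2) y, IsSmoothField W →
      ContMDiff (𝓡 2) 𝓘(ℝ, ℝ) ∞ (fun y => h.inner y (Z y) (W y))) : IsSmoothField Z := by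
  intro x
  obtain ⟨E, hE, hEe⟩ := exists_smooth_frame_eq x
  let G : Fin 2 → Fin 2 → M → ℝ := fun i j y => h.inner y (E i y) (E j y)
  have hG : ∀ i j, ContMDiffAt (𝓡 2) 𝓘(ℝ, ℝ) ∞ (G i j) x := fun i j =>
    inner_smoothAt h (hE i x) (hE j x)
  let d : M → ℝ := fun y => G 0 0 y * G 1 1 y - G 0 1 y * G 0 1 y
  have hd : ContMDiffAt (𝓡 2) 𝓘(ℝ, ℝ) ∞ d x := ((hG 0 0).mul (hG 1 1)).sub ((hG 0 1).mul (hG 0 1))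
  have hdx : d x ≠ 0 := by
    have he := hEe.self_of_nhds
    have : d x = (gram h x).det := by
      simp only [d, G, he, frame_self, gram_det, sq]
    rw [this]
    exact (gram_det_pos h x).ne'
  have hZ' : ∀ j, ContMDiffAt (𝓡 2) 𝓘(ℝ, ℝ) ∞ (fun y => h.inner y (Z y) (E j y)) x := fun j =>
    hZ (E j) (hE j) x
  have h0 : ContMDiffAt (𝓡 2) 𝓘(ℝ, ℝ) ∞ (fun y => (G 1 1 y * h.inner y (Z y) (E 0 y) -
      G 0 1 y * h.inner y (Z y) (E 1 y)) / d y) x :=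
    (((hG 1 1).mul (hZ' 0)).sub ((hG 0 1).mul (hZ' 1))).div₀ hd hdx
  have h1 : ContMDiffAt (𝓡 2) 𝓘(ℝ, ℝ) ∞ (fun y => (G 0 0 y * h.inner y (Z y) (E 1 y) -
      G 0 1 y * h.inner y (Z y) (E 0 y)) / d y) x :=
    (((hG 0 0).mul (hZ' 1)).sub ((hG 0 1).mul (hZ' 0))).div₀ hd hdx
  have hs := (h0.smul_section (hE 0 x)).add_section (h1.smul_section (hE 1 x))
  refine smoothAt_congr_field hs ?_
  filter_upwards [hEe, chart_source_eventually (H := Plane) x, hd.continuousAt.eventually_ne hdx] with y hy hyc hdy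
  have hz := frame_sum hyc (Z y)
  rw [Fin.sum_univ_two, ← hy, ← hy] at hz
  set z0 := coord x 0 y (Z y)
  set z1 := coord x 1 y (Z y)
  have e0 : h.inner y (Z y) (E 0 y) = z0 * G 0 0 y + z1 * G 0 1 y := by
    rw [hz]
    simp only [map_add, map_smul, add_apply, smul_apply, smul_eq_mul, G, h.symm y (E 1 y) (E 0 y)]
  have e1 : h.inner y (Z y) (E 1 y) = z0 * G 0 1 y + z1 * G 1 1 y := by
    rw [hz]
    simp only [map_add, map_smul, add_apply, smul_apply, smul_eq_mul, G]
  simp only [Pi.add_apply, Pi.smul_apply']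
  rw [e0, e1, hz]
  congr 2
  · rw [div_eq_iff hdy]; simp only [d]; ring
  · rw [div_eq_iff hdy]; simp only [d]; ring

end Raise

section LeviCivita

variable (D : TorsionFree M) (h : Metric M)

theorem nablaMetric_eq {x : M} (u : TangentSpace (𝓡 2) x) {X Y : Π y : M, TangentSpace (𝓡 2) y}
    (hX : FieldDiffAt X x) (hY : FieldDiffAt Y x) : nablaMetric D h x u (X x) (Y x) =
      mvfderiv (𝓡 2) (fun y => h.inner y (X y) (Y y)) x u
        - h.inner x (D.conn X x u) (Y x) - h.inner x (X x) (D.conn Y x u) := by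
  rw [mvfderiv_inner u hX hY]; ring

theorem nablaMetric_add_left (x : M) (u u' v w : TangentSpace (𝓡 2) x) :
    nablaMetric D h x (u + u') v w = nablaMetric D h x u v w + nablaMetric D h x u' v w := by
  have h1 := fun u => nablaMetric_eq D h u (mdiffAt_ext v) (mdiffAt_ext w)
  simp only [ext_self] at h1
  simp only [h1, map_add, add_apply]
  ring

theorem nablaMetric_smul_left (x : M) (c : ℝ) (u v w : TangentSpace (𝓡 2) x) :
    nablaMetric D h x (c • u) v w = c * nablaMetric D h x u v w := by
  have h1 := fun u => nablaMetric_eq D h u (mdiffAt_ext v) (mdiffAt_ext w)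
  simp only [ext_self] at h1
  simp only [h1, map_smul, smul_apply, smul_eq_mul]
  ring

theorem nablaMetric_add_right (x : M) (u v w w' : TangentSpace (𝓡 2) x) :
    nablaMetric D h x u v (w + w') = nablaMetric D h x u v w + nablaMetric D h x u v w' := by
  have h1 := fun w => nablaMetric_eq D h u (mdiffAt_ext v) (mdiffAt_ext w)
  have h2 := nablaMetric_eq D h u (mdiffAt_ext v) (mdifferentiableAt_add_section (mdiffAt_ext w)
    (mdiffAt_ext w'))
  have h3 := mvfderiv_add (inner_mdiffAt h (mdiffAt_ext v) (mdiffAt_ext w))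
    (inner_mdiffAt h (mdiffAt_ext v) (mdiffAt_ext w')) u
  rw [conn_add _ (mdiffAt_ext w) (mdiffAt_ext w')] at h2
  simp only [Pi.add_apply, ext_self, map_add, add_apply] at h1 h2 h3
  rw [h2, h1, h1, h3]
  ring

theorem nablaMetric_smul_right (x : M) (c : ℝ) (u v w : TangentSpace (𝓡 2) x) :
    nablaMetric D h x u v (c • w) = c * nablaMetric D h x u v w := by
  have h1 := nablaMetric_eq D h u (mdiffAt_ext v) (mdiffAt_ext w)
  have hc : FieldDiffAt (c • ext w) x := mdifferentiableAt_const.smul_section (mdiffAt_ext w)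
  have h2 := nablaMetric_eq D h u (mdiffAt_ext v) hc
  have h3 := mvfderiv_const_mul c (inner_mdiffAt h (mdiffAt_ext v) (mdiffAt_ext w)) u
  rw [conn_const_smul _ c (mdiffAt_ext w)] at h2
  simp only [Pi.smul_apply, ext_self, map_smul, smul_apply, smul_eq_mul] at h1 h2 h3
  rw [h2, h1, h3]
  ring

/-- Half of `∇h`, as a linear form in the last argument. -/
def halfNabla (x : M) (u v : TangentSpace (𝓡 2) x) : TangentSpace (𝓡 2) x →ₗ[ℝ] ℝ where
  toFun w := 1 / 2 * nablaMetric D h x u v w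
  map_add' w w' := by rw [nablaMetric_add_right]; ring
  map_smul' c w := by rw [nablaMetric_smul_right, RingHom.id_apply, smul_eq_mul]; ring

theorem halfNabla_apply (x : M) (u v w : TangentSpace (𝓡 2) x) :
    halfNabla D h x u v w = 1 / 2 * nablaMetric D h x u v w := rfl

/-- The difference of the Levi-Civita connection of `h` and `∇`, when `∇h` is symmetric. -/
def lcTensor (x : M) :
    TangentSpace (𝓡 2) x →L[ℝ] TangentSpace (𝓡 2) x →L[ℝ] TangentSpace (𝓡 2) x :=
  let b : TangentSpace (𝓡 2) x →ₗ[ℝ] TangentSpace (𝓡 2) x →ₗ[ℝ] TangentSpace (𝓡 2) x :=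
    LinearMap.mk₂ ℝ (fun v u : TangentSpace (𝓡 2) x => raise h x (halfNabla D h x u v))
      (fun v v' u => eq_of_inner h fun w => by
        simp only [map_add, add_apply, inner_raise, halfNabla_apply,
          nablaMetric_swap D h x u _ w, nablaMetric_add_right]
        ring)
      (fun c v u => eq_of_inner h fun w => by
        simp only [map_smul, smul_apply, inner_raise, halfNabla_apply,
          nablaMetric_swap D h x u _ w, nablaMetric_smul_right, smul_eq_mul]
        ring)
      (fun v u u' => eq_of_inner h fun w => by
        simp only [map_add, add_apply, inner_raise, halfNabla_apply, nablaMetric_add_left]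
        ring)
      (fun c v u => eq_of_inner h fun w => by
        simp only [map_smul, smul_apply, inner_raise, halfNabla_apply, nablaMetric_smul_left,
          smul_eq_mul]
        ring)
  (show Plane →ₗ[ℝ] Plane →ₗ[ℝ] Plane from b).toContinuousBilinearMap

theorem inner_lcTensor (x : M) (v u w : TangentSpace (𝓡 2) x) :
    h.inner x (lcTensor D h x v u) w = 1 / 2 * nablaMetric D h x u v w :=
  inner_raise h x _ w

variable {D h}

/-- The Levi-Civita connection of `h`, from a torsion-free connection for which `∇h` is symmetric. -/
def leviCivita [T2Space M] (hC : ∀ x u v w, nablaMetric D h x u v w = nablaMetric D h x v u w) :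
    TorsionFree M where
  conn := D.conn.addOneForm (lcTensor D h)
  smooth := by
    refine contMDiff_of_along fun V Y hV hY => ?_
    -- The tensor is defined pointwise by raising an index. Its inner product with a smooth field W
    -- is half of (∇_V h)(Y, W), which is smooth by the product rule.
    have h1 : IsSmoothField (fun x => lcTensor D h x (Y x) (V x)) := by
      refine smooth_of_inner (h := h) fun W hW => ?_
      have h2 : (fun x => h.inner x (lcTensor D h x (Y x) (V x)) (W x)) = fun x =>
          1 / 2 * (mvfderiv (𝓡 2) (fun y => h.inner y (Y y) (W y)) x (V x) -
            h.inner x (along D.conn V Y x) (W x) - h.inner x (Y x) (along D.conn V W x)) := by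
        funext x
        rw [inner_lcTensor, nablaMetric_eq D h (V x) (hY.mdiffAt x) (hW.mdiffAt x)]
        rfl
      rw [h2]
      have hm : ∀ {A B : Π y : M, TangentSpace (𝓡 2) y}, IsSmoothField A → IsSmoothField B →
          ContMDiff (𝓡 2) 𝓘(ℝ, ℝ) ∞ (fun y => h.inner y (A y) (B y)) := fun hA hB y =>
        inner_smoothAt h (hA y) (hB y)
      exact contMDiff_const.mul (((smooth_mvfderiv_apply (hm hY hW) hV).sub
        (hm (along_smooth D.smooth hV hY) hW)).sub (hm hY (along_smooth D.smooth hV hW)))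
    exact (along_smooth D.smooth hV hY).add h1
  torsion_eq := by
    have h0 := D.torsion_eq
    rw [CovariantDerivative.torsion_eq_zero_iff] at h0 ⊢
    intro X Y x hX hY
    rw [← h0 hX hY]
    have hs : lcTensor D h x (Y x) (X x) = lcTensor D h x (X x) (Y x) :=
      eq_of_inner h fun w => by rw [inner_lcTensor, inner_lcTensor, hC]
    change D.conn Y x (X x) + lcTensor D h x (Y x) (X x) -
      (D.conn X x (Y x) + lcTensor D h x (X x) (Y x)) = _
    rw [hs]
    abel

/-- The added tensor takes up half of ∇h in each of the two slots. -/
theorem leviCivita_nablaMetric [T2Space M]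
    (hC : ∀ x u v w, nablaMetric D h x u v w = nablaMetric D h x v u w) (x : M)
    (u v w : TangentSpace (𝓡 2) x) : nablaMetric (leviCivita hC) h x u v w = 0 := by
  have h1 := nablaMetric_eq D h u (mdiffAt_ext v) (mdiffAt_ext w)
  have h2 := nablaMetric_eq (leviCivita hC) h u (mdiffAt_ext v) (mdiffAt_ext w)
  have h3 : ∀ v : TangentSpace (𝓡 2) x, (leviCivita hC).conn (ext v) x u =
      D.conn (ext v) x u + lcTensor D h x (ext v x) u := fun v => rfl
  rw [h3, h3] at h2
  simp only [ext_self, map_add, add_apply, inner_lcTensor, h.symm x v (lcTensor D h x w u)]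
    at h1 h2
  rw [nablaMetric_swap D h x u w v] at h2
  linarith

end LeviCivita

end

end AH

namespace AH

open Affine

noncomputable section

variable {M : Type*} [TopologicalSpace M] [ChartedSpace Plane M] [IsManifold (𝓡 2) ∞ M]

/-! ### The scalar curvature as a function on the cone -/

section ScalarLift

variable [T2Space M]

/-- The density of the area form of h relative to |θ| is √det h / |component|, which is e^{−3ρ}. -/
theorem scalarLift_eq (D : TorsionFree M) (h : Metric M) (p : Cone M) :
    scalarLift D h p = scal D h (proj p) * Real.exp (-3 * logRadius h p) := by
  have h1 := exp_logRadius (h := h) p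
  have hd := gram_det_pos h (proj p)
  have hc := component_ne_zero p
  have h2 : twoForm p (e (proj p) 0) (e (proj p) 1) = component p := by
    simp [twoForm, e]
  have h3 : Real.exp (-3 * logRadius h p) = Real.sqrt (gram h (proj p)).det / |component p| := by
    rw [← Real.sqrt_sq_eq_abs, ← Real.sqrt_div hd.le, eq_comm,
      Real.sqrt_eq_iff_mul_self_eq (by positivity) (Real.exp_pos _).le, ← Real.exp_add,
      show -3 * logRadius h p + -3 * logRadius h p = -(6 * logRadius h p) by ring, Real.exp_neg, h1,
      inv_div]
  rw [scalarLift, h2, h3, mul_div_assoc]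

variable {D : TorsionFree M} {h : Metric M}
  (hs : IsSpecial D h (fun x => scal D h x / 2))

include hs

theorem IsSpecial.scal_smooth : ContMDiff (𝓡 2) 𝓘(ℝ, ℝ) ∞ (scal D h) := by
  have := hs.smooth.mul (contMDiff_const (c := (2 : ℝ)))
  exact this.congr fun y => (div_mul_cancel₀ _ two_ne_zero).symm

theorem IsSpecial.mvfderiv_scal (x : M) (u : TangentSpace (𝓡 2) x) :
    mvfderiv (𝓡 2) (scal D h) x u = 0 := by
  have h1 := mvfderiv_const_mul 2 (smooth_mdiffAt hs.smooth x) u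
  have h2 : (fun y => 2 * (scal D h y / 2)) = scal D h := funext fun y => by ring
  rw [h2, hs.mvfderiv_eq, zero_apply, mul_zero] at h1
  exact h1

theorem IsSpecial.scalarLift_neg (p : Cone M) : scalarLift D h p < 0 := by
  rw [scalarLift_eq]
  have := hs.neg (proj p)
  exact mul_neg_of_neg_of_pos (by linarith) (Real.exp_pos _)

theorem IsSpecial.scalarLift_smooth : ContMDiff coneModel 𝓘(ℝ, ℝ) ∞ (scalarLift D h) := by
  have h1 : ContMDiff coneModel 𝓘(ℝ, ℝ) ∞ (fun p => Real.exp (-3 * logRadius h p)) :=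
    Real.contDiff_exp.contMDiff.comp (contMDiff_const.mul (logRadius_smooth h))
  exact ((hs.scal_smooth.comp proj_smooth).mul h1).congr fun p => scalarLift_eq D h p

/-- Only the factor e^{−3ρ} is differentiated, since the differential of the scalar curvature
vanishes. -/
theorem IsSpecial.mvfderiv_scalarLift (p : Cone M) (u : TangentSpace coneModel p) :
    mvfderiv coneModel (scalarLift D h) p u = -3 * scalarLift D h p * eta h p u := by
  have hρ := smooth_mdiffAt (logRadius_smooth h) p
  have h1 : HasDerivAt (fun t : ℝ => Real.exp (-3 * t)) (Real.exp (-3 * logRadius h p) * -3)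
      (logRadius h p) := by
    have h2 : HasDerivAt (fun t : ℝ => -3 * t) (-3) (logRadius h p) := by
      simpa using (hasDerivAt_id (logRadius h p)).const_mul (-3)
    exact h2.exp
  have h2 := mvfderiv_comp_real h1 hρ u
  have hE : MDifferentiableAt coneModel 𝓘(ℝ, ℝ) (fun q => Real.exp (-3 * logRadius h q)) p :=
    h1.differentiableAt.mdifferentiableAt.comp p hρ
  have hS := smooth_mdiffAt hs.scal_smooth (proj p)
  have h3 := mvfderiv_mul (smooth_mdiffAt (hs.scal_smooth.comp proj_smooth) p) hE u
  have h4 := mvfderiv_comp_proj hS u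
  rw [hs.mvfderiv_scal] at h4
  have h5 : scalarLift D h = fun q => (scal D h ∘ proj) q * Real.exp (-3 * logRadius h q) :=
    funext fun q => scalarLift_eq D h q
  rw [h5, h3, h2]
  have h6 : mvfderiv coneModel (scal D h ∘ proj) p u = 0 := h4
  rw [h6, eta]
  ring

/-- The differential of the lift is a nonvanishing multiple of η, so the tangent planes of the level
surfaces are the horizontal planes. -/
theorem IsSpecial.mem_levelTangent (p : Cone M) (u : TangentSpace coneModel p) :
    u ∈ levelTangent coneModel (scalarLift D h) p ↔ eta h p u = 0 := by
  have h1 : u ∈ levelTangent coneModel (scalarLift D h) p ↔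
      mvfderiv coneModel (scalarLift D h) p u = 0 := Iff.rfl
  rw [h1, hs.mvfderiv_scalarLift]
  have := (hs.scalarLift_neg p).ne
  simp [this]

theorem IsSpecial.hasSmoothLevelSets : HasSmoothLevelSets coneModel (scalarLift D h) := by
  refine ⟨hs.scalarLift_smooth, fun p h0 => ?_⟩
  have h1 := hs.mvfderiv_scalarLift p (radial p)
  rw [h0, eta_radial, zero_apply] at h1
  have := (hs.scalarLift_neg p).ne
  simp [this] at h1

theorem IsSpecial.vLift_pos (p : Cone M) : 0 < vLift D h p := by
  have := (hs.scalarLift_neg p).ne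
  rw [vLift]
  positivity

theorem IsSpecial.vLift_smooth : ContMDiff coneModel 𝓘(ℝ, ℝ) ∞ (vLift D h) := by
  intro p
  have h0 := (hs.scalarLift_neg p).ne
  have h1 : ContDiffAt ℝ ∞ (fun t : ℝ => ((t / 2) ^ 2) ^ (-(1 / 3) : ℝ)) (scalarLift D h p) :=
    ((contDiffAt_id.div_const 2).pow 2).rpow_const_of_ne (by simp [h0])
  exact h1.contMDiffAt.comp p (hs.scalarLift_smooth p)

/-- The lift of the curvature has degree −3 and enters with exponent −2/3, which gives degree 2. -/
theorem IsSpecial.mvfderiv_vLift (p : Cone M) (u : TangentSpace coneModel p) :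
    mvfderiv coneModel (vLift D h) p u = 2 * vLift D h p * eta h p u := by
  have h0 := (hs.scalarLift_neg p).ne
  have hsq : (scalarLift D h p / 2) ^ 2 ≠ 0 := by simp [h0]
  have h1 : HasDerivAt (fun t : ℝ => (t / 2) ^ 2) (scalarLift D h p / 2) (scalarLift D h p) := by
    refine (((hasDerivAt_id (scalarLift D h p)).div_const 2).pow 2).congr_deriv ?_
    simp only [id_eq, Nat.cast_ofNat]
    ring
  have h2 : HasDerivAt (fun t : ℝ => ((t / 2) ^ 2) ^ (-(1 / 3) : ℝ)) _ (scalarLift D h p) :=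
    h1.rpow_const (p := (-(1 / 3) : ℝ)) (Or.inl hsq)
  have h3 := mvfderiv_comp_real (f := scalarLift D h) h2 (smooth_mdiffAt hs.scalarLift_smooth p) u
  have h4 : vLift D h = fun q => ((scalarLift D h q / 2) ^ 2) ^ (-(1 / 3) : ℝ) := rfl
  rw [h4, h3, hs.mvfderiv_scalarLift, Real.rpow_sub_one hsq]
  field_simp

theorem IsSpecial.potentialF_smooth : ContMDiff coneModel 𝓘(ℝ, ℝ) ∞ (potentialF D h) := by
  intro p
  have h1 : ContDiffAt ℝ ∞ (fun t : ℝ => -(3 / 2) * Real.log t) (vLift D h p) :=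
    contDiffAt_const.mul (Real.contDiffAt_log.2 (hs.vLift_pos p).ne')
  exact h1.contMDiffAt.comp p (hs.vLift_smooth p)

theorem IsSpecial.mvfderiv_potentialF (p : Cone M) (u : TangentSpace coneModel p) :
    mvfderiv coneModel (potentialF D h) p u = -3 * eta h p u := by
  have hv := (hs.vLift_pos p).ne'
  have h1 := (Real.hasDerivAt_log hv).const_mul (-(3 / 2))
  have h2 := mvfderiv_comp_real h1 (smooth_mdiffAt hs.vLift_smooth p) u
  have h3 : potentialF D h = fun q => -(3 / 2) * Real.log (vLift D h q) := rfl
  rw [h3, h2, hs.mvfderiv_vLift]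
  field_simp

theorem IsSpecial.potentialG_smooth : ContMDiff coneModel 𝓘(ℝ, ℝ) ∞ (potentialG D h) :=
  contMDiff_const.mul hs.vLift_smooth

theorem IsSpecial.mvfderiv_potentialG (p : Cone M) (u : TangentSpace coneModel p) :
    mvfderiv coneModel (potentialG D h) p u = vLift D h p * eta h p u := by
  have h2 := mvfderiv_const_mul (1 / 2) (smooth_mdiffAt hs.vLift_smooth p) u
  have h3 : potentialG D h = fun q => 1 / 2 * vLift D h q := rfl
  rw [h3, h2, hs.mvfderiv_vLift]
  ring

end ScalarLift

/-! ### Hessians and metrics on the cone -/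

section ConeMetric

variable [T2Space M]

/-- The Hessian of a function whose differential is a multiple of `η`. -/
theorem hess_coneConn (h : Metric M) (D : Connection (𝓡 2) M) (P : SymForm M) {F ψ : Cone M → ℝ}
    (hF : ContMDiff coneModel 𝓘(ℝ, ℝ) ∞ F) (hψ : ContMDiff coneModel 𝓘(ℝ, ℝ) ∞ ψ)
    (hd : ∀ q u, mvfderiv coneModel F q u = ψ q * eta h q u) (p : Cone M)
    (v w : TangentSpace coneModel p) : hess (coneConn h D P 1) F p v w =
      mvfderiv coneModel ψ p v * eta h p w + ψ p * (P.form (proj p) (dproj p v) (dproj p w) -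
        eta h p v * eta h p w) := by
  have hW := mdiffAt_ext (I := coneModel) w
  have h1 := hess_apply (coneConn h D P 1) hF v hW
  have h2 : (fun q => mvfderiv coneModel F q (ext w q)) = fun q => ψ q * eta h q (ext w q) :=
    funext fun q => hd q _
  have h3 := mvfderiv_mul (smooth_mdiffAt hψ p) (eta_mdiffAt h hW) v
  rw [h2, h3, mvfderiv_eta P, hd] at h1
  simp only [ext_self] at h1
  rw [h1, P.symm _ (dproj p w)]
  ring

theorem inner_dproj_smooth (h : Metric M) {V W : Π q : Cone M, TangentSpace coneModel q}
    (hV : IsSmoothField V) (hW : IsSmoothField W) :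
    ContMDiff coneModel 𝓘(ℝ, ℝ) ∞ (fun q => h.inner (proj q) (dproj q (V q)) (dproj q (W q))) := by
  have h1 : ∀ {V : Π q : Cone M, TangentSpace coneModel q}, IsSmoothField V →
      ContMDiff coneModel (𝓡 2).tangent ∞
        (fun q => (⟨proj q, dproj q (V q)⟩ : TangentBundle (𝓡 2) M)) := fun hV =>
    (proj_smooth.contMDiff_tangentMap (m := ∞) (by simp)).comp hV
  exact fun q => inner_smoothAt h (h1 hV q) (h1 hW q)

theorem inner_dproj_mdiffAt (h : Metric M) {V W : Π q : Cone M, TangentSpace coneModel q}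
    {p : Cone M} (hV : FieldDiffAt V p) (hW : FieldDiffAt W p) :
    MDifferentiableAt coneModel 𝓘(ℝ, ℝ)
      (fun q => h.inner (proj q) (dproj q (V q)) (dproj q (W q))) p := by
  have h1 : ∀ {V : Π q : Cone M, TangentSpace coneModel q}, FieldDiffAt V p →
      MDifferentiableAt coneModel (𝓡 2).tangent
        (fun q => (⟨proj q, dproj q (V q)⟩ : TangentBundle (𝓡 2) M)) p := fun hV =>
    ((proj_smooth.contMDiff_tangentMap (m := ∞) (by simp)).mdifferentiable (by simp) _).comp p hV
  exact inner_mdiffAt h (h1 hV) (h1 hW)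

/-- The metric `α η ⊗ η + β κ h`. -/
def coneMetric (h : Metric M) {κ : M → ℝ} (hκ : ContMDiff (𝓡 2) 𝓘(ℝ, ℝ) ∞ κ) (hκ0 : ∀ x, κ x ≠ 0)
    {α β : Cone M → ℝ} (hα : ContMDiff coneModel 𝓘(ℝ, ℝ) ∞ α)
    (hβ : ContMDiff coneModel 𝓘(ℝ, ℝ) ∞ β) (hα0 : ∀ p, α p ≠ 0) (hβ0 : ∀ p, β p ≠ 0) :
    PseudoMetric coneModel (Cone M) where
  form p := LinearMap.mk₂ ℝ (fun v w => α p * (eta h p v * eta h p w) +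
      β p * (κ (proj p) * h.inner (proj p) (dproj p v) (dproj p w)))
    (fun v v' w => by simp only [map_add, add_apply]; ring)
    (fun c v w => by simp only [map_smul, smul_apply, smul_eq_mul]; ring)
    (fun v w w' => by simp only [map_add]; ring)
    (fun c v w => by simp only [map_smul, smul_eq_mul]; ring)
  symm p v w := by
    simp only [LinearMap.mk₂_apply, h.symm (proj p) (dproj p v) (dproj p w)]
    ring
  nondegenerate p v hv := by
    simp only [LinearMap.mk₂_apply] at hv
    -- Pairing with 𝕏 isolates η(v). Pairing with the horizontal part of v itself isolates the
    -- h-length of its projection, and h is definite.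
    have h1 := hv (radial p)
    have h2 := hv (hlift h p (dproj p v))
    rw [eta_radial, dproj_radial, map_zero, mul_zero, mul_zero, add_zero, mul_one] at h1
    rw [eta_hlift, dproj_hlift, mul_zero, mul_zero, zero_add] at h2
    have h3 := (mul_eq_zero.1 h1).resolve_left (hα0 p)
    have h4 := (mul_eq_zero.1 ((mul_eq_zero.1 h2).resolve_left (hβ0 p))).resolve_left (hκ0 _)
    have h5 : dproj p v = 0 := by
      by_contra hne
      exact (h.pos (proj p) _ hne).ne' h4
    exact cone_ext h (by rw [h5, map_zero]) (by rw [h3, map_zero])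
  smooth V W hV hW := (hα.mul ((eta_smooth h hV).mul (eta_smooth h hW))).add
    (hβ.mul ((hκ.comp proj_smooth).mul (inner_dproj_smooth h hV hW)))

variable {h : Metric M} {κ : M → ℝ} (hκ : ContMDiff (𝓡 2) 𝓘(ℝ, ℝ) ∞ κ) (hκ0 : ∀ x, κ x ≠ 0)
  {α β : Cone M → ℝ} (hα : ContMDiff coneModel 𝓘(ℝ, ℝ) ∞ α)
  (hβ : ContMDiff coneModel 𝓘(ℝ, ℝ) ∞ β) (hα0 : ∀ p, α p ≠ 0) (hβ0 : ∀ p, β p ≠ 0)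

theorem coneMetric_apply (p : Cone M) (v w : TangentSpace coneModel p) :
    (coneMetric h hκ hκ0 hα hβ hα0 hβ0).form p v w = α p * (eta h p v * eta h p w) +
      β p * (κ (proj p) * h.inner (proj p) (dproj p v) (dproj p w)) := rfl

theorem coneMetric_isTensorAt (p : Cone M) :
    IsTensorAt (coneMetric h hκ hκ0 hα hβ hα0 hβ0).tensor p where
  multilinear q := by
    refine ⟨MultilinearMap.mk' (fun v => (coneMetric h hκ hκ0 hα hβ hα0 hβ0).tensor q v) ?_ ?_,
      fun v => rfl⟩
    · intro v i a b
      fin_cases i <;> simp [PseudoMetric.tensor]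
    · intro v i c a
      fin_cases i <;> simp [PseudoMetric.tensor]
  mdiff V hV := by
    have h1 := fun i => eta_mdiffAt h (hV i)
    exact ((smooth_mdiffAt hα p).mul ((h1 0).mul (h1 1))).add
      ((smooth_mdiffAt hβ p).mul ((smooth_mdiffAt (hκ.comp proj_smooth) p).mul
        (inner_dproj_mdiffAt h (hV 0) (hV 1))))

/-- Every tangent vector of the cone is the value of the sum of a multiple of the radial field and
a horizontal lift. -/
theorem exists_adapted (h : Metric M) {p : Cone M} (v : TangentSpace coneModel p) :
    ∃ (V : Π q : Cone M, TangentSpace coneModel q) (X : Π x : M, TangentSpace (𝓡 2) x) (c : ℝ),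
      FieldDiffAt V p ∧ FieldDiffAt X (proj p) ∧ V p = v ∧ (∀ q, eta h q (V q) = c) ∧
      (∀ q, dproj q (V q) = X (proj q)) ∧
      ∀ (D : Connection (𝓡 2) M) (P : SymForm M) (a : ℝ) (u : TangentSpace coneModel p),
        eta h p (coneConn h D P a V p u) =
          a * (c * eta h p u - P.form (proj p) (X (proj p)) (dproj p u)) ∧
        dproj p (coneConn h D P a V p u) = D X (proj p) (dproj p u) +
          a • (c • dproj p u + eta h p u • X (proj p)) := by
  let c := eta h p v
  let X : Π x : M, TangentSpace (𝓡 2) x := ext (dproj p v)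
  have hX : FieldDiffAt X (proj p) := mdiffAt_ext _
  have hr : FieldDiffAt (radial : Π q : Cone M, TangentSpace coneModel q) p := radial_smooth.mdiffAt p
  have hcr : FieldDiffAt (c • radial : Π q : Cone M, TangentSpace coneModel q) p :=
    mdifferentiableAt_const.smul_section hr
  let V : Π q : Cone M, TangentSpace coneModel q := c • radial + lift h X
  have hV : FieldDiffAt V p := mdifferentiableAt_add_section hcr (lift_diffAt h hX)
  have hη : ∀ q, eta h q (V q) = c := fun q => by
    simp only [V, Pi.add_apply, Pi.smul_apply, map_add, map_smul, eta_radial, eta_lift, smul_eq_mul,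
      mul_one, add_zero]
  have hd : ∀ q, dproj q (V q) = X (proj q) := fun q => by
    simp only [V, Pi.add_apply, Pi.smul_apply, map_add, map_smul, dproj_radial, dproj_lift, smul_zero,
      zero_add]
  refine ⟨V, X, c, hV, hX, ?_, hη, hd, fun D P a u => ?_⟩
  · have := cone_decomp h p v
    simp only [V, Pi.add_apply, Pi.smul_apply, lift, X, ext_self]
    exact this.symm
  · have h1 : pullConn D V p u = D X (proj p) (dproj p u) := by
      rw [← pullConn_lift D h hX, pullConn_congr_dproj D (Z := lift h X)
        (Filter.Eventually.of_forall fun q => by rw [hd, dproj_lift])]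
    rw [eta_coneConn, dproj_coneConn, h1, hd, hη]
    simp only [hη, mvfderiv_const, zero_apply, zero_add, and_self]

/-- The Levi-Civita connections of the metrics `α η ⊗ η + β κ h`. -/
theorem coneConn_isLeviCivita (Dh : TorsionFree M) (hDh : ∀ x u v w, nablaMetric Dh h x u v w = 0)
    (hdκ : ∀ x, mvfderiv (𝓡 2) κ x = 0) (a : ℝ) (hab : ∀ p, a * (α p - β p) = 0)
    (hdα : ∀ p u, mvfderiv coneModel α p u = 2 * a * α p * eta h p u)
    (hdβ : ∀ p u, mvfderiv coneModel β p u = 2 * a * β p * eta h p u) :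
    IsLeviCivita (coneMetric h hκ hκ0 hα hβ hα0 hβ0) (coneConn h Dh.conn (schouten h hκ) a) := by
  refine ⟨coneConn_smooth h Dh.conn _ a Dh.smooth, coneConn_torsion h Dh.conn _ a Dh.torsion_eq,
    fun p u v => ?_⟩
  -- With constant η-components, the metric on these fields is a constant multiple of α plus β times
  -- a function pulled back from M.
  obtain ⟨V, X, c, hV, hX, hVp, hVη, hVd, hVc⟩ := exists_adapted h (v 0)
  obtain ⟨W, Y, d, hW, hY, hWp, hWη, hWd, hWc⟩ := exists_adapted h (v 1)
  have hv : v = ![V p, W p] := by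
    ext1 i; fin_cases i
    · exact hVp.symm
    · exact hWp.symm
  rw [hv, covTensor_two _ (coneMetric_isTensorAt hκ hκ0 hα hβ hα0 hβ0 p) u hV hW]
  simp only [PseudoMetric.tensor, Matrix.cons_val_zero, Matrix.cons_val_one, coneMetric_apply,
    (hVc Dh.conn (schouten h hκ) a u).1, (hVc Dh.conn (schouten h hκ) a u).2,
    (hWc Dh.conn (schouten h hκ) a u).1, (hWc Dh.conn (schouten h hκ) a u).2, hVη, hWη, hVd, hWd,
    schouten_apply]
  have hi := inner_mdiffAt h hX hY
  have hi' : MDifferentiableAt coneModel 𝓘(ℝ, ℝ) (fun q : Cone M => h.inner (proj q) (X (proj q)) (Y (proj q))) p :=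
    hi.comp p (proj_smooth.mdifferentiable (by simp) p)
  have hk : MDifferentiableAt coneModel 𝓘(ℝ, ℝ) (fun q : Cone M => κ (proj q)) p :=
    smooth_mdiffAt (hκ.comp proj_smooth) p
  have hα' := smooth_mdiffAt hα p
  have hβ' := smooth_mdiffAt hβ p
  have hcd : MDifferentiableAt coneModel 𝓘(ℝ, ℝ) (fun _ : Cone M => c * d) p := mdifferentiableAt_const
  have e1 := mvfderiv_add (hα'.mul hcd) (hβ'.mul (hk.mul hi')) u
  have e2 := mvfderiv_mul hα' hcd u
  have e3 := mvfderiv_mul hβ' (hk.mul hi') u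
  have e4 := mvfderiv_mul hk hi' u
  have e5 := mvfderiv_comp_proj (smooth_mdiffAt hκ (proj p)) u
  have e6 := (mvfderiv_comp_proj hi u).trans (mvfderiv_inner (D := Dh) (dproj p u) hX hY)
  rw [hdκ, zero_apply] at e5
  rw [hDh, zero_add] at e6
  rw [e5, e6, mul_zero, add_zero] at e4
  have e3' := e3.trans (congrArg₂ (· + ·) (congrArg _ e4) rfl)
  rw [mvfderiv_const, zero_apply, mul_zero, zero_add] at e2
  have e7 := e1.trans (congrArg₂ (· + ·) e2 e3')
  refine (congrArg₂ (· - ·) e7 rfl).trans ?_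
  rw [hdα, hdβ]
  simp only [Pi.mul_apply, map_add, map_smul, add_apply, smul_apply, smul_eq_mul]
  -- The derivatives of α and β cancel against the terms with η(u). The surviving mixed terms pair
  -- −aαP with aβκh and have the common factor a(α − β), which vanishes by hypothesis.
  have h3 := hab p
  rw [h.symm (proj p) (X (proj p)) (dproj p u), h.symm (proj p) (Y (proj p)) (dproj p u)]
  linear_combination (κ (proj p) * (d * h.inner (proj p) (dproj p u) (X (proj p)) +
    c * h.inner (proj p) (dproj p u) (Y (proj p)))) * h3

end ConeMetric

end

end AH

namespace Affine

noncomputable section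

variable {E : Type*} [NormedAddCommGroup E] [NormedSpace ℝ E] [FiniteDimensional ℝ E]
  [CompleteSpace E] {H : Type*} [TopologicalSpace H] {I : ModelWithCorners ℝ E H}
  {N : Type*} [TopologicalSpace N] [ChartedSpace H N] [IsManifold I ∞ N]

/-- Top forms are indexed by the dimension of the model space, which equals 3 only propositionally;
this carries the computation with three arguments over. -/
theorem covTensor_reindex (T : Connection I N) {k l : ℕ} (hkl : k = l) (t : CoTensor I N k) (x : N)
    (u : TangentSpace I x) (v : Fin l → TangentSpace I x) :
    covTensor T (fun y w => t y (fun i => w (finCongr hkl i)) : CoTensor I N l) x u v =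
      covTensor T t x u (fun i => v (finCongr hkl i)) := by
  subst hkl
  rfl

theorem Agree.parallelVolume {T T' : Connection I N} (h : Agree T T') {vol : TopForm I N} {U : Set N}
    (hv : IsParallelVolume T' vol U) : IsParallelVolume T vol U :=
  ⟨hv.smooth, hv.ne_zero, fun x hx u v => (h.covTensor _ x u v).trans (hv.parallel x hx u v)⟩

end

end Affine

namespace AH

open Affine

noncomputable section

variable {M : Type*} [TopologicalSpace M] [ChartedSpace Plane M] [IsManifold (𝓡 2) ∞ M]

/-! ### The parallel volume form of the cone -/

section Volume

variable [T2Space M]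

theorem finrank_cone : 3 = Module.finrank ℝ (Plane × ℝ) := by simp

/-- The volume form `3 η ∧ μ`, as an alternating map. -/
def etaAlt (h : Metric M) (p : Cone M) : (TangentSpace coneModel p) [⋀^Fin 3]→ₗ[ℝ] ℝ where
  toFun v := 3 * etaTaut h p (v 0) (v 1) (v 2)
  map_update_add' v i a b := by
    obtain ⟨m, hm⟩ := (etaTaut_isTensorAt h 3 p).multilinear p
    have : ∀ w : Fin 3 → TangentSpace coneModel p, 3 * etaTaut h p (w 0) (w 1) (w 2) = m w := hm
    rw [this, this, this]
    convert m.map_update_add v i a b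
  map_update_smul' v i c a := by
    obtain ⟨m, hm⟩ := (etaTaut_isTensorAt h 3 p).multilinear p
    have : ∀ w : Fin 3 → TangentSpace coneModel p, 3 * etaTaut h p (w 0) (w 1) (w 2) = m w := hm
    rw [this, this]
    convert m.map_update_smul v i c a
  map_eq_zero_of_eq' v i j hij hne := by
    have h0 : ∀ z, tautological M p ![z, z] = 0 := fun z => by
      linarith [taut_swap p z z]
    have h1 := taut_swap p (v 1) (v 0)
    have h2 := taut_swap p (v 2) (v 1)
    have h3 := taut_swap p (v 0) (v 2)
    fin_cases i <;> fin_cases j <;> simp at hij hne <;> simp only [etaTaut] <;>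
      first
      | (rw [hij, h0, h1]; ring)
      | (rw [hij, h0, h2]; ring)
      | (rw [hij, h0, h3]; ring)

/-- The volume form `3 η ∧ μ`. -/
def coneVol (h : Metric M) : TopForm coneModel (Cone M) := fun p =>
  (etaAlt h p).domDomCongr (finCongr finrank_cone)

theorem coneVol_apply (h : Metric M) (p : Cone M)
    (v : Fin (Module.finrank ℝ (Plane × ℝ)) → TangentSpace coneModel p) : coneVol h p v =
      3 * etaTaut h p (v (finCongr finrank_cone 0)) (v (finCongr finrank_cone 1))
        (v (finCongr finrank_cone 2)) := rfl

theorem etaTaut_radial (h : Metric M) (p : Cone M) (v w : TangentSpace coneModel p) :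
    etaTaut h p (radial p) v w = tautological M p ![v, w] := by
  have h5 : ∀ z, tautological M p ![radial p, z] = 0 := fun z => by
    rw [taut_eq]
    simp only [Matrix.cons_val_zero, Matrix.cons_val_one, dproj_radial]
    exact (congrArg _ (zero_wedge _)).trans (mul_zero _)
  rw [etaTaut, eta_radial, taut_swap p w, h5, h5]
  ring

theorem coneVol_ne_zero (h : Metric M) (p : Cone M) : coneVol h p ≠ 0 := by
  intro h0
  let w : Fin 3 → TangentSpace coneModel p :=
    ![radial p, hlift h p (e (proj p) 0), hlift h p (e (proj p) 1)]
  have h1 : coneVol h p (fun i => w ((finCongr finrank_cone).symm i)) = 0 := by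
    rw [h0]; rfl
  rw [coneVol_apply] at h1
  simp only [Equiv.symm_apply_apply] at h1
  have h2 : 3 * etaTaut h p (radial p) (hlift h p (e (proj p) 0)) (hlift h p (e (proj p) 1)) = 0 := h1
  rw [etaTaut_radial, taut_eq] at h2
  simp only [Matrix.cons_val_zero, Matrix.cons_val_one, dproj_hlift] at h2
  have h3 : wedge (e (proj p) 0) (e (proj p) 1) = 1 := by simp [wedge, e]
  rw [h3] at h2
  have := component_ne_zero p
  simp [this] at h2

theorem taut_smooth {V W : Π q : Cone M, TangentSpace coneModel q} (hV : IsSmoothField V)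
    (hW : IsSmoothField W) :
    ContMDiff coneModel 𝓘(ℝ, ℝ) ∞ (fun q => tautological M q ![V q, W q]) := by
  intro p
  have hv := fun j => coneCoord_smoothAt (hV p) j
  have hw := fun j => coneCoord_smoothAt (hW p) j
  have hf := fib_smoothAt (mem_chart_source Plane (proj p))
  refine (hf.mul (((hv 0).mul (hw 1)).sub ((hv 1).mul (hw 0)))).congr_of_eventuallyEq ?_
  filter_upwards [proj_source_eventually p] with q hq
  exact taut_eq_fib hq _

theorem coneVol_isParallelVolume {h : Metric M} {D : Connection (𝓡 2) M} (hD : IsAreaParallel h D)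
    (P : SymForm M) (U : Set (Cone M)) : IsParallelVolume (coneConn h D P 1) (coneVol h) U where
  smooth X hX := by
    have h1 := fun i => eta_smooth h (hX i)
    have h2 := fun i j => taut_smooth (hX i) (hX j)
    exact (contMDiff_const.mul ((((h1 _).mul (h2 _ _)).add ((h1 _).mul (h2 _ _))).add
      ((h1 _).mul (h2 _ _)))).contMDiffOn
  ne_zero p _ := coneVol_ne_zero h p
  parallel p _ u v := (covTensor_reindex (coneConn h D P 1) finrank_cone
    (fun q v => 3 * etaTaut h q (v 0) (v 1) (v 2) : CoTensor coneModel (Cone M) 3) p u v).trans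
      (covTensor_etaTaut hD P 3 p u _)

end Volume

/-! ### The Kähler affine Ricci tensors -/

section Ricci

variable [T2Space M] {h : Metric M} {κ : M → ℝ} (hκ : ContMDiff (𝓡 2) 𝓘(ℝ, ℝ) ∞ κ)
  (hκ0 : ∀ x, κ x ≠ 0) {α β : Cone M → ℝ} (hα : ContMDiff coneModel 𝓘(ℝ, ℝ) ∞ α)
  (hβ : ContMDiff coneModel 𝓘(ℝ, ℝ) ∞ β) (hα0 : ∀ p, α p ≠ 0) (hβ0 : ∀ p, β p ≠ 0)

/-- In the coframe formed by η and the two projected coordinates the metric has the block matrix Q.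
If B holds the components of the given vectors, their Gram matrix is B Q Bᵀ, while η ∧ μ takes the
value `component p` times det B on them. -/
theorem coneMetric_det (p : Cone M) {k : ℕ} (hk : 3 = k) (b : Fin k → TangentSpace coneModel p) :
    component p ^ 2 * (Matrix.of fun i j =>
      (coneMetric h hκ hκ0 hα hβ hα0 hβ0).form p (b i) (b j)).det =
      α p * β p ^ 2 * κ (proj p) ^ 2 * (gram h (proj p)).det *
        etaTaut h p (b (finCongr hk 0)) (b (finCongr hk 1)) (b (finCongr hk 2)) ^ 2 := by
  subst hk
  let G := gram h (proj p)
  let Q : Matrix (Fin 3) (Fin 3) ℝ := !![α p, 0, 0; 0, β p * κ (proj p) * G 0 0, β p * κ (proj p) * G 0 1;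
    0, β p * κ (proj p) * G 0 1, β p * κ (proj p) * G 1 1]
  let B : Matrix (Fin 3) (Fin 3) ℝ := Matrix.of fun i => ![eta h p (b i),
    (show Plane from dproj p (b i)) 0, (show Plane from dproj p (b i)) 1]
  have h1 : (Matrix.of fun i j => (coneMetric h hκ hκ0 hα hβ hα0 hβ0).form p (b i) (b j)) =
      B * Q * B.transpose := by
    ext i j
    rw [Matrix.of_apply, coneMetric_apply, inner_eq h (proj p)]
    simp [Matrix.mul_apply, Fin.sum_univ_three, B, Q, G, gram]
    ring
  have h2 : etaTaut h p (b 0) (b 1) (b 2) = component p * B.det := by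
    rw [Matrix.det_fin_three]
    simp only [etaTaut, taut_eq, wedge, B, Matrix.of_apply, Matrix.cons_val_zero,
      Matrix.cons_val_one, Matrix.cons_val]
    ring
  have h3 : Q.det = α p * β p ^ 2 * κ (proj p) ^ 2 * (gram h (proj p)).det := by
    rw [Matrix.det_fin_three, gram_det]
    simp [Q, G, gram]
    ring
  rw [h1, Matrix.det_mul, Matrix.det_mul, Matrix.det_transpose, h3]
  simp only [finCongr_refl, Equiv.refl_apply]
  rw [h2]
  ring

/-- The volume form is 3η ∧ μ, whence the factor 9 from its square. Its value on a basis is nonzero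
and can be divided out. -/
theorem coneMetric_detRatio (p : Cone M) :
    detRatio (coneMetric h hκ hκ0 hα hβ hα0 hβ0) (coneVol h) p =
      α p * β p ^ 2 * κ (proj p) ^ 2 * (gram h (proj p)).det / (9 * component p ^ 2) := by
  let b : Module.Basis (Fin (Module.finrank ℝ (Plane × ℝ))) ℝ (TangentSpace coneModel p) :=
    Module.finBasis ℝ (Plane × ℝ)
  have h1 := coneMetric_det (h := h) hκ hκ0 hα hβ hα0 hβ0 p finrank_cone b
  have h2 : coneVol h p b ≠ 0 :=
    (AlternatingMap.map_basis_ne_zero_iff b (coneVol h p)).2 (coneVol_ne_zero h p)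
  have hc := component_ne_zero p
  have h3 : detRatio (coneMetric h hκ hκ0 hα hβ hα0 hβ0) (coneVol h) p = (Matrix.of fun i j =>
      (coneMetric h hκ hκ0 hα hβ hα0 hβ0).form p (b i) (b j)).det / (coneVol h p b) ^ 2 := rfl
  rw [h3]
  rw [coneVol_apply] at h2 ⊢
  rw [div_eq_div_iff (pow_ne_zero 2 h2) (by positivity)]
  linear_combination 9 * h1

end Ricci

end

end AH

namespace AH

open Affine

noncomputable section

variable {M : Type*} [TopologicalSpace M] [ChartedSpace Plane M] [IsManifold (𝓡 2) ∞ M]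

/-! ### The two Hessian metrics -/

section Hessian

variable [T2Space M] {D : TorsionFree M} {h : Metric M}
  (hs : IsSpecial D h (fun x => scal D h x / 2))

include hs

theorem IsSpecial.ne_zero (x : M) : (fun x => scal D h x / 2) x ≠ 0 := (hs.neg x).ne

theorem IsSpecial.ric_eq (x : M) (v w : TangentSpace (𝓡 2) x) :
    ric D.conn x v w = (schouten h hs.smooth).form x v w := by
  have h1 : ∀ v : TangentSpace (𝓡 2) x, wedge (e x 0) v = (show Plane from v) 1 := fun v => by
    simp [wedge, e]
  have h2 : ∀ v : TangentSpace (𝓡 2) x, wedge (e x 1) v = - (show Plane from v) 0 := fun v => by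
    simp [wedge, e]
  rw [(riemann_eq_ric D x v v w).2, hs.curvature, schouten_apply]
  have h3 : ∀ (a b : ℝ) (P Q v : Plane), wedge (a • P - b • Q) v = a * wedge P v - b * wedge Q v :=
    fun a b P Q v => by
      simp only [wedge, PiLp.sub_apply, PiLp.smul_apply, smul_eq_mul]
      ring
  refine (h3 _ _ (e x 0) (e x 1) v).trans ?_
  have h4 : wedge (e x 0) v = (show Plane from v) 1 := h1 v
  have h5 : wedge (e x 1) v = - (show Plane from v) 0 := h2 v
  rw [h4, h5, inner_eq h x v w, inner_eq h x (e x 0) w, inner_eq h x (e x 1) w]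
  simp [e]
  ring

theorem IsSpecial.isFlat : IsFlat (coneConn h D.conn (schouten h hs.smooth) 1) :=
  IsConeLike.isFlat (coneConn_isConeLike h (schouten h hs.smooth) D.smooth D.torsion_eq) D.smooth
    D.torsion_eq hs.schouten_codazzi fun x u v w => hs.curvature x u v w

theorem IsSpecial.agree {T : Connection coneModel (Cone M)} (hT : IsThomas (Quotient.mk _ D) T) :
    Agree T (coneConn h D.conn (schouten h hs.smooth) 1) := hT.agree hs.area hs.ric_eq

/-- The Lorentzian metric `g = v (η ⊗ η + κ h)`. -/
def IsSpecial.metricG : PseudoMetric coneModel (Cone M) :=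
  coneMetric h hs.smooth hs.ne_zero hs.vLift_smooth hs.vLift_smooth (fun p => (hs.vLift_pos p).ne')
    (fun p => (hs.vLift_pos p).ne')

/-- The Riemannian metric `f = 3 (η ⊗ η - κ h)`. -/
def IsSpecial.metricF : PseudoMetric coneModel (Cone M) :=
  coneMetric h hs.smooth hs.ne_zero (α := fun _ => 3) (β := fun _ => -3) contMDiff_const
    contMDiff_const (fun _ => by norm_num) (fun _ => by norm_num)

theorem IsSpecial.metricG_apply (p : Cone M) (v w : TangentSpace coneModel p) :
    hs.metricG.form p v w = vLift D h p * (eta h p v * eta h p w) +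
      vLift D h p * (scal D h (proj p) / 2 * h.inner (proj p) (dproj p v) (dproj p w)) := rfl

theorem IsSpecial.metricF_apply (p : Cone M) (v w : TangentSpace coneModel p) :
    hs.metricF.form p v w = 3 * (eta h p v * eta h p w) +
      -3 * (scal D h (proj p) / 2 * h.inner (proj p) (dproj p v) (dproj p w)) := rfl

variable {T : Connection coneModel (Cone M)} (hT : IsThomas (Quotient.mk _ D) T)

include hT

theorem IsSpecial.thomas_isFlat : IsFlat T :=
  (hs.agree hT).symm.isFlat (coneConn_smooth h D.conn _ 1 D.smooth) hs.isFlat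

theorem IsSpecial.isHessianMetric_metricG : IsHessianMetric T hs.metricG (potentialG D h) where
  smooth_connection := hT.smooth
  flat := hs.thomas_isFlat hT
  smooth_potential := hs.potentialG_smooth
  hessian p v w := by
    rw [(hs.agree hT).hess, hess_coneConn h D.conn _ hs.potentialG_smooth hs.vLift_smooth
      hs.mvfderiv_potentialG, hs.mvfderiv_vLift, hs.metricG_apply, schouten_apply]
    ring

theorem IsSpecial.hess_potentialF (p : Cone M) (v w : TangentSpace coneModel p) :
    hess T (potentialF D h) p v w = hs.metricF.form p v w := by
  rw [(hs.agree hT).hess, hess_coneConn h D.conn _ hs.potentialF_smooth (ψ := fun _ => -3)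
    contMDiff_const hs.mvfderiv_potentialF, mvfderiv_const, zero_apply, hs.metricF_apply,
    schouten_apply]
  ring

theorem IsSpecial.isHessianMetric_metricF : IsHessianMetric T hs.metricF (potentialF D h) where
  smooth_connection := hT.smooth
  flat := hs.thomas_isFlat hT
  smooth_potential := hs.potentialF_smooth
  hessian p v w := (hs.hess_potentialF hT p v w).symm

omit hT

theorem IsSpecial.metricG_neg (p : Cone M) (v : TangentSpace coneModel p) (hη : eta h p v = 0)
    (hv : v ≠ 0) : hs.metricG.form p v v < 0 := by
  have h1 : dproj p v ≠ 0 := fun h0 =>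
    hv (cone_ext h (by rw [h0, map_zero]) (by rw [hη, map_zero]))
  have h2 : 0 < h.inner (proj p) (dproj p v) (dproj p v) := h.pos _ _ h1
  have h3 := hs.vLift_pos p
  have h4 : scal D h (proj p) / 2 < 0 := hs.neg (proj p)
  rw [hs.metricG_apply, hη]
  nlinarith [mul_pos h3 (mul_pos (neg_pos.2 h4) h2)]

theorem IsSpecial.metricG_isLorentzian : hs.metricG.IsLorentzian := by
  intro p
  have h3 := hs.vLift_pos p
  refine ⟨radial p, ?_, fun v hv hv0 => hs.metricG_neg p v ?_ hv0⟩
  · rw [hs.metricG_apply, eta_radial, dproj_radial, map_zero, mul_zero, mul_zero]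
    linarith
  · rw [hs.metricG_apply, eta_radial, dproj_radial, map_zero, zero_apply, mul_zero, mul_zero,
      add_zero, one_mul] at hv
    exact (mul_eq_zero.1 hv).resolve_left h3.ne'

theorem IsSpecial.metricF_isRiemannian : hs.metricF.IsRiemannian := by
  intro p v hv
  have h4 : scal D h (proj p) / 2 < 0 := hs.neg (proj p)
  rw [hs.metricF_apply]
  by_cases h1 : dproj p v = 0
  · have h2 : eta h p v ≠ 0 := fun h0 =>
      hv (cone_ext h (by rw [h1, map_zero]) (by rw [h0, map_zero]))
    rw [h1, map_zero, mul_zero, mul_zero, add_zero]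
    have := mul_self_pos.2 h2
    linarith
  · have h2 : 0 < h.inner (proj p) (dproj p v) (dproj p v) := h.pos _ _ h1
    nlinarith [mul_pos (neg_pos.2 h4) h2, mul_self_nonneg (eta h p v)]

/-- The exponent in ṽ is chosen for this: ṽ^{−3} is the square of half the lifted curvature, that is
κ²e^{−6ρ}, and e^{−6ρ} is det h over the squared component. It makes the determinant of g constant.
-/
theorem IsSpecial.vLift_cube (p : Cone M) :
    vLift D h p ^ 3 * ((scal D h (proj p) / 2) ^ 2 * (gram h (proj p)).det) = component p ^ 2 := by
  have h0 := (hs.scalarLift_neg p).ne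
  have h1 : 0 ≤ (scalarLift D h p / 2) ^ 2 := sq_nonneg _
  have h2 : vLift D h p ^ 3 = ((scalarLift D h p / 2) ^ 2)⁻¹ := by
    rw [vLift, ← Real.rpow_natCast, ← Real.rpow_mul h1]
    norm_num
    rw [Real.rpow_neg_one]
  have h3 : (Real.exp (-3 * logRadius h p)) ^ 2 * (component p ^ 2 / (gram h (proj p)).det) = 1 := by
    rw [← exp_logRadius, sq, ← Real.exp_add, ← Real.exp_add,
      show -3 * logRadius h p + -3 * logRadius h p + 6 * logRadius h p = 0 by ring, Real.exp_zero]
  have hd := (gram_det_pos h (proj p)).ne'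
  have hS := scalarLift_eq D h p
  have h4 : scal D h (proj p) ≠ 0 := fun h4 => h0 (by rw [hS, h4, zero_mul])
  rw [h2, hS]
  have h5 := Real.exp_ne_zero (-3 * logRadius h p)
  field_simp at h3 ⊢
  linear_combination -h3

theorem IsSpecial.metricG_detRatio (p : Cone M) : detRatio hs.metricG (coneVol h) p = 1 / 9 := by
  have h1 := hs.vLift_cube p
  have hc := component_ne_zero p
  rw [IsSpecial.metricG, coneMetric_detRatio, div_eq_div_iff (by positivity) (by norm_num)]
  linear_combination 9 * h1

/-- The logarithm of the right side is log 3 + 2F, a Monge–Ampère equation for the potential F; the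
Einstein condition follows by taking its Hessian. -/
theorem IsSpecial.metricF_detRatio (p : Cone M) :
    detRatio hs.metricF (coneVol h) p = 3 * (vLift D h p ^ 3)⁻¹ := by
  have h1 := hs.vLift_cube p
  have hc := component_ne_zero p
  have hv := (hs.vLift_pos p).ne'
  rw [IsSpecial.metricF, coneMetric_detRatio]
  field_simp
  linear_combination 36 * h1

include hT

theorem IsSpecial.isParallelVolume : IsParallelVolume T (coneVol h) univ :=
  (hs.agree hT).parallelVolume (coneVol_isParallelVolume hs.area _ _)

theorem IsSpecial.metricG_isMongeAmpere : IsMongeAmpere T hs.metricG := fun p => by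
  refine ⟨univ, coneVol h, isOpen_univ, mem_univ p, hs.isParallelVolume hT, fun q _ v w => ?_⟩
  have h1 : (fun y => Real.log |detRatio hs.metricG (coneVol h) y|) = fun _ => Real.log |1 / 9| :=
    funext fun y => by rw [hs.metricG_detRatio]
  rw [h1, (hs.agree hT).hess, hess_coneConn h D.conn _ contMDiff_const (ψ := fun _ => 0)
    contMDiff_const (fun q u => by rw [mvfderiv_const, zero_apply, zero_mul]), mvfderiv_const,
    zero_apply]
  ring

theorem IsSpecial.metricF_isKahlerAffineEinstein : IsKahlerAffineEinstein T hs.metricF := by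
  -- The logarithm of the determinant is 2F up to a constant, and the Ricci tensor is minus its
  -- Hessian, hence −2f.
  refine ⟨-2, fun p =>
    ⟨univ, coneVol h, isOpen_univ, mem_univ p, hs.isParallelVolume hT, fun q _ v w => ?_⟩⟩
  have h1 : (fun y => Real.log |detRatio hs.metricF (coneVol h) y|) =
      fun y => Real.log 3 + 2 * potentialF D h y := funext fun y => by
    have hv := hs.vLift_pos y
    rw [hs.metricF_detRatio, abs_of_pos (by positivity), Real.log_mul (by norm_num) (by positivity),
      Real.log_inv, Real.log_pow, potentialF]
    push_cast
    ring
  have h2 : ContMDiff coneModel 𝓘(ℝ, ℝ) ∞ (fun y => Real.log 3 + 2 * potentialF D h y) :=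
    contMDiff_const.add (contMDiff_const.mul hs.potentialF_smooth)
  have h3 : ∀ q u, mvfderiv coneModel (fun y => Real.log 3 + 2 * potentialF D h y) q u =
      -6 * eta h q u := fun q u => by
    have hF := smooth_mdiffAt hs.potentialF_smooth q
    have h4 : ContMDiff coneModel 𝓘(ℝ, ℝ) ∞ (fun y => 2 * potentialF D h y) :=
      contMDiff_const.mul hs.potentialF_smooth
    have e1 := mvfderiv_add (f := fun _ => Real.log 3) mdifferentiableAt_const (smooth_mdiffAt h4 q) u
    refine e1.trans ((congrArg₂ (· + ·) (congrArg (fun L => L u) (mvfderiv_const (I := coneModel) (Real.log 3) (x := q)))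
      (mvfderiv_const_mul 2 hF u)).trans ?_)
    rw [hs.mvfderiv_potentialF]
    simp only [zero_apply]
    ring
  rw [h1, (hs.agree hT).hess, hess_coneConn h D.conn _ h2 (ψ := fun _ => -6) contMDiff_const h3,
    mvfderiv_const, zero_apply, schouten_apply]
  refine (congrArg (-2 * ·) (hs.metricF_apply q v w)).trans ?_
  ring

end Hessian

end

end AH

namespace Affine

noncomputable section

variable {E : Type*} [NormedAddCommGroup E] [NormedSpace ℝ E] [FiniteDimensional ℝ E]
  [CompleteSpace E] {H : Type*} [TopologicalSpace H] {I : ModelWithCorners ℝ E H}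
  {N : Type*} [TopologicalSpace N] [ChartedSpace H N] [IsManifold I ∞ N]

theorem contDiffAt_chart [I.Boundaryless] {F : N → ℝ} (hF : ContMDiff I 𝓘(ℝ, ℝ) ∞ F) (x : N) :
    ContDiffAt ℝ ∞ (F ∘ (extChartAt I x).symm) (extChartAt I x x) := by
  have h1 := (contMDiffAt_iff.1 (hF x)).2
  rw [I.range_eq_univ, contDiffWithinAt_univ] at h1
  exact h1

theorem mvfderiv_chart [I.Boundaryless] {F : N → ℝ} (hF : ContMDiff I 𝓘(ℝ, ℝ) ∞ F) (x : N)
    (v : TangentSpace I x) : mvfderiv I F x v =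
      fderiv ℝ (F ∘ (extChartAt I x).symm) (extChartAt I x x) (v : E) := by
  have h1 := (smooth_mdiffAt hF x).mfderiv
  rw [I.range_eq_univ, fderivWithin_univ] at h1
  exact congrArg (fun L : E →L[ℝ] ℝ => L v) h1

/-- A function vanishing on a regular level set has zero derivative along it. -/
theorem mvfderiv_eq_zero_of_level [I.Boundaryless] {F φ : N → ℝ} (hF : ContMDiff I 𝓘(ℝ, ℝ) ∞ F)
    (hφ : ContMDiff I 𝓘(ℝ, ℝ) ∞ φ) {x : N} (h0 : mvfderiv I φ x ≠ 0)
    (hz : ∀ y, φ y = φ x → F y = 0) {v : TangentSpace I x} (hv : mvfderiv I φ x v = 0) :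
    mvfderiv I F x v = 0 := by
  have hsF := (contDiffAt_chart hF x).hasStrictFDerivAt (by simp)
  have hsφ := (contDiffAt_chart hφ x).hasStrictFDerivAt (by simp)
  have hx : (extChartAt I x).symm (extChartAt I x x) = x := extChartAt_to_inv x
  -- In a chart, F is constant on the level set and thus has a local extremum there. The Lagrange
  -- multiplier rule makes dF proportional to dφ, the coefficient of dF being nonzero because dφ
  -- does not vanish.
  have hextr : IsLocalExtrOn (F ∘ (extChartAt I x).symm)
      {y | (φ ∘ (extChartAt I x).symm) y = (φ ∘ (extChartAt I x).symm) (extChartAt I x x)}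
      (extChartAt I x x) := by
    refine Or.inl (Filter.eventually_of_mem self_mem_nhdsWithin fun y hy => ?_)
    simp only [Function.comp_apply, mem_ofPred_eq, hx] at hy ⊢
    rw [hz _ hy, hz _ rfl]
  obtain ⟨a, b, hab, h1⟩ := hextr.exists_multipliers_of_hasStrictFDerivAt_1d hsφ hsF
  have h2 : ∀ w : TangentSpace I x, a * mvfderiv I φ x w + b * mvfderiv I F x w = 0 := fun w => by
    rw [mvfderiv_chart hφ, mvfderiv_chart hF]
    exact congrArg (fun L : E →L[ℝ] ℝ => L w) h1
  have hb : b ≠ 0 := by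
    rintro rfl
    have ha : a ≠ 0 := fun ha => hab (by rw [ha, Prod.mk_zero_zero])
    refine h0 (ContinuousLinearMap.ext fun w => ?_)
    have := h2 w
    rw [zero_mul, add_zero] at this
    exact (mul_eq_zero.1 this).resolve_left ha
  have h3 := h2 v
  rw [hv, mul_zero, zero_add] at h3
  exact (mul_eq_zero.1 h3).resolve_left hb

/-- The trace of m times the induced metric of a surface is 2m. Definiteness is used to invert the
Gram matrix. -/
theorem hasMeanCurvatureAt_of_umbilic {g : PseudoMetric I N} {L : Connection I N} {φ : N → ℝ}
    {ν : Π x : N, TangentSpace I x} {x : N} {m : ℝ}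
    (hg : ∀ v ∈ levelTangent I φ x, v ≠ 0 → g.form x v v < 0)
    (hm : ∀ v ∈ levelTangent I φ x, ∀ w ∈ levelTangent I φ x,
      secondForm g L ν x v w = m * g.form x v w) : HasMeanCurvatureAt g L φ ν x m := by
  intro e he ht
  set G : Matrix (Fin 2) (Fin 2) ℝ := Matrix.of fun a b => g.form x (e a) (e b) with hG
  have hsymm : ∀ i j, G j i = G i j := fun i j => g.symm x _ _
  have hdet : G.det ≠ 0 := by
    intro h0
    obtain ⟨c, hc0, hc⟩ := Matrix.exists_mulVec_eq_zero_iff.2 h0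
    let u : TangentSpace I x := c 0 • e 0 + c 1 • e 1
    have hu : u ≠ 0 := fun hu => hc0 <| by
      have h1 := Fintype.linearIndependent_iff.1 he c (by rw [Fin.sum_univ_two]; exact hu)
      exact funext h1
    have h1 := hg u (Submodule.add_mem _ (Submodule.smul_mem _ _ (ht 0))
      (Submodule.smul_mem _ _ (ht 1))) hu
    have c0 := congrFun hc 0
    have c1 := congrFun hc 1
    simp only [Matrix.mulVec, dotProduct, Fin.sum_univ_two, Pi.zero_apply, hG, Matrix.of_apply]
      at c0 c1
    have h2 : g.form x u u = 0 := by
      simp only [u, map_add, map_smul, LinearMap.add_apply, LinearMap.smul_apply, smul_eq_mul]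
      linear_combination c 0 * c0 + c 1 * c1
    exact h1.ne h2
  have h1 : ∑ i, ∑ j, G⁻¹ i j * secondForm g L ν x (e i) (e j) = m * (G⁻¹ * G).trace := by
    simp only [Matrix.trace, Matrix.diag, Matrix.mul_apply, Finset.mul_sum]
    refine Finset.sum_congr rfl fun i _ => Finset.sum_congr rfl fun j _ => ?_
    rw [hm _ (ht i) _ (ht j), hsymm i j]
    simp only [hG, Matrix.of_apply]
    ring
  rw [h1, Matrix.nonsing_inv_mul _ (isUnit_iff_ne_zero.2 hdet), Matrix.trace_one, Fintype.card_fin]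
  push_cast
  ring

end

end Affine

namespace AH

open Affine

noncomputable section

variable {M : Type*} [TopologicalSpace M] [ChartedSpace Plane M] [IsManifold (𝓡 2) ∞ M]

/-! ### The level surfaces of the scalar curvature -/

section Levels

variable [T2Space M] {D : TorsionFree M} {h : Metric M}
  (hs : IsSpecial D h (fun x => scal D h x / 2))

include hs

/-- The Levi-Civita connection of `g`. -/
def IsSpecial.connG : Connection coneModel (Cone M) :=
  coneConn h (leviCivita hs.codazzi).conn (schouten h hs.smooth) 1

/-- The Levi-Civita connection of `f`. -/
def IsSpecial.connF : Connection coneModel (Cone M) :=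
  coneConn h (leviCivita hs.codazzi).conn (schouten h hs.smooth) 0

/-- Here α = β = ṽ has degree 2, which matches a = 1: g is a cone metric. -/
theorem IsSpecial.isLeviCivita_metricG : IsLeviCivita hs.metricG hs.connG :=
  coneConn_isLeviCivita hs.smooth hs.ne_zero hs.vLift_smooth hs.vLift_smooth _ _
    (leviCivita hs.codazzi) (leviCivita_nablaMetric hs.codazzi) hs.mvfderiv_eq 1
    (fun p => by rw [sub_self, mul_zero]) (fun p u => by rw [hs.mvfderiv_vLift, mul_one])
    (fun p u => by rw [hs.mvfderiv_vLift, mul_one])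

/-- Here α and β are constant, which matches a = 0: f is locally a product. -/
theorem IsSpecial.isLeviCivita_metricF : IsLeviCivita hs.metricF hs.connF :=
  coneConn_isLeviCivita hs.smooth hs.ne_zero (α := fun _ => 3) (β := fun _ => -3) contMDiff_const
    contMDiff_const _ _ (leviCivita hs.codazzi) (leviCivita_nablaMetric hs.codazzi) hs.mvfderiv_eq 0
    (fun p => by rw [zero_mul]) (fun p u => by rw [mvfderiv_const, zero_apply]; ring)
    (fun p u => by rw [mvfderiv_const, zero_apply]; ring)

/-- For a = 0 the η-component of ∇_X Y is the derivative of η(Y) along X. As Y is tangent only along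
the one level set, η(Y) is known to vanish only there, and `mvfderiv_eq_zero_of_level` is needed. -/
theorem IsSpecial.isTotallyGeodesicLevel (c : ℝ) :
    IsTotallyGeodesicLevel hs.connF (scalarLift D h) c := by
  intro X Y hX hY hXt hYt p hp
  rw [hs.mem_levelTangent, IsSpecial.connF, eta_coneConn, zero_mul, add_zero]
  exact mvfderiv_eq_zero_of_level (eta_smooth h hY) hs.scalarLift_smooth
    (hs.hasSmoothLevelSets.2 p) (fun q hq => (hs.mem_levelTangent q _).1 (hYt q (hq.trans hp)))
    (hXt p hp)

omit hs in
/-- The length of the unit normal of the level surfaces, relative to the radial field. -/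
def normalFactor (D : TorsionFree M) (h : Metric M) (p : Cone M) : ℝ :=
  vLift D h p ^ (-(1 / 2) : ℝ)

theorem IsSpecial.normalFactor_smooth : ContMDiff coneModel 𝓘(ℝ, ℝ) ∞ (normalFactor D h) := by
  intro p
  have h1 : ContDiffAt ℝ ∞ (fun t : ℝ => t ^ (-(1 / 2) : ℝ)) (vLift D h p) :=
    contDiffAt_id.rpow_const_of_ne (hs.vLift_pos p).ne'
  exact h1.contMDiffAt.comp p (hs.vLift_smooth p)

theorem IsSpecial.normalFactor_sq (p : Cone M) :
    vLift D h p * (normalFactor D h p * normalFactor D h p) = 1 := by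
  have hv := hs.vLift_pos p
  rw [normalFactor, ← Real.rpow_add hv, show (-(1 / 2) + -(1 / 2) : ℝ) = -1 by norm_num,
    Real.rpow_neg_one, mul_inv_cancel₀ hv.ne']

omit hs in
/-- The unit normal of the level surfaces. -/
def unitNormal (D : TorsionFree M) (h : Metric M) : Π p : Cone M, TangentSpace coneModel p :=
  normalFactor D h • (radial : Π p : Cone M, TangentSpace coneModel p)

omit hs in
theorem unitNormal_apply (D : TorsionFree M) (h : Metric M) (p : Cone M) :
    unitNormal D h p = normalFactor D h p • radial p := rfl

theorem IsSpecial.metricG_radial (p : Cone M) (v : TangentSpace coneModel p) :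
    hs.metricG.form p (radial p) v = vLift D h p * eta h p v := by
  rw [hs.metricG_apply, eta_radial, dproj_radial, map_zero, zero_apply]
  ring

theorem IsSpecial.isUnitNormal : IsUnitNormal hs.metricG (scalarLift D h) (unitNormal D h) := by
  refine ⟨hs.normalFactor_smooth.smul_section radial_smooth, fun p => ⟨?_, fun v hv => ?_⟩⟩
  · rw [unitNormal_apply, map_smul, map_smul, LinearMap.smul_apply, hs.metricG_radial, eta_radial]
    have := hs.normalFactor_sq p
    rw [show normalFactor D h p • normalFactor D h p • (vLift D h p * 1) = 1 by
      simp only [smul_eq_mul]; linear_combination this, abs_one]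
  · rw [unitNormal_apply, map_smul, LinearMap.smul_apply, hs.metricG_radial,
      (hs.mem_levelTangent p v).1 hv, mul_zero, smul_zero]

/-- The unit normal is s𝕏 with ∇𝕏 = id, so its derivative along v is sv plus a multiple of 𝕏, and
the latter is orthogonal to w. -/
theorem IsSpecial.secondForm_metricG (p : Cone M) (v w : TangentSpace coneModel p)
    (hw : w ∈ levelTangent coneModel (scalarLift D h) p) :
    secondForm hs.metricG hs.connG (unitNormal D h) p v w =
      -normalFactor D h p * hs.metricG.form p v w := by
  have h1 := conn_smul hs.connG (smooth_mdiffAt hs.normalFactor_smooth p)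
    (radial_smooth.mdiffAt p) v
  have h2 : hs.connG radial p v = v := by
    rw [IsSpecial.connG, coneConn_radial, one_smul]
  rw [h2] at h1
  have h3 : hs.metricG.form p (hs.connG (unitNormal D h) p v) w =
      normalFactor D h p * hs.metricG.form p v w := by
    refine (congrArg (fun z => hs.metricG.form p z w) h1).trans ?_
    simp only [map_add, map_smul, LinearMap.add_apply, LinearMap.smul_apply, smul_eq_mul,
      hs.metricG_radial, (hs.mem_levelTangent p w).1 hw]
    ring
  rw [secondForm, h3]
  ring

theorem IsSpecial.metricG_spacelike (p : Cone M) (v : TangentSpace coneModel p)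
    (hv : v ∈ levelTangent coneModel (scalarLift D h) p) (h0 : v ≠ 0) :
    hs.metricG.form p v v < 0 := hs.metricG_neg p v ((hs.mem_levelTangent p v).1 hv) h0

theorem IsSpecial.isUmbilicAt (p : Cone M) :
    IsUmbilicAt hs.metricG hs.connG (scalarLift D h) (unitNormal D h) p :=
  ⟨-normalFactor D h p, fun v _ w hw => hs.secondForm_metricG p v w hw⟩

theorem IsSpecial.hasMeanCurvatureAt (p : Cone M) :
    HasMeanCurvatureAt hs.metricG hs.connG (scalarLift D h) (unitNormal D h) p
      (-normalFactor D h p) :=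
  hasMeanCurvatureAt_of_umbilic (hs.metricG_spacelike p)
    fun v _ w hw => hs.secondForm_metricG p v w hw

-- The factor is a function of the lifted curvature alone, which is why the mean curvature is
-- constant on each level set.
omit hs in
theorem normalFactor_eq (D : TorsionFree M) (h : Metric M) (p : Cone M) :
    normalFactor D h p = (((scalarLift D h p / 2) ^ 2) ^ (-(1 / 3) : ℝ)) ^ (-(1 / 2) : ℝ) := rfl

end Levels

end

end AH

theorem mainTheorem10 {M : Type*} [TopologicalSpace M] [ChartedSpace AH.Plane M]
    [IsManifold (𝓡 2) ∞ M] [T2Space M] [SecondCountableTopology M]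
    (A : AH.Structure M) (hexact : A.IsExact) (heinstein : A.IsEinstein)
    (hneg : A.HasNegativeScalar) :
    (∃ T : Affine.Connection AH.coneModel (AH.Cone M), AH.IsThomas A.proj T) ∧
    ∀ T : Affine.Connection AH.coneModel (AH.Cone M), AH.IsThomas A.proj T →
    ∀ (D : AH.TorsionFree M) (h : AH.Metric M), A.IsAligned D →
      (Quotient.mk _ h : AH.ConformalStructure M) = A.conf →
      Affine.HasSmoothLevelSets AH.coneModel (AH.scalarLift D h) ∧
      (∃ g : Affine.PseudoMetric AH.coneModel (AH.Cone M),
        Affine.IsHessianMetric T g (AH.potentialG D h) ∧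
        g.IsLorentzian ∧
        Affine.IsMongeAmpere T g ∧
        (∀ p, ∀ v ∈ Affine.levelTangent AH.coneModel (AH.scalarLift D h) p, v ≠ 0 →
          g.form p v v < 0) ∧
        ∃ (L : Affine.Connection AH.coneModel (AH.Cone M))
          (ν : Π p : AH.Cone M, TangentSpace AH.coneModel p),
          Affine.IsLeviCivita g L ∧
          Affine.IsUnitNormal g (AH.scalarLift D h) ν ∧
          ∀ c : ℝ,
            (∀ p, AH.scalarLift D h p = c → Affine.IsUmbilicAt g L (AH.scalarLift D h) ν p) ∧
            ∃ m : ℝ, ∀ p, AH.scalarLift D h p = c →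
              Affine.HasMeanCurvatureAt g L (AH.scalarLift D h) ν p m) ∧
      (∃ f : Affine.PseudoMetric AH.coneModel (AH.Cone M),
        Affine.IsHessianMetric T f (AH.potentialF D h) ∧
        f.IsRiemannian ∧
        Affine.IsKahlerAffineEinstein T f ∧
        ∃ L : Affine.Connection AH.coneModel (AH.Cone M),
          Affine.IsLeviCivita f L ∧
          ∀ c : ℝ, Affine.IsTotallyGeodesicLevel L (AH.scalarLift D h) c) := by
  obtain ⟨D₀, h₀, hD₀, hh₀, hpar⟩ := hexact
  have hs := AH.isSpecial_of_isEinstein heinstein hneg hD₀ hh₀ hpar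
  refine ⟨⟨_, hD₀.1 ▸ hs.isThomas⟩, fun T hT D h hD hh => ?_⟩
  -- The claims concern every aligned D and every metric of the conformal class. Uniqueness of the
  -- aligned representative and conformal invariance of the lifted curvature reduce them to the pair
  -- given by exactness.
  have hagree : Affine.Agree D₀.conn D.conn :=
    AH.agree_of_aligned (Quotient.exact (hD.1.trans hD₀.1.symm)) (hD.2 h₀ hh₀) hpar
      (hD₀.2 h₀ hh₀)
  have hS : AH.scalarLift D h = AH.scalarLift D₀ h₀ :=
    AH.scalarLift_congr hagree (Quotient.exact (hh₀.trans hh.symm))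
  have hv : AH.vLift D h = AH.vLift D₀ h₀ := funext fun p => by rw [AH.vLift, AH.vLift, hS]
  have hG : AH.potentialG D h = AH.potentialG D₀ h₀ :=
    funext fun p => by rw [AH.potentialG, AH.potentialG, hv]
  have hF : AH.potentialF D h = AH.potentialF D₀ h₀ :=
    funext fun p => by rw [AH.potentialF, AH.potentialF, hv]
  rw [← hD₀.1] at hT
  rw [hS, hG, hF]
  exact ⟨hs.hasSmoothLevelSets,
    ⟨hs.metricG, hs.isHessianMetric_metricG hT, hs.metricG_isLorentzian,
      hs.metricG_isMongeAmpere hT, hs.metricG_spacelike, hs.connG, AH.unitNormal D₀ h₀,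
      hs.isLeviCivita_metricG, hs.isUnitNormal, fun c => ⟨fun p _ => hs.isUmbilicAt p,
        -- This is −ṽ^{−1/2} where the lifted curvature equals c.
        -(((c / 2) ^ 2) ^ (-(1 / 3) : ℝ)) ^ (-(1 / 2) : ℝ), fun p hp => by
          rw [← hp, ← AH.normalFactor_eq]
          exact hs.hasMeanCurvatureAt p⟩⟩,
    ⟨hs.metricF, hs.isHessianMetric_metricF hT, hs.metricF_isRiemannian,
      hs.metricF_isKahlerAffineEinstein hT, hs.connF, hs.isLeviCivita_metricF,
      hs.isTotallyGeodesicLevel⟩⟩
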